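/- An instance of the node-weighted Steiner tree augmentation problem (NW-STAP) consists of a finite simple graph $G=(V,E)$, a set of terminals $R\subseteq V$, a subgraph $T=(R,E(T))$ of $G$ that is a tree with vertex set exactly $R$, and a non-negative rational cost $c_v$ for every Steiner node $v\in V\setminus R$. A set $S\subseteq V\setminus R$ is feasible if the induced subgraph $G[R\cup S]$ is 2-edge-connected, i.e. remains connected after the deletion of any single edge (a one-vertex graph counts as 2-edge-connected); its cost is $c(S)=\sum_{v\in S}c_v$. There are an absolute constant $C$ and an algorithm (a program for a unit-cost random access machine with addition, subtraction and halving) that, for every instance of NW-STAP, halts after a number of steps polynomial in the bit length of the instance (with costs written in binary as fractions) and outputs a set $A\subseteq V$ such that, whenever the instance has a feasible set, $A$ is feasible and $$c(A)\le C\,(\log|R|)^2\,c(S)\qquad\text{for every feasible set } S .$$ That is, NW-STAP has a polynomial-time $O(\log^2|R|)$-approximation algorithm. -/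

import Mathlib

/-! ### A random access machine with unit-cost steps

The machine has registers and arrays, all of whose cells hold natural numbers of arbitrary size.
Its arithmetic consists of addition, truncated subtraction and halving; there is no multiplication,
so a number grows by at most one bit per operation and the number of steps is polynomially related
to the running time of a Turing machine. Programs are finite and structured. -/

namespace RAM

/-- Expressions. The names of registers and arrays are fixed in the program, the index into an
array is computed. -/
inductive Expr where
  | lit (n : ℕ)
  | reg (r : ℕ)
  | get (a : ℕ) (i : Expr)
  | add (e₁ e₂ : Expr)
  | sub (e₁ e₂ : Expr)
  | half (e : Expr)

/-- Programs: doing nothing, assignment to a register, assignment to an array cell, composition,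
branching on whether an expression is nonzero, and iteration while an expression is nonzero. -/
inductive Prog where
  | skip
  | assign (r : ℕ) (e : Expr)
  | store (a : ℕ) (i e : Expr)
  | seq (p q : Prog)
  | branch (e : Expr) (p q : Prog)
  | loop (e : Expr) (p : Prog)

/-- The contents of the registers and of the arrays. -/
@[ext]
structure State where
  reg : ℕ → ℕ
  arr : ℕ → ℕ → ℕ

namespace Expr

/-- The value of an expression. -/
def eval (s : State) : Expr → ℕ
  | lit n => n
  | reg r => s.reg r
  | get a i => s.arr a (i.eval s)
  | add e₁ e₂ => e₁.eval s + e₂.eval s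
  | sub e₁ e₂ => e₁.eval s - e₂.eval s
  | half e => e.eval s / 2

/-- The number of elementary operations in the evaluation of an expression. -/
def cost : Expr → ℕ
  | lit _ => 1
  | reg _ => 1
  | get _ i => i.cost + 1
  | add e₁ e₂ => e₁.cost + e₂.cost + 1
  | sub e₁ e₂ => e₁.cost + e₂.cost + 1
  | half e => e.cost + 1

end Expr

namespace State

/-- Overwrite the register `r`. -/
def setReg (s : State) (r v : ℕ) : State :=
  { s with reg := Function.update s.reg r v }

/-- Overwrite the cell `i` of the array `a`. -/
def setArr (s : State) (a i v : ℕ) : State :=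
  { s with arr := Function.update s.arr a (Function.update (s.arr a) i v) }

/-- The initial state on the input `x`: the entries of `x` are in array `0`, the length of `x` is in
register `0`, and everything else is `0`. -/
def init (x : List ℕ) : State where
  reg r := if r = 0 then x.length else 0
  arr a i := if a = 0 then x.getD i 0 else 0

/-- The output in a final state: the list whose length is in register `0` and whose entries are in
array `0`. -/
def output (s : State) : List ℕ :=
  (List.range (s.reg 0)).map (s.arr 0)

end State

/-- `Exec p s t s'` says that the program `p`, started in the state `s`, halts after exactly `t`
steps in the state `s'`. -/
inductive Exec : Prog → State → ℕ → State → Prop where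
  | skip (s : State) : Exec .skip s 1 s
  | assign (r : ℕ) (e : Expr) (s : State) :
      Exec (.assign r e) s (e.cost + 1) (s.setReg r (e.eval s))
  | store (a : ℕ) (i e : Expr) (s : State) :
      Exec (.store a i e) s (i.cost + e.cost + 1) (s.setArr a (i.eval s) (e.eval s))
  | seq {p q : Prog} {s s' s'' : State} {t t' : ℕ} :
      Exec p s t s' → Exec q s' t' s'' → Exec (.seq p q) s (t + t') s''
  | branch_true {e : Expr} {p q : Prog} {s s' : State} {t : ℕ} :
      e.eval s ≠ 0 → Exec p s t s' → Exec (.branch e p q) s (e.cost + 1 + t) s'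
  | branch_false {e : Expr} {p q : Prog} {s s' : State} {t : ℕ} :
      e.eval s = 0 → Exec q s t s' → Exec (.branch e p q) s (e.cost + 1 + t) s'
  | loop_true {e : Expr} {p : Prog} {s s' s'' : State} {t t' : ℕ} :
      e.eval s ≠ 0 → Exec p s t s' → Exec (.loop e p) s' t' s'' →
        Exec (.loop e p) s (e.cost + 1 + t + t') s''
  | loop_false {e : Expr} {p : Prog} {s : State} :
      e.eval s = 0 → Exec (.loop e p) s (e.cost + 1) s

/-- The size of a list of natural numbers written in binary, with one separator per entry. -/
def bitLength (x : List ℕ) : ℕ :=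
  (x.map fun k => Nat.size k + 1).sum

/-- One fixed program produces the output `out a` on the input `inp a`, for every `a`, in a number
of steps that is bounded by a polynomial in the bit length of the input. -/
def PolyTimeComputable {α : Type*} (inp out : α → List ℕ) : Prop :=
  ∃ (P : Prog) (p : Polynomial ℕ), ∀ a : α, ∃ (t : ℕ) (s : State),
    Exec P (State.init (inp a)) t s ∧ t ≤ p.eval (bitLength (inp a)) ∧ s.output = out a

end RAM

/-! ### Node-weighted Steiner tree augmentation -/

/-- An instance of the node-weighted Steiner tree augmentation problem: a graph `G` on the vertices
`0, …, n - 1`, a set `R` of terminals, a subgraph `T` of `G` that is a tree with vertex set `R`, and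
nonnegative rational costs of the Steiner nodes, i.e. the vertices outside `R` (terminals carry the
value `0`). -/
structure NWSTAP where
  n : ℕ
  G : SimpleGraph (Fin n)
  R : Finset (Fin n)
  T : G.Subgraph
  verts_T : T.verts = (R : Set (Fin n))
  isTree_T : T.coe.IsTree
  c : Fin n → ℚ≥0
  c_terminal : ∀ v ∈ R, c v = 0

namespace NWSTAP

/-- A set `S` of Steiner nodes is feasible if `G[R ∪ S]` is 2-edge-connected. -/
def Feasible (I : NWSTAP) (S : Finset (Fin I.n)) : Prop :=
  Disjoint S I.R ∧ (I.G.induce ((I.R ∪ S : Finset (Fin I.n)) : Set (Fin I.n))).IsEdgeConnected 2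

/-- The cost of a set of Steiner nodes. -/
def cost (I : NWSTAP) (S : Finset (Fin I.n)) : ℚ≥0 :=
  ∑ v ∈ S, I.c v

open Classical in
/-- A set of vertices as the list of its `n` indicator bits. -/
noncomputable def encodeSet (I : NWSTAP) (S : Finset (Fin I.n)) : List ℕ :=
  List.ofFn fun v => if v ∈ S then 1 else 0

open Classical in
/-- A binary relation on the vertices as the list, row by row, of the entries of its matrix. -/
noncomputable def encodeRel (I : NWSTAP) (r : Fin I.n → Fin I.n → Prop) : List ℕ :=
  (List.finRange I.n).flatMap fun u => (List.finRange I.n).map fun v => if r u v then 1 else 0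

/-- The encoding of an instance: the number of vertices, the adjacency matrices of `G` and of `T`,
the indicator bits of `R`, and the numerator and denominator of the cost of every vertex. -/
noncomputable def encode (I : NWSTAP) : List ℕ :=
  [I.n] ++ I.encodeRel I.G.Adj ++ I.encodeRel I.T.Adj ++ I.encodeSet I.R ++
    (List.finRange I.n).flatMap fun v => [(I.c v).num, (I.c v).den]

end NWSTAP

/-! Call the edges of G outside T links. A set M ⊇ R covers a tree edge ab if a and b stay connected
in G[M] after the deletion of ab. This happens exactly when some component of the links inside M
contains terminals on both sides of ab (`covers_of_crosses`, `Covers.exists_crossing`). Covering all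
tree edges is enough: after discarding the vertices that a single edge deletion separates from R,
what is left is feasible (`feasible_of_covers`). So tree edges have to be covered by components of
links, and this is done greedily with spiders: a center v together with cheapest link paths (legs)
from v to some terminals (feet).

The greedy rounds have thresholds λ = 1, 2, 4, …. For each center v and first foot r a spider is
grown foot by foot, a leg being added if it costs at most λ per newly covered edge, and the result
is kept if it costs at most 2λ per newly covered edge. Kept or not, from then on every spider with
center v and foot set Y ∋ r costs at least λ times the number of uncovered edges crossed by Y
(`SpiderInv.finish_accept`, `SpiderInv.finish_reject`).

The combinatorial core is `exists_path_of_spiders`: a connected set K decomposes into spiders of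
total cost at most (log₂|R| + 2) w(K). The number of uncovered edges crossed is subadditive on
intersecting sets of terminals, so after the round with threshold λ the number u of uncovered edges
satisfies λ u ≤ (log₂|R| + 2) w(S) for every S ⊇ R covering all edges (`Level.mul_uncovered_le`).
This is the first logarithm. Since thresholds only double, an edge covered while u edges are
uncovered is charged O((log|R| + 1) w(S) / u), and the harmonic sum over u gives the second one
(`cost_le_harmonic`).

The round with threshold 1 has no earlier bound to rely on and may cost 2 u₀, where u₀ ≤ |R|² counts
the oriented tree edges not covered at the start. Costs are therefore scaled to integers divisible
by 4n² > 2 u₀: a positive optimum absorbs this term, and an optimum 0 forces the cost 0.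

On the machine all of this is a program with counting loops bounded by n and by the bit length B of
the input. Its effect is a function, `Cmd.run`, reasoned about by loop invariants, and
`Cmd.exec_compile` yields the polynomial time bound. Bellman–Ford computes the legs and also tests
connectivity after an edge deletion. B rounds suffice because 2^B dominates all scaled weights. -/

namespace RAM

/-! ### Counting-loop programs: semantics, frame property, running time -/

/-- Programs whose only loops are counting loops: `loopTo r b p` runs `p` with the register `r` set
to `0, 1, …` up to the value of the register `b`. -/
inductive Cmd where
  | skip
  | assign (r : ℕ) (e : Expr)
  | store (a : ℕ) (i e : Expr)
  | seq (p q : Cmd)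
  | ite (e : Expr) (p q : Cmd)
  | loopTo (r b : ℕ) (p : Cmd)

namespace Cmd

/-- The translation into programs of the machine. -/
def compile : Cmd → Prog
  | skip => .skip
  | assign r e => .assign r e
  | store a i e => .store a i e
  | seq p q => .seq p.compile q.compile
  | ite e p q => .branch e p.compile q.compile
  | loopTo r b p => .seq (.assign r (.lit 0))
      (.loop (.sub (.reg b) (.reg r)) (.seq p.compile (.assign r (.add (.reg r) (.lit 1)))))

/-- `k` rounds of a counting loop with counter `r` and body `f`. -/
def iter (f : State → State) (r : ℕ) (s : State) : ℕ → State
  | 0 => s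
  | k + 1 => f ((iter f r s k).setReg r k)

/-- The final state. -/
def run : Cmd → State → State
  | skip, s => s
  | assign r e, s => s.setReg r (e.eval s)
  | store a i e, s => s.setArr a (i.eval s) (e.eval s)
  | seq p q, s => q.run (p.run s)
  | ite e p q, s => if e.eval s ≠ 0 then p.run s else q.run s
  | loopTo r b p, s => (iter p.run r s (s.reg b)).setReg r (s.reg b)

/-- The registers that a command may write. -/
def regs : Cmd → List ℕ
  | skip => []
  | assign r _ => [r]
  | store _ _ _ => []
  | seq p q => p.regs ++ q.regs
  | ite _ p q => p.regs ++ q.regs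
  | loopTo r _ p => r :: p.regs

/-- The arrays that a command may write. -/
def arrs : Cmd → List ℕ
  | skip => []
  | assign _ _ => []
  | store a _ _ => [a]
  | seq p q => p.arrs ++ q.arrs
  | ite _ p q => p.arrs ++ q.arrs
  | loopTo _ _ p => p.arrs

/-- All loops are bounded by registers from `bs`, and no bound and no counter is overwritten. -/
def WF (bs : List ℕ) : Cmd → Prop
  | skip => True
  | assign r _ => r ∉ bs
  | store _ _ _ => True
  | seq p q => p.WF bs ∧ q.WF bs
  | ite _ p q => p.WF bs ∧ q.WF bs
  | loopTo r b p => b ∈ bs ∧ r ∉ bs ∧ r ∉ p.regs ∧ p.WF bs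

instance decidableWF (bs : List ℕ) : (p : Cmd) → Decidable (p.WF bs)
  | skip => .isTrue trivial
  | assign r _ => inferInstanceAs (Decidable (r ∉ bs))
  | store _ _ _ => .isTrue trivial
  | seq p q => @instDecidableAnd _ _ (decidableWF bs p) (decidableWF bs q)
  | ite _ p q => @instDecidableAnd _ _ (decidableWF bs p) (decidableWF bs q)
  | loopTo r b p =>
    have := decidableWF bs p
    inferInstanceAs (Decidable (b ∈ bs ∧ r ∉ bs ∧ r ∉ p.regs ∧ p.WF bs))

/-- A bound for the running time when all loops have at most `X` rounds. -/
noncomputable def timeBound : Cmd → Polynomial ℕ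
  | skip => 1
  | assign _ e => Polynomial.C (e.cost + 1)
  | store _ i e => Polynomial.C (i.cost + e.cost + 1)
  | seq p q => p.timeBound + q.timeBound
  | ite e p q => Polynomial.C (e.cost + 1) + p.timeBound + q.timeBound
  | loopTo _ _ p => Polynomial.C 6 + Polynomial.X * (p.timeBound + Polynomial.C 8)

end Cmd

namespace State

@[simp] theorem setReg_reg (s : State) (r v r' : ℕ) :
    (s.setReg r v).reg r' = if r' = r then v else s.reg r' := by
  simp [setReg, Function.update_apply]

@[simp] theorem setReg_arr (s : State) (r v : ℕ) : (s.setReg r v).arr = s.arr := rfl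

@[simp] theorem setArr_reg (s : State) (a i v : ℕ) : (s.setArr a i v).reg = s.reg := rfl

@[simp] theorem setArr_arr (s : State) (a i v a' j : ℕ) :
    (s.setArr a i v).arr a' j = if a' = a ∧ j = i then v else s.arr a' j := by
  by_cases h : a' = a
  · subst h; simp [setArr, Function.update_apply]
  · simp [setArr, h]

theorem setArr_arr_of_ne (s : State) {a i v a' : ℕ} (h : a' ≠ a) :
    (s.setArr a i v).arr a' = s.arr a' := by
  funext j; simp [h]

/-- The states agree on all registers outside `rs` and all arrays outside `as`. -/
def Agree (rs as : List ℕ) (s t : State) : Prop :=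
  (∀ r, r ∉ rs → t.reg r = s.reg r) ∧ ∀ a, a ∉ as → t.arr a = s.arr a

theorem Agree.refl (rs as : List ℕ) (s : State) : Agree rs as s s :=
  ⟨fun _ _ => rfl, fun _ _ => rfl⟩

theorem Agree.trans {rs as : List ℕ} {s t u : State} (h : Agree rs as s t) (h' : Agree rs as t u) :
    Agree rs as s u :=
  ⟨fun r hr => (h'.1 r hr).trans (h.1 r hr), fun a ha => (h'.2 a ha).trans (h.2 a ha)⟩

theorem Agree.mono {rs as rs' as' : List ℕ} {s t : State} (h : Agree rs as s t)
    (hr : rs ⊆ rs') (ha : as ⊆ as') : Agree rs' as' s t :=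
  ⟨fun r h' => h.1 r fun h'' => h' (hr h''), fun a h' => h.2 a fun h'' => h' (ha h'')⟩

theorem agree_setReg {rs as : List ℕ} {r : ℕ} (h : r ∈ rs) (s : State) (v : ℕ) :
    Agree rs as s (s.setReg r v) :=
  ⟨fun r' hr' => by
    have : r' ≠ r := fun e => hr' (e ▸ h)
    simp [this], fun _ _ => rfl⟩

theorem agree_setArr {rs as : List ℕ} {a : ℕ} (h : a ∈ as) (s : State) (i v : ℕ) :
    Agree rs as s (s.setArr a i v) :=
  ⟨fun _ _ => rfl, fun _ ha' => setArr_arr_of_ne s fun e => ha' (e ▸ h)⟩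

end State

namespace Cmd

open State

theorem agree_iter {rs as : List ℕ} {f : State → State} {r : ℕ} (hr : r ∈ rs)
    (hf : ∀ s, Agree rs as s (f s)) (s : State) (k : ℕ) : Agree rs as s (iter f r s k) := by
  induction k with
  | zero => exact .refl _ _ _
  | succ k ih => exact (ih.trans (agree_setReg hr _ _)).trans (hf _)

/-- A command changes nothing outside the registers and arrays that it writes. -/
theorem agree_run (p : Cmd) (s : State) : Agree p.regs p.arrs s (p.run s) := by
  induction p generalizing s with
  | skip => exact .refl _ _ _
  | assign r e => exact agree_setReg (by simp [regs]) _ _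
  | store a i e => exact agree_setArr (by simp [arrs]) _ _ _
  | seq p q hp hq =>
    exact ((hp s).mono (by simp [regs]) (by simp [arrs])).trans
      ((hq _).mono (by simp [regs]) (by simp [arrs]))
  | ite e p q hp hq =>
    simp only [run]
    split
    · exact (hp s).mono (by simp [regs]) (by simp [arrs])
    · exact (hq s).mono (by simp [regs]) (by simp [arrs])
  | loopTo r b p hp =>
    have h : ∀ s, Agree (r :: p.regs) p.arrs s (p.run s) :=
      fun s => (hp s).mono (by simp) (by simp)
    exact (agree_iter (by simp) h s _).trans (agree_setReg (by simp) _ _)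

theorem run_reg {p : Cmd} {r : ℕ} (h : r ∉ p.regs) (s : State) : (p.run s).reg r = s.reg r :=
  (agree_run p s).1 r h

theorem run_skip (s : State) : skip.run s = s := rfl

theorem run_assign (r : ℕ) (e : Expr) (s : State) :
    (assign r e).run s = s.setReg r (e.eval s) := rfl

theorem run_store (a : ℕ) (i e : Expr) (s : State) :
    (store a i e).run s = s.setArr a (i.eval s) (e.eval s) := rfl

theorem run_seq (p q : Cmd) (s : State) : (seq p q).run s = q.run (p.run s) := rfl

theorem run_ite_pos {e : Expr} {s : State} (h : e.eval s ≠ 0) (p q : Cmd) :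
    (ite e p q).run s = p.run s := if_pos h

theorem run_ite_neg {e : Expr} {s : State} (h : ¬ e.eval s ≠ 0) (p q : Cmd) :
    (ite e p q).run s = q.run s := if_neg h

theorem WF.notMem_regs {bs : List ℕ} {p : Cmd} (h : p.WF bs) {b : ℕ} (hb : b ∈ bs) :
    b ∉ p.regs := by
  induction p with
  | skip => simp [regs]
  | assign r e => rintro h'; simp [regs] at h'; exact h (h' ▸ hb)
  | store a i e => simp [regs]
  | seq p q hp hq => simp [regs, hp h.1, hq h.2]
  | ite e p q hp hq => simp [regs, hp h.1, hq h.2]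
  | loopTo r b p hp =>
    obtain ⟨-, h2, -, h4⟩ := h
    simp only [regs, List.mem_cons, not_or]
    exact ⟨fun e => h2 (e ▸ hb), hp h4⟩

/-- Since the body never writes the counter, the machine state before round k is `iter p.run r s k`
with the counter set to k. The number j of remaining rounds drives the induction. -/
theorem exec_loop {bs : List ℕ} {X T r b : ℕ} {p : Cmd} (h : (loopTo r b p).WF bs)
    (hp : ∀ s : State, (∀ b ∈ bs, s.reg b ≤ X) → ∃ t, Exec p.compile s t (p.run s) ∧ t ≤ T)
    (s : State) (hs : ∀ b ∈ bs, s.reg b ≤ X) (j k : ℕ) (hjk : j + k = s.reg b) :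
    ∃ t, Exec (.loop (.sub (.reg b) (.reg r)) (.seq p.compile (.assign r (.add (.reg r) (.lit 1)))))
      ((iter p.run r s k).setReg r k) t ((iter p.run r s (s.reg b)).setReg r (s.reg b)) ∧
      t ≤ 4 + j * (T + 8) := by
  obtain ⟨hb, hr, hrp, hwf⟩ := h
  have hbr : b ≠ r := fun e => hr (e ▸ hb)
  have hag : ∀ k, Agree (r :: p.regs) p.arrs s (iter p.run r s k) := fun k =>
    agree_iter (by simp) (fun s => (agree_run p s).mono (by simp) (by simp)) s k
  have hreg : ∀ k, ∀ b ∈ bs, (iter p.run r s k).reg b = s.reg b := fun k b hb =>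
    (hag k).1 b (by
      have := hwf.notMem_regs hb
      have : b ≠ r := fun e => hr (e ▸ hb)
      simp [*])
  induction j generalizing k with
  | zero =>
    have hk : k = s.reg b := by omega
    subst hk
    refine ⟨_, .loop_false ?_, ?_⟩
    · simp [Expr.eval, hbr, hreg _ b hb]
    · simp [Expr.cost]
  | succ j ih =>
    obtain ⟨t, ht, htT⟩ := hp ((iter p.run r s k).setReg r k) (fun b' hb' => by
      have : b' ≠ r := fun e => hr (e ▸ hb')
      simp [this, hreg k b' hb', hs b' hb'])
    obtain ⟨t', ht', htT'⟩ := ih (k + 1) (by omega)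
    refine ⟨_, .loop_true (t' := t') ?_ (.seq ht (.assign r _ _)) ?_, ?_⟩
    · simp [Expr.eval, hbr, hreg k b hb]; omega
    · have : Expr.eval (p.run ((iter p.run r s k).setReg r k)) ((Expr.reg r).add (Expr.lit 1)) =
          k + 1 := by simp [Expr.eval, run_reg hrp]
      rw [this]
      exact ht'
    -- Besides the body, a round takes four steps for the test and four for the increment; the last,
    -- failing test takes four more.
    · simp only [Expr.cost]
      nlinarith

/-- A well-formed command halts in the state computed by `run`, in polynomial time. -/
theorem exec_compile {bs : List ℕ} {X : ℕ} {p : Cmd} (h : p.WF bs) (s : State)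
    (hs : ∀ b ∈ bs, s.reg b ≤ X) :
    ∃ t, Exec p.compile s t (p.run s) ∧ t ≤ p.timeBound.eval X := by
  induction p generalizing s with
  | skip => exact ⟨_, .skip s, by simp [timeBound]⟩
  | assign r e => exact ⟨_, .assign r e s, by simp [timeBound]⟩
  | store a i e => exact ⟨_, .store a i e s, by simp [timeBound]⟩
  | seq p q hp hq =>
    obtain ⟨t, ht, htT⟩ := hp h.1 s hs
    obtain ⟨t', ht', htT'⟩ := hq h.2 (p.run s) (fun b hb => by
      rw [run_reg (h.1.notMem_regs hb)]; exact hs b hb)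
    exact ⟨_, .seq ht ht', by simp [timeBound]; omega⟩
  | ite e p q hp hq =>
    by_cases he : e.eval s = 0
    · obtain ⟨t', ht', htT'⟩ := hq h.2 s hs
      exact ⟨_, by simpa [run, compile, he] using Exec.branch_false he ht',
        by simp [timeBound]; omega⟩
    · obtain ⟨t', ht', htT'⟩ := hp h.1 s hs
      exact ⟨_, by simpa [run, compile, he] using Exec.branch_true he ht',
        by simp [timeBound]; omega⟩
  | loopTo r b p hp =>
    obtain ⟨t, ht, htT⟩ := exec_loop (T := p.timeBound.eval X) h (fun s hs => hp h.2.2.2 s hs) s hs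
      (s.reg b) 0 (by omega)
    refine ⟨_, .seq (.assign r (.lit 0) s) ht, ?_⟩
    have := Nat.mul_le_mul_right (p.timeBound.eval X + 8) (hs b h.1)
    simp [timeBound, Expr.cost]
    omega

/-- The invariant rule for counting loops. In the body, everything that the loop does not write has
its initial value. -/
theorem loopTo_induction {r b : ℕ} {p : Cmd} {s : State} (I : ℕ → State → Prop)
    (hI : ∀ k t v, I k t → I k (t.setReg r v)) (h0 : I 0 s)
    (hstep : ∀ k < s.reg b, ∀ t, Agree (r :: p.regs) p.arrs s t → t.reg r = k → I k t →
      I (k + 1) (p.run t)) :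
    I (s.reg b) ((loopTo r b p).run s) := by
  refine hI _ _ _ ?_
  have key : ∀ k ≤ s.reg b, I k (iter p.run r s k) := by
    intro k hk
    induction k with
    | zero => exact h0
    | succ k ih =>
      refine hstep k hk _ ?_ (by simp) (hI _ _ _ (ih (by omega)))
      exact (agree_iter (by simp) (fun s => (agree_run p s).mono (by simp) (by simp)) s k).trans
        (agree_setReg (by simp) _ _)
  exact key _ le_rfl

end Cmd

end RAM

open Finset

/-! ### Connected vertex sets and their decomposition into spiders -/

section Spider

variable {V : Type*}

namespace SimpleGraph

/-- The edges of a graph with both ends in `M`, as a graph on all vertices. -/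
def within (H : SimpleGraph V) (M : Finset V) : SimpleGraph V where
  Adj a b := H.Adj a b ∧ a ∈ M ∧ b ∈ M
  symm := ⟨fun _ _ h => ⟨h.1.symm, h.2.2, h.2.1⟩⟩
  loopless := ⟨fun _ h => H.loopless.irrefl _ h.1⟩

theorem within_mono {H H' : SimpleGraph V} {M M' : Finset V} (hH : H ≤ H') (hM : M ⊆ M') :
    H.within M ≤ H'.within M' :=
  fun _ _ h => ⟨hH h.1, hM h.2.1, hM h.2.2⟩

theorem within_le (H : SimpleGraph V) (M : Finset V) : H.within M ≤ H := fun _ _ h => h.1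

theorem Reachable.mem_of_within {H : SimpleGraph V} {M : Finset V} {x y : V}
    (h : (H.within M).Reachable x y) (hx : x ∈ M) : y ∈ M := by
  obtain ⟨p⟩ := h
  induction p with
  | nil => exact hx
  | cons h _ ih => exact ih h.2.2

/-- The set `K` induces a connected subgraph (or is empty). -/
def ConnectedOn (H : SimpleGraph V) (K : Finset V) : Prop :=
  ∀ x ∈ K, ∀ y ∈ K, (H.within K).Reachable x y

theorem ConnectedOn.of_root {H : SimpleGraph V} {K : Finset V} (u : V)
    (h : ∀ x ∈ K, (H.within K).Reachable u x) : H.ConnectedOn K :=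
  fun x hx y hy => (h x hx).symm.trans (h y hy)

theorem connectedOn_singleton (H : SimpleGraph V) (u : V) : H.ConnectedOn {u} := by
  intro x hx y hy
  simp only [mem_singleton] at hx hy
  subst hx; subst hy
  rfl

theorem ConnectedOn.insert [DecidableEq V] {H : SimpleGraph V} {P : Finset V}
    (hP : H.ConnectedOn P) {u z : V}
    (hz : z ∈ P) (huz : H.Adj u z) : H.ConnectedOn (insert u P) := by
  refine .of_root z fun x hx => ?_
  rcases mem_insert.1 hx with rfl | hx
  · exact Adj.reachable ⟨huz.symm, by simp [hz], by simp⟩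
  · exact (hP z hz x hx).mono (within_mono le_rfl (subset_insert _ _))

open Classical in
/-- The vertices of `M` that are connected to `x` inside `M`. -/
noncomputable def compOn (H : SimpleGraph V) (M : Finset V) (x : V) : Finset V :=
  M.filter fun z => (H.within M).Reachable x z

theorem mem_compOn {H : SimpleGraph V} {M : Finset V} {x z : V} :
    z ∈ H.compOn M x ↔ z ∈ M ∧ (H.within M).Reachable x z := by
  simp [compOn]

theorem compOn_subset (H : SimpleGraph V) (M : Finset V) (x : V) : H.compOn M x ⊆ M :=
  fun _ h => (mem_compOn.1 h).1

theorem connectedOn_compOn (H : SimpleGraph V) (M : Finset V) (x : V) :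
    H.ConnectedOn (H.compOn M x) := by
  refine .of_root x fun y hy => ?_
  obtain ⟨hyM, ⟨p⟩⟩ := mem_compOn.1 hy
  suffices key : ∀ (a y : V) (p : (H.within M).Walk a y), (H.within M).Reachable x a →
      (H.within (H.compOn M x)).Reachable a y from key x y p .rfl
  intro a y p ha
  induction p with
  | nil => rfl
  | cons h _ ih =>
    have h' := ha.trans h.reachable
    have hadj : (H.within (H.compOn M x)).Adj _ _ :=
      ⟨h.1, mem_compOn.2 ⟨h.2.1, ha⟩, mem_compOn.2 ⟨h.2.2, h'⟩⟩
    exact hadj.reachable.trans (ih h')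

theorem compOn_eq {H : SimpleGraph V} {M : Finset V} {x y z : V} (hx : z ∈ H.compOn M x)
    (hy : z ∈ H.compOn M y) : H.compOn M x = H.compOn M y := by
  have h := (mem_compOn.1 hx).2.trans (mem_compOn.1 hy).2.symm
  ext t
  simp only [mem_compOn]
  exact and_congr_right fun _ => ⟨h.symm.trans, h.trans⟩

/-- Stop a walk from x to u when it first hits u: the vertex just before is a neighbor of u, and the
walk up to it avoids u. -/
theorem exists_adj_of_reachable [DecidableEq V] {H : SimpleGraph V} {K : Finset V} {x u : V}
    (h : (H.within K).Reachable x u) (hx : x ≠ u) :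
    ∃ z ∈ H.compOn (K.erase u) x, H.Adj u z := by
  obtain ⟨p⟩ := h
  induction p with
  | nil => exact absurd rfl hx
  | @cons a b c h _ ih =>
    have ha : a ∈ K.erase c := mem_erase.2 ⟨hx, h.2.1⟩
    by_cases hb : b = c
    · subst hb
      exact ⟨a, mem_compOn.2 ⟨ha, .rfl⟩, h.1.symm⟩
    · obtain ⟨z, hz, hzc⟩ := ih hb
      obtain ⟨hz, hr⟩ := mem_compOn.1 hz
      have hadj : (H.within (K.erase c)).Adj a b := ⟨h.1, ha, mem_erase.2 ⟨hb, h.2.2⟩⟩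
      exact ⟨z, mem_compOn.2 ⟨hz, hadj.reachable.trans hr⟩, hzc⟩

end SimpleGraph

open SimpleGraph

variable [DecidableEq V]

/-- The sets f c are joined one at a time, and each meets Y, so subadditivity on intersecting sets
applies in every step. -/
theorem le_sum_of_meet {ι : Type*} [DecidableEq ι] {h : Finset V → ℕ}
    (hu : ∀ X Y, (X ∩ Y).Nonempty → h (X ∪ Y) ≤ h X + h Y) (Y : Finset V) (C : Finset ι)
    (f : ι → Finset V) (hC : ∀ c ∈ C, (Y ∩ f c).Nonempty) :
    h (Y ∪ C.biUnion f) ≤ h Y + ∑ c ∈ C, h (f c) := by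
  induction C using Finset.induction_on with
  | empty => simp
  | insert c C hc ih =>
    have h1 := ih fun c' hc' => hC c' (mem_insert_of_mem hc')
    have h2 : Y ∪ (insert c C).biUnion f = (Y ∪ C.biUnion f) ∪ f c := by
      rw [biUnion_insert, union_comm (f c), union_assoc]
    have h3 := hu (Y ∪ C.biUnion f) (f c)
      ((hC c (mem_insert_self _ _)).mono (inter_subset_inter_right subset_union_left))
    rw [h2, sum_insert hc]
    omega

/-- Let `h` be a subadditive measure of sets of terminals that is bounded on the feet of every
spider by the cost of the spider. Then on the terminals of a connected set it is bounded by the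
weight of the set, up to a logarithmic factor. The path `P` from the root `u` to a terminal descends
to a child subtree with the fewest terminals. -/
theorem exists_path_of_spiders {H : SimpleGraph V} {R : Finset V} {w : V → ℕ} {d : V → V → ℕ}
    {h : Finset V → ℕ} {L : ℕ} (hR : ∀ v ∈ R, w v = 0)
    (hd : ∀ v y P, H.ConnectedOn P → v ∈ P → y ∈ P → w v + d v y ≤ ∑ x ∈ P, w x)
    (hu : ∀ X Y, (X ∩ Y).Nonempty → h (X ∪ Y) ≤ h X + h Y)
    (hs : ∀ v, ∀ Y ⊆ R, Y.Nonempty → (∀ y ∈ Y, H.Reachable v y) → h Y ≤ w v + ∑ y ∈ Y, d v y)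
    (K : Finset V) (hK : H.ConnectedOn K) (u : V) (huK : u ∈ K) (hKR : (K ∩ R).Nonempty)
    (hL : Nat.log 2 (K ∩ R).card ≤ L) :
    ∃ x ∈ K ∩ R, ∃ P ⊆ K, H.ConnectedOn P ∧ u ∈ P ∧ x ∈ P ∧
      h (K ∩ R) + (L + 1 - Nat.log 2 (K ∩ R).card) * ∑ x ∈ P, w x ≤ (L + 2) * ∑ x ∈ K, w x := by
  induction hn : K.card using Nat.strong_induction_on generalizing K u with
  | _ n ih =>
  subst hn
  set M := K.erase u with hM
  have hMK : M ⊆ K := erase_subset _ _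
  have huM : u ∉ M := notMem_erase _ _
  set C := (M ∩ R).image (H.compOn M) with hC
  have hCsub : ∀ c ∈ C, c ⊆ M := by
    intro c hc
    obtain ⟨x, -, rfl⟩ := mem_image.1 hc
    exact compOn_subset _ _ _
  have hCdisj : ∀ c ∈ C, ∀ c' ∈ C, ∀ z, z ∈ c → z ∈ c' → c = c' := by
    intro c hc c' hc' z hz hz'
    obtain ⟨x, -, rfl⟩ := mem_image.1 hc
    obtain ⟨x', -, rfl⟩ := mem_image.1 hc'
    exact compOn_eq hz hz'
  have hCpw : (C : Set (Finset V)).PairwiseDisjoint id := by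
    intro c hc c' hc' hne
    rw [Function.onFun, id, id, Finset.disjoint_left]
    exact fun z hz hz' => hne (hCdisj c hc c' hc' z hz hz')
  have hstep : ∀ c : Finset V, ∃ (x : V) (P : Finset V), c ∈ C → x ∈ c ∩ R ∧ P ⊆ c ∧
      H.ConnectedOn (insert u P) ∧ x ∈ P ∧ h (c ∩ R) +
        (L + 1 - Nat.log 2 (c ∩ R).card) * ∑ x ∈ P, w x ≤ (L + 2) * ∑ x ∈ c, w x := by
    intro c
    by_cases hc : c ∈ C
    · obtain ⟨x, hx, rfl⟩ := mem_image.1 hc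
      obtain ⟨hxM, hxR⟩ := mem_inter.1 hx
      have hxu : x ≠ u := fun e => huM (e ▸ hxM)
      obtain ⟨z, hz, huz⟩ := exists_adj_of_reachable (hK x (hMK hxM) u huK) hxu
      have hcard : (H.compOn M x).card < K.card :=
        (card_le_card (compOn_subset _ _ _)).trans_lt (card_erase_lt_of_mem huK)
      obtain ⟨y, hy, P, hP, hPc, hzP, hyP, hle⟩ := ih _ hcard (H.compOn M x)
        (connectedOn_compOn H M x) z hz ⟨x, mem_inter.2 ⟨mem_compOn.2 ⟨hxM, .rfl⟩, hxR⟩⟩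
        ((Nat.log_mono_right (card_le_card (inter_subset_inter_right
          ((compOn_subset _ _ _).trans hMK)))).trans hL) rfl
      exact ⟨y, P, fun _ => ⟨hy, hP, hPc.insert hzP huz, hyP, hle⟩⟩
    -- An irrelevant value for sets that are not child components; it lets `choose` return total
    -- functions.
    · exact ⟨u, ∅, fun h => absurd h hc⟩
  choose x P hxP using hstep
  have hlogc : ∀ c ∈ C, Nat.log 2 (c ∩ R).card ≤ L := fun c hc =>
    (Nat.log_mono_right (card_le_card (inter_subset_inter_right ((hCsub c hc).trans hMK)))).trans hL
  -- The path in each child is available with multiplicity at least 1. One copy pays for the leg of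
  -- the spider centered at u that ends in this child.
  have hcost : ∀ c ∈ C, h (c ∩ R) + ∑ x ∈ P c, w x ≤ (L + 2) * ∑ x ∈ c, w x := by
    intro c hc
    have h1 := (hxP c hc).2.2.2.2
    have h2 := hlogc c hc
    have h3 : 1 * ∑ x ∈ P c, w x ≤ (L + 1 - Nat.log 2 (c ∩ R).card) * ∑ x ∈ P c, w x :=
      Nat.mul_le_mul_right _ (by omega)
    omega
  have huP : ∀ c ∈ C, u ∉ P c := fun c hc h' => huM (hCsub c hc ((hxP c hc).2.1 h'))
  have hdx : ∀ c ∈ C, d u (x c) ≤ ∑ x ∈ P c, w x := by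
    intro c hc
    have := hd u (x c) (insert u (P c)) (hxP c hc).2.2.1 (mem_insert_self _ _)
      (mem_insert_of_mem (hxP c hc).2.2.2.1)
    rw [sum_insert (huP c hc)] at this
    omega
  have hxinj : Set.InjOn x C := by
    intro c hc c' hc' he
    refine hCdisj c hc c' hc' (x c) (mem_inter.1 (hxP c hc).1).1 ?_
    rw [he]
    exact (mem_inter.1 (hxP c' hc').1).1
  have hsumd : ∑ y ∈ C.image x, d u y ≤ ∑ c ∈ C, ∑ x ∈ P c, w x := by
    rw [sum_image hxinj]
    exact sum_le_sum hdx
  have hsumw : w u + ∑ c ∈ C, ∑ x ∈ c, w x ≤ ∑ x ∈ K, w x := by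
    rw [← add_sum_erase K w huK]
    have : ∑ c ∈ C, ∑ x ∈ c, w x = ∑ x ∈ C.biUnion id, w x := (sum_biUnion hCpw).symm
    rw [this]
    exact Nat.add_le_add_left (sum_le_sum_of_subset (biUnion_subset.2 hCsub)) _
  have hxR : ∀ c ∈ C, x c ∈ M ∧ x c ∈ R := fun c hc =>
    ⟨hCsub c hc (mem_inter.1 (hxP c hc).1).1, (mem_inter.1 (hxP c hc).1).2⟩
  have hcover : ∀ z ∈ M ∩ R, ∃ c ∈ C, z ∈ c := fun z hz =>
    ⟨_, mem_image_of_mem _ hz, mem_compOn.2 ⟨(mem_inter.1 hz).1, .rfl⟩⟩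
  have hreach : ∀ y ∈ K, H.Reachable u y := fun y hy => (hK u huK y hy).mono (within_le _ _)
  have hsumc : ∑ c ∈ C, (h (c ∩ R) + ∑ x ∈ P c, w x) ≤ (L + 2) * ∑ c ∈ C, ∑ x ∈ c, w x := by
    rw [mul_sum]
    exact sum_le_sum hcost
  rw [sum_add_distrib] at hsumc
  -- A terminal root weighs nothing: the path {u} needs no reserve, the center of the spider is
  -- free, and u itself is taken as a further foot.
  by_cases huR : u ∈ R
  · refine ⟨u, mem_inter.2 ⟨huK, huR⟩, {u}, by simpa using huK, connectedOn_singleton H u, by simp,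
      by simp, ?_⟩
    have hY := hs u (insert u (C.image x)) (by
      intro y hy
      rcases mem_insert.1 hy with rfl | hy
      · exact huR
      · obtain ⟨c, hc, rfl⟩ := mem_image.1 hy
        exact (hxR c hc).2) (insert_nonempty _ _) (by
      intro y hy
      rcases mem_insert.1 hy with rfl | hy
      · rfl
      · obtain ⟨c, hc, rfl⟩ := mem_image.1 hy
        exact hreach _ (hMK (hxR c hc).1))
    have hunion : insert u (C.image x) ∪ C.biUnion (fun c => c ∩ R) = K ∩ R := by
      ext z
      constructor
      · intro hz
        rcases mem_union.1 hz with hz | hz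
        · rcases mem_insert.1 hz with rfl | hz
          · exact mem_inter.2 ⟨huK, huR⟩
          · obtain ⟨c, hc, rfl⟩ := mem_image.1 hz
            exact mem_inter.2 ⟨hMK (hxR c hc).1, (hxR c hc).2⟩
        · obtain ⟨c, hc, hz⟩ := mem_biUnion.1 hz
          obtain ⟨hz, hzR⟩ := mem_inter.1 hz
          exact mem_inter.2 ⟨hMK (hCsub c hc hz), hzR⟩
      · intro hz
        obtain ⟨hz, hzR⟩ := mem_inter.1 hz
        by_cases hzu : z = u
        · simp [hzu]
        · obtain ⟨c, hc, hzc⟩ := hcover z (mem_inter.2 ⟨mem_erase.2 ⟨hzu, hz⟩, hzR⟩)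
          exact mem_union_right _ (mem_biUnion.2 ⟨c, hc, mem_inter.2 ⟨hzc, hzR⟩⟩)
    have hle := le_sum_of_meet hu (insert u (C.image x)) C (fun c => c ∩ R) (fun c hc =>
      ⟨x c, mem_inter.2 ⟨mem_insert_of_mem (mem_image_of_mem _ hc), (hxP c hc).1⟩⟩)
    rw [hunion] at hle
    have hduu : w u + d u u ≤ w u := by
      simpa using hd u u {u} (connectedOn_singleton H u) (by simp) (by simp)
    rw [sum_insert (fun h' => by
      obtain ⟨c, hc, he⟩ := mem_image.1 h'
      exact huM (he ▸ (hxR c hc).1)), hR u huR] at hY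
    simp only [sum_singleton, hR u huR, mul_zero, add_zero]
    have : (L + 2) * ∑ c ∈ C, ∑ x ∈ c, w x ≤ (L + 2) * ∑ x ∈ K, w x :=
      Nat.mul_le_mul_left _ (by omega)
    omega
  · have hKM : K ∩ R = M ∩ R := by
      ext z
      simp only [mem_inter, hM, mem_erase]
      constructor
      · rintro ⟨h1, h2⟩; exact ⟨⟨fun e => huR (e ▸ h2), h1⟩, h2⟩
      · rintro ⟨⟨-, h1⟩, h2⟩; exact ⟨h1, h2⟩
    have hCne : C.Nonempty := by
      rw [hC, image_nonempty, ← hKM]; exact hKR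
    obtain ⟨c₁, hc₁, hmin⟩ := exists_min_image C (fun c => (c ∩ R).card) hCne
    have hsub : ∀ c ∈ C, c ∩ R ⊆ K ∩ R := fun c hc =>
      inter_subset_inter_right ((hCsub c hc).trans hMK)
    obtain ⟨hx1, hP1, hPc1, hxP1, hle1⟩ := hxP c₁ hc₁
    refine ⟨x c₁, hsub c₁ hc₁ hx1, insert u (P c₁),
      insert_subset huK (hP1.trans ((hCsub c₁ hc₁).trans hMK)), hPc1, mem_insert_self _ _,
      mem_insert_of_mem hxP1, ?_⟩
    rw [sum_insert (huP c₁ hc₁)]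
    have hsplit : ∑ c ∈ C, ∑ x ∈ c, w x = ∑ x ∈ c₁, w x + ∑ c ∈ C.erase c₁, ∑ x ∈ c, w x :=
      (add_sum_erase C _ hc₁).symm
    -- With a single child no spider is needed. The terminals are those of the child, and extending
    -- its path by u takes at most L + 1 of the L + 2 available copies of w u.
    by_cases hone : C = {c₁}
    · have hKc : K ∩ R = c₁ ∩ R := by
        refine Subset.antisymm (fun z hz => ?_) (hsub c₁ hc₁)
        obtain ⟨c, hc, hzc⟩ := hcover z (hKM ▸ hz)
        rw [hone, mem_singleton] at hc
        exact mem_inter.2 ⟨hc ▸ hzc, (mem_inter.1 hz).2⟩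
      rw [hKc]
      have : (L + 1 - Nat.log 2 (c₁ ∩ R).card) * w u ≤ (L + 2) * w u :=
        Nat.mul_le_mul_right _ (by omega)
      have h5 : (L + 2) * (w u + ∑ c ∈ C, ∑ x ∈ c, w x) ≤ (L + 2) * ∑ x ∈ K, w x :=
        Nat.mul_le_mul_left _ hsumw
      rw [hsplit] at h5
      simp only [mul_add] at h5 ⊢
      omega
    · obtain ⟨c₂, hc₂, hne⟩ : ∃ c ∈ C, c ≠ c₁ := by
        by_contra! hcon
        exact hone (eq_singleton_iff_unique_mem.2 ⟨hc₁, hcon⟩)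
      -- With several children the smallest has at most half of the terminals, so its logarithm is
      -- smaller by at least one and its path is available at least once more than the path of K has
      -- to be. The extra copy pays for the leg to x c₁, the other legs are paid by their own
      -- children, and u is paid once as a center and otherwise as a vertex of the path.
      have hcard : 2 * (c₁ ∩ R).card ≤ (K ∩ R).card := by
        have hdis : Disjoint (c₁ ∩ R) (c₂ ∩ R) :=
          Disjoint.mono inter_subset_left inter_subset_left (hCpw hc₁ hc₂ hne.symm)
        have h1 := card_le_card (union_subset (hsub c₁ hc₁) (hsub c₂ hc₂))
        rw [card_union_of_disjoint hdis] at h1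
        have h2 := hmin c₂ hc₂
        omega
      have hlog : Nat.log 2 (c₁ ∩ R).card + 1 ≤ Nat.log 2 (K ∩ R).card := by
        rw [← Nat.log_mul_base one_lt_two (card_pos.2 ⟨_, hx1⟩).ne']
        exact Nat.log_mono_right (by omega)
      have hY := hs u (C.image x) (by
        intro y hy
        obtain ⟨c, hc, rfl⟩ := mem_image.1 hy
        exact (hxR c hc).2) (hCne.image _) (by
        intro y hy
        obtain ⟨c, hc, rfl⟩ := mem_image.1 hy
        exact hreach _ (hMK (hxR c hc).1))
      have hunion : C.image x ∪ C.biUnion (fun c => c ∩ R) = K ∩ R := by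
        ext z
        constructor
        · intro hz
          rcases mem_union.1 hz with hz | hz
          · obtain ⟨c, hc, rfl⟩ := mem_image.1 hz
            exact mem_inter.2 ⟨hMK (hxR c hc).1, (hxR c hc).2⟩
          · obtain ⟨c, hc, hz⟩ := mem_biUnion.1 hz
            exact hsub c hc hz
        · intro hz
          obtain ⟨c, hc, hzc⟩ := hcover z (hKM ▸ hz)
          exact mem_union_right _ (mem_biUnion.2 ⟨c, hc, mem_inter.2 ⟨hzc, (mem_inter.1 hz).2⟩⟩)
      have hle := le_sum_of_meet hu (C.image x) C (fun c => c ∩ R) (fun c hc =>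
        ⟨x c, mem_inter.2 ⟨mem_image_of_mem _ hc, (hxP c hc).1⟩⟩)
      rw [hunion] at hle
      have hrest : ∑ c ∈ C.erase c₁, (h (c ∩ R) + ∑ x ∈ P c, w x) ≤
          (L + 2) * ∑ c ∈ C.erase c₁, ∑ x ∈ c, w x := by
        rw [mul_sum]
        exact sum_le_sum fun c hc => hcost c (mem_of_mem_erase hc)
      rw [sum_add_distrib] at hrest
      have e1 := (add_sum_erase C (fun c => h (c ∩ R)) hc₁).symm
      have e2 := (add_sum_erase C (fun c => ∑ x ∈ P c, w x) hc₁).symm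
      have h5 : (L + 2) * (w u + ∑ c ∈ C, ∑ x ∈ c, w x) ≤ (L + 2) * ∑ x ∈ K, w x :=
        Nat.mul_le_mul_left _ hsumw
      rw [hsplit] at h5
      have h6 : (L + 1 - Nat.log 2 (K ∩ R).card + 1) * ∑ x ∈ P c₁, w x ≤
          (L + 1 - Nat.log 2 (c₁ ∩ R).card) * ∑ x ∈ P c₁, w x :=
        Nat.mul_le_mul_right _ (by omega)
      have h7 : (L + 1 - Nat.log 2 (K ∩ R).card + 1) * w u ≤ (L + 2) * w u :=
        Nat.mul_le_mul_right _ (by omega)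
      generalize L + 1 - Nat.log 2 (K ∩ R).card = l₁ at *
      generalize L + 1 - Nat.log 2 (c₁ ∩ R).card = l₂ at *
      generalize L + 2 = l₃ at *
      simp only [mul_add, add_mul, one_mul] at h5 h6 h7 ⊢
      omega

/-- The weighted path in `exists_path_of_spiders` is a reserve for the induction only; at the top
level it is dropped, and any terminal of K serves as the root. -/
theorem le_log_mul_of_spiders {H : SimpleGraph V} {R : Finset V} {w : V → ℕ} {d : V → V → ℕ}
    {h : Finset V → ℕ} {L : ℕ} (hR : ∀ v ∈ R, w v = 0)
    (hd : ∀ v y P, H.ConnectedOn P → v ∈ P → y ∈ P → w v + d v y ≤ ∑ x ∈ P, w x)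
    (hu : ∀ X Y, (X ∩ Y).Nonempty → h (X ∪ Y) ≤ h X + h Y)
    (hs : ∀ v, ∀ Y ⊆ R, Y.Nonempty → (∀ y ∈ Y, H.Reachable v y) → h Y ≤ w v + ∑ y ∈ Y, d v y)
    {K : Finset V} (hK : H.ConnectedOn K) (hKR : (K ∩ R).Nonempty)
    (hL : Nat.log 2 R.card ≤ L) : h (K ∩ R) ≤ (L + 2) * ∑ x ∈ K, w x := by
  obtain ⟨u, hu'⟩ := hKR
  obtain ⟨x, -, P, -, -, -, -, hle⟩ := exists_path_of_spiders hR hd hu hs K hK u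
    (mem_inter.1 hu').1 ⟨u, hu'⟩ ((Nat.log_mono_right (card_le_card inter_subset_right)).trans hL)
  omega

end Spider

/-! ### Node-weighted distances and 2-edge-connection to a set -/

namespace SimpleGraph

variable {V : Type*}

/-- The least weight of a connected set containing `v` and `y`, without the weight of `v`. -/
noncomputable def nodeDist (H : SimpleGraph V) (w : V → ℕ) (v y : V) : ℕ :=
  sInf {k | ∃ P, H.ConnectedOn P ∧ v ∈ P ∧ y ∈ P ∧ ∑ x ∈ P, w x = w v + k}

/-- Leaving out the weight of v makes the legs of a spider share their center. For disconnected v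
and y the infimum is over the empty set and equals 0, which is why all spider inequalities assume
reachability. -/
theorem nodeDist_le (H : SimpleGraph V) (w : V → ℕ) (v y : V) (P : Finset V)
    (hP : H.ConnectedOn P) (hv : v ∈ P) (hy : y ∈ P) : w v + H.nodeDist w v y ≤ ∑ x ∈ P, w x := by
  have h1 : w v ≤ ∑ x ∈ P, w x := single_le_sum (fun _ _ => Nat.zero_le _) hv
  have h2 : H.nodeDist w v y ≤ ∑ x ∈ P, w x - w v :=
    Nat.sInf_le ⟨P, hP, hv, hy, by omega⟩
  omega

/-- A number that is the weight of some connected set and a lower bound for all of them is the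
distance. -/
theorem nodeDist_eq {H : SimpleGraph V} {w : V → ℕ} {v y : V} {k : ℕ} {P : Finset V}
    (hP : H.ConnectedOn P) (hv : v ∈ P) (hy : y ∈ P) (hk : ∑ x ∈ P, w x ≤ w v + k)
    (hmin : ∀ Q, H.ConnectedOn Q → v ∈ Q → y ∈ Q → w v + k ≤ ∑ x ∈ Q, w x) :
    k = H.nodeDist w v y := by
  have h1 := nodeDist_le H w v y P hP hv hy
  have hne : {k | ∃ P, H.ConnectedOn P ∧ v ∈ P ∧ y ∈ P ∧ ∑ x ∈ P, w x = w v + k}.Nonempty :=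
    ⟨_, P, hP, hv, hy, (Nat.add_sub_of_le (by omega)).symm⟩
  obtain ⟨Q, hQ, hvQ, hyQ, he⟩ := Nat.sInf_mem hne
  have h2 := hmin Q hQ hvQ hyQ
  rw [he] at h2
  have : k ≤ H.nodeDist w v y := by unfold nodeDist; omega
  omega

/-- Whenever a walk from a uses the edge ab, it is at a or at b again afterwards. -/
theorem reachable_deleteEdges_or {T : SimpleGraph V} {a b y : V} (h : T.Reachable a y) :
    (T.deleteEdges {s(a, b)}).Reachable a y ∨ (T.deleteEdges {s(a, b)}).Reachable b y := by
  obtain ⟨p⟩ := h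
  suffices key : ∀ (x y : V) (p : T.Walk x y),
      ((T.deleteEdges {s(a, b)}).Reachable a x ∨ (T.deleteEdges {s(a, b)}).Reachable b x) →
      ((T.deleteEdges {s(a, b)}).Reachable a y ∨ (T.deleteEdges {s(a, b)}).Reachable b y) from
    key a y p (.inl .rfl)
  intro x y p
  induction p with
  | nil => exact id
  | @cons x z y h _ ih =>
    intro hx
    apply ih
    by_cases he : s(x, z) = s(a, b)
    · rcases Sym2.eq_iff.1 he with ⟨-, rfl⟩ | ⟨-, rfl⟩
      · exact .inr .rfl
      · exact .inl .rfl
    · have hadj : (T.deleteEdges {s(a, b)}).Adj x z := deleteEdges_adj.2 ⟨h, he⟩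
      exact hx.imp (·.trans hadj.reachable) (·.trans hadj.reachable)

theorem Walk.reachable_within {H : SimpleGraph V} {M B : Finset V} {x y : V}
    (p : (H.within M).Walk x y) (hp : ∀ z ∈ p.support, z ∈ B) : (H.within B).Reachable x y := by
  induction p with
  | nil => rfl
  | @cons x z y h p ih =>
    have hadj : (H.within B).Adj x z :=
      ⟨h.1, hp x (by simp), hp z (by simp)⟩
    exact hadj.reachable.trans (ih fun t ht => hp t (by simp [ht]))

theorem Walk.reachable_within_deleteEdges {G H : SimpleGraph V} {M : Finset V} {e : Sym2 V}
    {x y : V} (hH : H ≤ G) (p : (H.within M).Walk x y) (hp : e ∉ p.edges) :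
    ((G.deleteEdges {e}).within M).Reachable x y := by
  induction p with
  | nil => rfl
  | @cons x z y h p ih =>
    simp only [Walk.edges_cons, List.mem_cons, not_or] at hp
    have hadj : ((G.deleteEdges {e}).within M).Adj x z :=
      ⟨deleteEdges_adj.2 ⟨hH h.1, fun h' => hp.1 h'.symm⟩, h.2⟩
    exact hadj.reachable.trans (ih hp.2)

/-- The vertices that are connected to `R` in `G[M]` after the deletion of any edge induce a
subgraph with the same property. -/
theorem reachable_within_of_forall [DecidableEq V] {G : SimpleGraph V} {M R B : Finset V}
    (hB : ∀ x, x ∈ B ↔ ∀ a b, ∀ r ∈ R, ((G.deleteEdges {s(a, b)}).within M).Reachable r x)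
    (hRB : R ⊆ B) {r x : V} (hr : r ∈ R) (hx : x ∈ B) (a b : V) :
    ((G.deleteEdges {s(a, b)}).within B).Reachable r x := by
  obtain ⟨p, hp⟩ := ((hB x).1 hx a b r hr).exists_isPath
  refine p.reachable_within fun z hz => (hB z).2 fun a' b' r' hr' => ?_
  refine ((hB r).1 (hRB hr) a' b' r' hr').trans ?_
  have hle : G.deleteEdges {s(a, b)} ≤ G := deleteEdges_le _
  have hnd := hp.isTrail.edges_nodup
  rw [← p.take_spec hz, Walk.edges_append] at hnd
  -- The edges of a path are distinct, so the deleted edge misses one of the two pieces at z. Hence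
  -- z is reached from r directly, or backwards from x, which lies in B.
  by_cases h1 : s(a', b') ∈ (p.takeUntil z hz).edges
  · have h2 : s(a', b') ∉ (p.dropUntil z hz).edges := fun h2 =>
      (List.nodup_append.1 hnd).2.2 _ h1 _ h2 rfl
    exact ((hB x).1 hx a' b' r hr).trans
      ((p.dropUntil z hz).reachable_within_deleteEdges hle h2).symm
  · exact (p.takeUntil z hz).reachable_within_deleteEdges hle h1

end SimpleGraph

/-! ### Covering tree edges by components of links -/

namespace NWSTAP

open SimpleGraph

variable (I : NWSTAP)

/-- The graph without the edges of the tree. -/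
def links : SimpleGraph (Fin I.n) := I.G \ I.T.spanningCoe

theorem links_adj {a b : Fin I.n} : I.links.Adj a b ↔ I.G.Adj a b ∧ ¬ I.T.Adj a b := by
  simp [links]

/-- The tree edge `ab` is not a bridge in the graph induced by `M`. -/
def Covers (M : Finset (Fin I.n)) (a b : Fin I.n) : Prop :=
  ((I.G.deleteEdges {s(a, b)}).within M).Reachable a b

/-- The vertex `y` is on the side of `a` when the edge `ab` is removed from the tree. -/
def Side (a b y : Fin I.n) : Prop :=
  (I.T.spanningCoe.deleteEdges {s(a, b)}).Reachable a y

/-- The set `Y` has vertices on both sides of the edge `ab` of the tree. -/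
def Crosses (a b : Fin I.n) (Y : Finset (Fin I.n)) : Prop :=
  (∃ y ∈ Y, I.Side a b y) ∧ ∃ y ∈ Y, ¬ I.Side a b y

open Classical in
/-- The number of (oriented) tree edges covered by `M`. -/
noncomputable def cov (M : Finset (Fin I.n)) : ℕ :=
  #{p : Fin I.n × Fin I.n | I.T.Adj p.1 p.2 ∧ I.Covers M p.1 p.2}

open Classical in
/-- The number of (oriented) tree edges not covered by `M` that are crossed by `Y`. -/
noncomputable def unc (M Y : Finset (Fin I.n)) : ℕ :=
  #{p : Fin I.n × Fin I.n | I.T.Adj p.1 p.2 ∧ ¬ I.Covers M p.1 p.2 ∧ I.Crosses p.1 p.2 Y}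

open Classical in
/-- The number of (oriented) tree edges not covered by `M`. -/
noncomputable def uncovered (M : Finset (Fin I.n)) : ℕ :=
  #{p : Fin I.n × Fin I.n | I.T.Adj p.1 p.2 ∧ ¬ I.Covers M p.1 p.2}

variable {I} {M M' Q Y : Finset (Fin I.n)} {a b r y : Fin I.n}

theorem mem_R_of_adj (h : I.T.Adj a b) : a ∈ I.R := by
  have := h.fst_mem
  rw [I.verts_T] at this
  exact this

theorem tree_reachable (ha : a ∈ I.R) (hb : b ∈ I.R) : I.T.spanningCoe.Reachable a b := by
  have ha' : a ∈ I.T.verts := by rw [I.verts_T]; exact ha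
  have hb' : b ∈ I.T.verts := by rw [I.verts_T]; exact hb
  obtain ⟨p⟩ := I.isTree_T.connected.preconnected ⟨a, ha'⟩ ⟨b, hb'⟩
  exact ⟨p.map ⟨Subtype.val, fun {x y} h => h⟩⟩

theorem R_nonempty : I.R.Nonempty := by
  obtain ⟨⟨x, hx⟩⟩ := I.isTree_T.connected.nonempty
  rw [I.verts_T] at hx
  exact ⟨x, hx⟩

theorem side_or (hab : I.T.Adj a b) (hy : y ∈ I.R) : I.Side a b y ∨ I.Side b a y := by
  have := reachable_deleteEdges_or (b := b) (tree_reachable (mem_R_of_adj hab) hy)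
  rwa [Side, Side, Sym2.eq_swap (a := b)]

theorem tree_le_within (hM : I.R ⊆ M) (a b : Fin I.n) :
    I.T.spanningCoe.deleteEdges {s(a, b)} ≤ (I.G.deleteEdges {s(a, b)}).within M := by
  intro x y h
  obtain ⟨h1, h2⟩ := deleteEdges_adj.1 h
  have h1 : I.T.Adj x y := h1
  exact ⟨deleteEdges_adj.2 ⟨h1.adj_sub, h2⟩, hM (mem_R_of_adj h1), hM (mem_R_of_adj h1.symm)⟩

theorem links_le (hab : I.T.Adj a b) : I.links ≤ I.G.deleteEdges {s(a, b)} := by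
  intro x y h
  obtain ⟨h1, h2⟩ := I.links_adj.1 h
  refine deleteEdges_adj.2 ⟨h1, fun he => h2 ?_⟩
  rcases Sym2.eq_iff.1 he with ⟨rfl, rfl⟩ | ⟨rfl, rfl⟩
  · exact hab
  · exact hab.symm

/-- The detour around ab goes from a to r in the tree, from r to y by links, and from y to b in the
tree; no part of it uses ab. -/
theorem covers_of_side (hab : I.T.Adj a b) (hM : I.R ⊆ M) (hr : I.Side a b r)
    (hy : I.Side b a y) (h : (I.links.within M).Reachable r y) : I.Covers M a b := by
  have h1 := hr.mono (tree_le_within hM a b)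
  have h2 := hy.mono (tree_le_within hM b a)
  rw [Sym2.eq_swap (a := b)] at h2
  exact (h1.trans (h.mono (within_mono (links_le hab) subset_rfl))).trans h2.symm

theorem covers_of_crosses (hab : I.T.Adj a b) (hM : I.R ⊆ M) (hr : r ∈ I.R) (hy : y ∈ I.R)
    (hc : I.Crosses a b {r, y}) (h : (I.links.within M).Reachable r y) : I.Covers M a b := by
  obtain ⟨⟨y₁, hy₁, hs₁⟩, y₂, hy₂, hs₂⟩ := hc
  have key : ∀ z ∈ I.R, ¬ I.Side a b z → I.Side b a z := fun z hz hs =>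
    (side_or hab hz).resolve_left hs
  simp only [mem_insert, mem_singleton] at hy₁ hy₂
  rcases hy₁ with rfl | rfl <;> rcases hy₂ with rfl | rfl
  · exact absurd hs₁ hs₂
  · exact covers_of_side hab hM hs₁ (key _ hy hs₂) h
  · exact covers_of_side hab hM hs₁ (key _ hr hs₂) h.symm
  · exact absurd hs₁ hs₂

theorem Covers.mono (h : I.Covers M a b) (hM : M ⊆ M') : I.Covers M' a b :=
  Reachable.mono (within_mono le_rfl hM) h

theorem cov_mono (hM : M ⊆ M') : I.cov M ≤ I.cov M' :=
  card_le_card fun p hp => by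
    simp only [mem_filter, mem_univ, true_and] at hp ⊢
    exact ⟨hp.1, hp.2.mono hM⟩

theorem unc_anti (hM : M ⊆ M') (Y : Finset (Fin I.n)) : I.unc M' Y ≤ I.unc M Y :=
  card_le_card fun p hp => by
    simp only [mem_filter, mem_univ, true_and] at hp ⊢
    exact ⟨hp.1, fun h => hp.2.1 (h.mono hM), hp.2.2⟩

/-- An edge not covered by M is either still not covered by Q or one of the edges that Q newly
covers. -/
theorem unc_le_add (hM : M ⊆ Q) (Y : Finset (Fin I.n)) :
    I.unc M Y ≤ I.unc Q Y + (I.cov Q - I.cov M) := by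
  classical
  have h1 := card_le_card (s := ({p : Fin I.n × Fin I.n |
    I.T.Adj p.1 p.2 ∧ ¬ I.Covers M p.1 p.2 ∧ I.Crosses p.1 p.2 Y} : Finset _))
    (t := ({p : Fin I.n × Fin I.n |
      I.T.Adj p.1 p.2 ∧ ¬ I.Covers Q p.1 p.2 ∧ I.Crosses p.1 p.2 Y} : Finset _) ∪
      (({p : Fin I.n × Fin I.n | I.T.Adj p.1 p.2 ∧ I.Covers Q p.1 p.2} : Finset _) \
        ({p : Fin I.n × Fin I.n | I.T.Adj p.1 p.2 ∧ I.Covers M p.1 p.2} : Finset _)))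
    (fun p hp => by
      simp only [mem_union, mem_sdiff, mem_filter, mem_univ, true_and] at hp ⊢
      tauto)
  have h2 := h1.trans (card_union_le _ _)
  rw [card_sdiff_of_subset (fun p hp => by
    simp only [mem_filter, mem_univ, true_and] at hp ⊢
    exact ⟨hp.1, hp.2.mono hM⟩)] at h2
  unfold unc cov
  convert h2

theorem unc_pair_eq_zero (hM : I.R ⊆ M) (hr : r ∈ I.R) (hy : y ∈ I.R)
    (h : (I.links.within M).Reachable r y) : I.unc M {r, y} = 0 := by
  classical
  rw [unc, card_eq_zero, filter_eq_empty_iff]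
  rintro p - ⟨hp, hc, hcr⟩
  exact hc (covers_of_crosses hp hM hr hy hcr h)

theorem unc_pair_le (hMQ : M ⊆ Q) (hM : I.R ⊆ M) (hr : r ∈ I.R) (hy : y ∈ I.R)
    (h : (I.links.within Q).Reachable r y) : I.unc M {r, y} ≤ I.cov Q - I.cov M := by
  have h1 := unc_le_add hMQ {r, y}
  rw [unc_pair_eq_zero (hM.trans hMQ) hr hy h] at h1
  omega

/-- Whichever side r lies on, an edge crossed by Y has some y ∈ Y on the other side. This allows
feet to be examined one by one, each together with the first foot r. -/
theorem unc_le_sum (M Y : Finset (Fin I.n)) (r : Fin I.n) :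
    I.unc M Y ≤ ∑ y ∈ Y.erase r, I.unc M {r, y} := by
  classical
  have h1 := card_le_card (s := ({p : Fin I.n × Fin I.n |
    I.T.Adj p.1 p.2 ∧ ¬ I.Covers M p.1 p.2 ∧ I.Crosses p.1 p.2 Y} : Finset _))
    (t := (Y.erase r).biUnion fun y => ({p : Fin I.n × Fin I.n |
      I.T.Adj p.1 p.2 ∧ ¬ I.Covers M p.1 p.2 ∧ I.Crosses p.1 p.2 {r, y}} : Finset _))
    (fun p hp => by
      simp only [mem_biUnion, mem_filter, mem_univ, true_and] at hp ⊢
      obtain ⟨h1, h2, ⟨y₁, hy₁, hs₁⟩, y₂, hy₂, hs₂⟩ := hp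
      by_cases hs : I.Side p.1 p.2 r
      · exact ⟨y₂, mem_erase.2 ⟨fun e => hs₂ (e ▸ hs), hy₂⟩, h1, h2, ⟨r, by simp, hs⟩, y₂, by simp,
          hs₂⟩
      · exact ⟨y₁, mem_erase.2 ⟨fun e => hs (e ▸ hs₁), hy₁⟩, h1, h2, ⟨y₁, by simp, hs₁⟩, r, by simp,
          hs⟩)
  have h2 := h1.trans card_biUnion_le
  unfold unc
  convert h2

/-- If the union has vertices on both sides, then one of them is separated from the common vertex z,
and it lies in X or Y together with z. -/
theorem unc_union_le (M X Y : Finset (Fin I.n)) (h : (X ∩ Y).Nonempty) :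
    I.unc M (X ∪ Y) ≤ I.unc M X + I.unc M Y := by
  classical
  obtain ⟨z, hz⟩ := h
  obtain ⟨hzX, hzY⟩ := mem_inter.1 hz
  refine (card_le_card fun p hp => ?_).trans (card_union_le _ _)
  simp only [mem_union, mem_filter, mem_univ, true_and] at hp ⊢
  obtain ⟨h1, h2, ⟨y₁, hy₁, hs₁⟩, y₂, hy₂, hs₂⟩ := hp
  by_cases hs : I.Side p.1 p.2 z
  · rcases mem_union.1 hy₂ with hy | hy
    · exact .inl ⟨h1, h2, ⟨z, hzX, hs⟩, y₂, hy, hs₂⟩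
    · exact .inr ⟨h1, h2, ⟨z, hzY, hs⟩, y₂, hy, hs₂⟩
  · rcases mem_union.1 hy₁ with hy | hy
    · exact .inl ⟨h1, h2, ⟨y₁, hy, hs₁⟩, z, hzX, hs⟩
    · exact .inr ⟨h1, h2, ⟨y₁, hy, hs₁⟩, z, hzY, hs⟩

/-- Edges of a tree are bridges. A walk in the spanning copy of T that starts in R never leaves R,
so it transfers to T itself. -/
theorem not_side_self (hab : I.T.Adj a b) : ¬ I.Side a b b := by
  have ha : a ∈ I.T.verts := hab.fst_mem
  have hb : b ∈ I.T.verts := hab.snd_mem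
  have hbr : I.T.coe.IsBridge s(⟨a, ha⟩, ⟨b, hb⟩) :=
    isAcyclic_iff_forall_adj_isBridge.1 I.isTree_T.isAcyclic hab
  rintro ⟨p⟩
  suffices key : ∀ (x y : Fin I.n) (p : (I.T.spanningCoe.deleteEdges {s(a, b)}).Walk x y)
      (hx : x ∈ I.T.verts) (hy : y ∈ I.T.verts),
      (I.T.coe.deleteEdges {s(⟨a, ha⟩, ⟨b, hb⟩)}).Reachable ⟨x, hx⟩ ⟨y, hy⟩ from
    hbr (key a b p ha hb)
  intro x y p hx hy
  induction p with
  | nil => rfl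
  | @cons x z y h p ih =>
    obtain ⟨h1, h2⟩ := deleteEdges_adj.1 h
    have h1 : I.T.Adj x z := h1
    have hadj : (I.T.coe.deleteEdges {s(⟨a, ha⟩, ⟨b, hb⟩)}).Adj ⟨x, hx⟩ ⟨z, h1.snd_mem⟩ := by
      refine deleteEdges_adj.2 ⟨h1, fun he => h2 ?_⟩
      simpa [Sym2.eq_iff, Subtype.ext_iff] using he
    exact hadj.reachable.trans (ih h1.snd_mem hy)

/-- Every tree edge covered by `M` is crossed by two terminals that are connected by links inside
`M`. -/
theorem Covers.exists_crossing (hab : I.T.Adj a b) (hc : I.Covers M a b) :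
    ∃ y ∈ I.R, ∃ y' ∈ I.R, I.Side a b y ∧ ¬ I.Side a b y' ∧ (I.links.within M).Reachable y y' := by
  by_contra! hcon
  obtain ⟨p⟩ := hc
  suffices key : ∀ (x z : Fin I.n) (p : ((I.G.deleteEdges {s(a, b)}).within M).Walk x z),
      (∃ y ∈ I.R, I.Side a b y ∧ (I.links.within M).Reachable y x) →
      ∃ y ∈ I.R, I.Side a b y ∧ (I.links.within M).Reachable y z by
    obtain ⟨y, hy, hs, h⟩ := key a b p ⟨a, mem_R_of_adj hab, .rfl, .rfl⟩
    exact hcon y hy b (mem_R_of_adj hab.symm) hs (not_side_self hab) h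
  intro x z p
  induction p with
  | nil => exact id
  | @cons x t z h p ih =>
    rintro ⟨y, hy, hs, hyx⟩
    apply ih
    obtain ⟨h1, h2⟩ := deleteEdges_adj.1 h.1
    -- Along a tree edge other than ab, x is a terminal linked to y; in the absence of a crossing it
    -- lies on the side of a, hence so does t, which becomes the new witness. Along a link the old
    -- witness is kept.
    by_cases hT : I.T.Adj x t
    · have hx : I.Side a b x := by
        by_contra hx
        exact hcon y hy x (mem_R_of_adj hT) hs hx hyx
      have hadj : (I.T.spanningCoe.deleteEdges {s(a, b)}).Adj x t := deleteEdges_adj.2 ⟨hT, h2⟩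
      exact ⟨t, mem_R_of_adj hT.symm, hx.trans hadj.reachable, .rfl⟩
    · have hadj : (I.links.within M).Adj x t := ⟨I.links_adj.2 ⟨h1, hT⟩, h.2⟩
      exact ⟨y, hy, hs, hyx.trans hadj.reachable⟩

/-- What one round with threshold `lam` does to the current set `M`. -/
structure Level (I : NWSTAP) (w : Fin I.n → ℕ) (lam : ℕ) (M M' : Finset (Fin I.n)) : Prop where
  subset : M ⊆ M'
  cost_le : ∑ x ∈ M', w x ≤ ∑ x ∈ M, w x + 2 * lam * (I.cov M' - I.cov M)
  spider_le : ∀ v, ∀ Y ⊆ I.R, Y.Nonempty → (∀ y ∈ Y, I.links.Reachable v y) →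
    lam * I.unc M' Y ≤ w v + ∑ y ∈ Y, I.links.nodeDist w v y

/-- After a round with threshold `lam`, the number of uncovered edges is small in comparison with
the weight of any set that covers all edges. -/
theorem Level.mul_uncovered_le {w : Fin I.n → ℕ} {lam : ℕ} (hl : I.Level w lam M M')
    (hw : ∀ v ∈ I.R, w v = 0) {S : Finset (Fin I.n)} (hS : I.R ⊆ S)
    (hcov : ∀ a b, I.T.Adj a b → I.Covers S a b) :
    lam * I.uncovered M' ≤ (Nat.log 2 I.R.card + 2) * ∑ x ∈ S, w x := by
  classical
  set C := I.R.image (I.links.compOn S) with hC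
  have hpw : (C : Set (Finset (Fin I.n))).PairwiseDisjoint id := by
    intro c hc c' hc' hne
    rw [Function.onFun, id, id, Finset.disjoint_left]
    intro z hz hz'
    obtain ⟨x, -, rfl⟩ := mem_image.1 hc
    obtain ⟨x', -, rfl⟩ := mem_image.1 hc'
    exact hne (compOn_eq hz hz')
  -- Each edge is covered by S, hence crossed by the terminals of one component of the links inside
  -- S. Summing over these disjoint components counts every uncovered edge.
  have h1 : I.uncovered M' ≤ ∑ c ∈ C, I.unc M' (c ∩ I.R) := by
    refine le_trans (card_le_card fun p hp => ?_) (card_biUnion_le (s := C)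
      (t := fun c => {p : Fin I.n × Fin I.n |
        I.T.Adj p.1 p.2 ∧ ¬ I.Covers M' p.1 p.2 ∧ I.Crosses p.1 p.2 (c ∩ I.R)}))
    simp only [mem_biUnion, mem_filter, mem_univ, true_and] at hp ⊢
    obtain ⟨y, hy, y', hy', hs, hs', h⟩ := (hcov p.1 p.2 hp.1).exists_crossing hp.1
    exact ⟨_, mem_image_of_mem _ hy, hp.1, hp.2,
      ⟨y, mem_inter.2 ⟨mem_compOn.2 ⟨hS hy, .rfl⟩, hy⟩, hs⟩,
      y', mem_inter.2 ⟨mem_compOn.2 ⟨hS hy', h⟩, hy'⟩, hs'⟩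
  have h2 : ∀ c ∈ C, lam * I.unc M' (c ∩ I.R) ≤
      (Nat.log 2 I.R.card + 2) * ∑ x ∈ c, w x := by
    intro c hc
    obtain ⟨x, hx, rfl⟩ := mem_image.1 hc
    exact le_log_mul_of_spiders (h := fun Y => lam * I.unc M' Y) (d := I.links.nodeDist w) hw
      (nodeDist_le _ _)
      (fun X Y h => by
        rw [← mul_add]; exact Nat.mul_le_mul_left _ (unc_union_le M' X Y h))
      hl.spider_le (connectedOn_compOn _ _ _)
      ⟨x, mem_inter.2 ⟨mem_compOn.2 ⟨hS hx, .rfl⟩, hx⟩⟩ le_rfl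
  calc lam * I.uncovered M' ≤ ∑ c ∈ C, lam * I.unc M' (c ∩ I.R) := by
        rw [← mul_sum]; exact Nat.mul_le_mul_left _ h1
    _ ≤ ∑ c ∈ C, (Nat.log 2 I.R.card + 2) * ∑ x ∈ c, w x := sum_le_sum h2
    _ = (Nat.log 2 I.R.card + 2) * ∑ x ∈ C.biUnion id, w x := by
        rw [← mul_sum, sum_biUnion hpw]; rfl
    _ ≤ _ := by
        refine Nat.mul_le_mul_left _ (sum_le_sum_of_subset (biUnion_subset.2 fun c hc => ?_))
        obtain ⟨x, -, rfl⟩ := mem_image.1 hc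
        exact compOn_subset _ _ _

/-- The empty set covers no edge, so `uncovered ∅` is the number of all oriented tree edges. -/
theorem cov_add_uncovered (M : Finset (Fin I.n)) : I.cov M + I.uncovered M = I.uncovered ∅ := by
  classical
  have h0 : ∀ a b, I.T.Adj a b → ¬ I.Covers ∅ a b := by
    rintro a b hab ⟨p⟩
    cases p with
    | nil => exact I.T.loopless.irrefl _ hab
    | cons h _ => exact absurd h.2.1 (notMem_empty _)
  unfold cov uncovered
  rw [← card_union_of_disjoint]
  · congr 1
    ext p
    simp only [mem_union, mem_filter, mem_univ, true_and]
    have := h0 p.1 p.2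
    tauto
  · rw [Finset.disjoint_left]
    intro p hp hp'
    simp only [mem_filter, mem_univ, true_and] at hp hp'
    exact hp'.2 hp.2

/-- A crude count suffices: it enters the final bound only inside a logarithm and through the choice
of the scale. -/
theorem uncovered_le (M : Finset (Fin I.n)) : I.uncovered M ≤ I.R.card ^ 2 := by
  classical
  rw [sq, ← card_product]
  refine card_le_card fun p hp => ?_
  simp only [mem_filter, mem_univ, true_and] at hp
  exact mem_product.2 ⟨mem_R_of_adj hp.1, mem_R_of_adj hp.1.symm⟩

theorem covers_of_uncovered_eq_zero (h : I.uncovered M = 0) (hab : I.T.Adj a b) :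
    I.Covers M a b := by
  classical
  rw [uncovered, card_eq_zero, filter_eq_empty_iff] at h
  by_contra hc
  exact h (mem_univ (a, b)) ⟨hab, hc⟩

theorem Feasible.covers {S : Finset (Fin I.n)} (hS : I.Feasible S) (hab : I.T.Adj a b) :
    I.Covers (I.R ∪ S) a b := by
  have ha : a ∈ ((I.R ∪ S : Finset (Fin I.n)) : Set (Fin I.n)) :=
    mem_coe.2 (mem_union_left _ (mem_R_of_adj hab))
  have hb : b ∈ ((I.R ∪ S : Finset (Fin I.n)) : Set (Fin I.n)) :=
    mem_coe.2 (mem_union_left _ (mem_R_of_adj hab.symm))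
  have h := isEdgeConnected_two.1 hS.2 s(⟨a, ha⟩, ⟨b, hb⟩) ⟨a, ha⟩ ⟨b, hb⟩
  refine h.map (G' := (I.G.deleteEdges {s(a, b)}).within (I.R ∪ S)) ⟨Subtype.val, ?_⟩
  rintro ⟨x, hx⟩ ⟨y, hy⟩ hxy
  obtain ⟨h1, h2⟩ := deleteEdges_adj.1 hxy
  refine ⟨deleteEdges_adj.2 ⟨h1, fun he => h2 ?_⟩, hx, hy⟩
  simpa [Sym2.eq_iff, Subtype.ext_iff] using he

/-- Removing the vertices that are not 2-edge-connected with the terminals leaves a feasible set. -/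
theorem feasible_of_covers {A : Finset (Fin I.n)} (hM : I.R ⊆ M)
    (hcov : ∀ a b, I.T.Adj a b → I.Covers M a b)
    (hA : ∀ x, x ∈ A ↔ x ∉ I.R ∧
      ∀ a b, ∀ r ∈ I.R, ((I.G.deleteEdges {s(a, b)}).within M).Reachable r x) :
    I.Feasible A := by
  -- If the deleted edge lies on the tree path, coverage of this edge supplies a detour.
  have htree : ∀ a b, ∀ r ∈ I.R, ∀ x ∈ I.R,
      ((I.G.deleteEdges {s(a, b)}).within M).Reachable r x := by
    intro a b r hr x hx
    obtain ⟨p⟩ := tree_reachable hr hx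
    induction p with
    | nil => rfl
    | @cons x z y h p ih =>
      have h : I.T.Adj x z := h
      refine Reachable.trans ?_ (ih (mem_R_of_adj h.symm) hx)
      by_cases he : s(x, z) = s(a, b)
      · rw [← he]
        exact hcov x z h
      · exact Adj.reachable ⟨deleteEdges_adj.2 ⟨h.adj_sub, he⟩, hM (mem_R_of_adj h),
          hM (mem_R_of_adj h.symm)⟩
  refine ⟨Finset.disjoint_left.2 fun x hx => ((hA x).1 hx).1, isEdgeConnected_two.2 fun e => ?_⟩
  have hB : ∀ x, x ∈ I.R ∪ A ↔
      ∀ a b, ∀ r ∈ I.R, ((I.G.deleteEdges {s(a, b)}).within M).Reachable r x := by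
    intro x
    rw [mem_union, hA]
    by_cases hx : x ∈ I.R
    · simp only [hx, true_or, true_iff]
      exact fun a b r hr => htree a b r hr x hx
    · simp [hx]
  obtain ⟨r, hr⟩ := I.R_nonempty
  induction e using Sym2.ind with
  | _ a b =>
  have key : ∀ (x y : Fin I.n) (p : ((I.G.deleteEdges {s(a.1, b.1)}).within (I.R ∪ A)).Walk x y)
      (hx : x ∈ ((I.R ∪ A : Finset (Fin I.n)) : Set (Fin I.n)))
      (hy : y ∈ ((I.R ∪ A : Finset (Fin I.n)) : Set (Fin I.n))),
      ((I.G.induce ((I.R ∪ A : Finset (Fin I.n)) : Set (Fin I.n))).deleteEdges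
        {s(a, b)}).Reachable ⟨x, hx⟩ ⟨y, hy⟩ := by
    intro x y p hx hy
    induction p with
    | nil => rfl
    | @cons x z y h p ih =>
      obtain ⟨h1, h2⟩ := deleteEdges_adj.1 h.1
      have hadj : ((I.G.induce ((I.R ∪ A : Finset (Fin I.n)) : Set (Fin I.n))).deleteEdges
          {s(a, b)}).Adj ⟨x, hx⟩ ⟨z, h.2.2⟩ := by
        refine deleteEdges_adj.2 ⟨h1, fun he => h2 ?_⟩
        simpa [Sym2.eq_iff, Subtype.ext_iff] using he
      exact hadj.reachable.trans (ih h.2.2 hy)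
  have hroot : ∀ x : ((I.R ∪ A : Finset (Fin I.n)) : Set (Fin I.n)), ((I.G.induce
      ((I.R ∪ A : Finset (Fin I.n)) : Set (Fin I.n))).deleteEdges {s(a, b)}).Reachable
        ⟨r, mem_coe.2 (mem_union_left _ hr)⟩ x := by
    intro x
    obtain ⟨p⟩ := reachable_within_of_forall hB subset_union_left hr x.2 a.1 b.1
    exact key r x.1 p _ x.2
  exact fun x y => (hroot x).symm.trans (hroot y)

end NWSTAP

/-! ### Summing the costs of the rounds -/

/-- Each of the a - b reciprocals in the difference of harmonic numbers is at least 1 / a. -/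
theorem sub_le_mul_harmonic_sub {a b : ℕ} (h : b ≤ a) :
    (a : ℚ) - b ≤ a * (harmonic a - harmonic b) := by
  suffices key : 0 ≤ harmonic a - harmonic b ∧ (a : ℚ) - b ≤ a * (harmonic a - harmonic b) from
    key.2
  induction a, h using Nat.le_induction with
  | base => simp
  | succ a _ ih =>
    obtain ⟨h1, h2⟩ := ih
    have h3 : ((a : ℚ) + 1) * ((a : ℚ) + 1)⁻¹ = 1 := mul_inv_cancel₀ (by positivity)
    have h4 : (0 : ℚ) < ((a : ℚ) + 1)⁻¹ := by positivity
    rw [harmonic_succ]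
    push_cast
    constructor
    · linarith
    · nlinarith

/-- The total cost of rounds with doubling thresholds, each paying at most twice the threshold per
newly covered element and leaving at most `β / 2 ^ k` elements uncovered. -/
theorem cost_le_harmonic {u W : ℕ → ℕ} {β B : ℕ} (hu : ∀ k < B, u (k + 1) ≤ u k) (hW : W 0 = 0)
    (hcost : ∀ k < B, W (k + 1) ≤ W k + 2 * 2 ^ k * (u k - u (k + 1)))
    (hβ : ∀ k < B, 2 ^ k * u (k + 1) ≤ β) :
    ∀ k < B, (W (k + 1) : ℚ) ≤ 2 * u 0 + 4 * β * (harmonic (u 0) - harmonic (u (k + 1))) := by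
  have hmono : ∀ {a b : ℕ}, b ≤ a → 0 ≤ harmonic a - harmonic b := by
    intro a b h
    induction a, h using Nat.le_induction with
    | base => simp
    | succ a _ ih =>
      have h4 : (0 : ℚ) < ((a : ℚ) + 1)⁻¹ := by positivity
      rw [harmonic_succ]
      push_cast
      linarith
  intro k hk
  induction k with
  | zero =>
    -- No earlier round bounds u 0, so the round with threshold 1 is charged 2 per element; this is
    -- the source of the term 2 * u 0.
    have h1 := hcost 0 hk
    have h2 : (0 : ℚ) ≤ 4 * β * (harmonic (u 0) - harmonic (u 1)) :=
      mul_nonneg (by positivity) (hmono (hu 0 hk))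
    have h3 : W 1 ≤ 2 * u 0 := by simp only [zero_add, hW, pow_zero] at h1; omega
    have h4 : (W 1 : ℚ) ≤ 2 * u 0 := by exact_mod_cast h3
    simp only [zero_add]
    linarith
  | succ k ih =>
    have h0 := ih (by omega)
    have h1 : (W (k + 2) : ℚ) ≤ W (k + 1) + 2 * 2 ^ (k + 1) * (u (k + 1) - u (k + 2)) := by
      have h2 := hcost (k + 1) hk
      have h3 : u (k + 2) ≤ u (k + 1) := hu (k + 1) hk
      have h4 : (((u (k + 1) - u (k + 2) : ℕ)) : ℚ) = u (k + 1) - u (k + 2) := Nat.cast_sub h3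
      rw [← h4]
      exact_mod_cast h2
    have h2 := sub_le_mul_harmonic_sub (hu (k + 1) hk)
    -- The current threshold is 2 ^ (k + 1), while the bound on u (k + 1) stems from the previous
    -- round with threshold 2 ^ k; this turns the factor 2 into 4.
    have h3 : ((2 : ℚ) ^ k * u (k + 1)) ≤ β := by exact_mod_cast hβ k (by omega)
    have h4 := hmono (hu (k + 1) hk)
    have h5 := mul_le_mul_of_nonneg_left h2 (show (0 : ℚ) ≤ 2 ^ k by positivity)
    have h6 := mul_le_mul_of_nonneg_right h3 h4
    rw [pow_succ] at h1
    simp only [Nat.add_assoc, Nat.reduceAdd] at *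
    nlinarith

namespace NWSTAP

variable {I : NWSTAP}

/-- A chain of rounds with doubling thresholds covers all edges at a cost within the claimed factor
of the optimum. -/
theorem covers_and_cost_le_of_levels {w : Fin I.n → ℕ} {scale B : ℕ} (hB0 : B ≠ 0)
    (hw : ∀ v ∈ I.R, w v = 0) (hdvd : ∀ v, scale ∣ w v) (hscale : 2 * I.R.card ^ 2 < scale)
    {Ms : ℕ → Finset (Fin I.n)} (h0 : Ms 0 = I.R)
    (hl : ∀ k < B, I.Level w (2 ^ k) (Ms k) (Ms (k + 1)))
    {S : Finset (Fin I.n)} (hS : I.Feasible S)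
    (hB : (Nat.log 2 I.R.card + 2) * (∑ x, w x) * 2 < 2 ^ B) :
    (∀ a b, I.T.Adj a b → I.Covers (Ms B) a b) ∧
      ((∑ x ∈ Ms B, w x : ℕ) : ℝ) ≤ 100 * Real.log I.R.card ^ 2 * ((∑ x ∈ S, w x : ℕ) : ℝ) := by
  have hSw : ∑ x ∈ I.R ∪ S, w x = ∑ x ∈ S, w x := by
    rw [sum_union hS.1.symm, sum_eq_zero hw, zero_add]
  obtain ⟨B, rfl⟩ := Nat.exists_eq_succ_of_ne_zero hB0
  set u := fun k => I.uncovered (Ms k) with hu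
  set β := (Nat.log 2 I.R.card + 2) * ∑ x ∈ S, w x with hβ
  have hcu : ∀ k, I.cov (Ms k) + u k = I.uncovered ∅ := fun k => cov_add_uncovered _
  have hanti : ∀ k < B + 1, u (k + 1) ≤ u k := fun k hk => by
    have := cov_mono (hl k hk).subset
    have := hcu k
    have := hcu (k + 1)
    omega
  have hlev : ∀ k < B + 1, 2 ^ k * u (k + 1) ≤ β := fun k hk => by
    have := (hl k hk).mul_uncovered_le hw subset_union_left (fun a b hab => hS.covers hab)
    rwa [hSw] at this
  have hcost : ∀ k < B + 1, ∑ x ∈ Ms (k + 1), w x ≤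
      ∑ x ∈ Ms k, w x + 2 * 2 ^ k * (u k - u (k + 1)) := fun k hk => by
    have h1 := (hl k hk).cost_le
    have : I.cov (Ms (k + 1)) - I.cov (Ms k) = u k - u (k + 1) := by
      have := hcu k
      have := hcu (k + 1)
      omega
    rwa [this] at h1
  have hβle : β ≤ (Nat.log 2 I.R.card + 2) * ∑ x, w x :=
    Nat.mul_le_mul_left _ (sum_le_sum_of_subset (subset_univ _))
  -- The last threshold exceeds β, so a single uncovered edge would already violate the bound of the
  -- last round.
  have huB : u (B + 1) = 0 := by
    by_contra hne
    have h1 := hlev B (by omega)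
    have h2 : 2 ^ B * 1 ≤ 2 ^ B * u (B + 1) := Nat.mul_le_mul_left _ (by omega)
    rw [pow_succ] at hB
    omega
  refine ⟨fun a b hab => covers_of_uncovered_eq_zero huB hab, ?_⟩
  have hmain := cost_le_harmonic (W := fun k => ∑ x ∈ Ms k, w x) hanti
    (by simp only [h0]; exact sum_eq_zero hw) hcost hlev B (by omega)
  have hu0 : u 0 ≤ I.R.card ^ 2 := uncovered_le _
  simp only [huB, harmonic_zero, sub_zero] at hmain
  set W := ∑ x ∈ Ms (B + 1), w x with hW
  set O := ∑ x ∈ S, w x with hO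
  have hmainR : (W : ℝ) ≤ 2 * u 0 + 4 * β * (harmonic (u 0) : ℝ) := by
    have := (Rat.cast_le (K := ℝ)).2 hmain
    push_cast at this
    exact this
  -- With a single terminal the factor log² is 0, but then there are no tree edges and nothing is
  -- bought.
  rcases Nat.lt_or_ge I.R.card 2 with hR | hR
  · have hu00 : u 0 = 0 := by
      classical
      simp only [hu, uncovered, card_eq_zero, filter_eq_empty_iff]
      rintro ⟨a, b⟩ - ⟨hab, -⟩
      have := card_le_one.1 (show I.R.card ≤ 1 by omega) a (mem_R_of_adj hab) b
        (mem_R_of_adj hab.symm)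
      exact hab.ne this
    rw [hu00] at hmainR
    simp only [Nat.cast_zero, mul_zero, harmonic_zero, Rat.cast_zero, add_zero] at hmainR
    exact hmainR.trans (by positivity)
  -- All weights are multiples of a number exceeding 2 * u 0. If O = 0, then W ≤ 2 * u 0 forces W =
  -- 0; otherwise O absorbs the term 2 * u 0.
  rcases Nat.eq_zero_or_pos O with hO0 | hOpos
  · have hβ0 : β = 0 := by rw [hβ, hO0, mul_zero]
    rw [hβ0] at hmainR
    have h1 : W ≤ 2 * u 0 := by
      have : (W : ℝ) ≤ ((2 * u 0 : ℕ) : ℝ) := by push_cast; simpa using hmainR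
      exact_mod_cast this
    have h2 : scale ∣ W := dvd_sum fun x _ => hdvd x
    have h3 : W = 0 := Nat.eq_zero_of_dvd_of_lt h2 (by omega)
    rw [h3, hO0]
    simp
  · have h1 : scale ∣ O := dvd_sum fun x _ => hdvd x
    have h2 : 2 * u 0 ≤ O := by have := Nat.le_of_dvd hOpos h1; omega
    have h2R : (2 : ℝ) * u 0 ≤ O := by exact_mod_cast h2
    set l := Real.log I.R.card with hl'
    have hlog2 : (1 : ℝ) / 2 ≤ Real.log 2 := by have := Real.log_two_gt_d9; linarith
    have hRr : (2 : ℝ) ≤ I.R.card := by exact_mod_cast hR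
    have hl1 : 1 / 2 ≤ l := hlog2.trans (Real.log_le_log (by norm_num) hRr)
    have hL : (Nat.log 2 I.R.card : ℝ) ≤ 2 * l := by
      have h3 : ((2 : ℝ) ^ Nat.log 2 I.R.card) ≤ I.R.card := by
        exact_mod_cast Nat.pow_log_le_self 2 (by omega)
      have h4 := Real.log_le_log (by positivity) h3
      rw [Real.log_pow] at h4
      have h5 : (0 : ℝ) ≤ Nat.log 2 I.R.card := by positivity
      nlinarith
    have hh : (harmonic (u 0) : ℝ) ≤ 1 + 2 * l := by
      refine (harmonic_le_one_add_log (u 0)).trans ?_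
      rcases Nat.eq_zero_or_pos (u 0) with h3 | h3
      · rw [h3]; simp; linarith
      · have h4 : Real.log (u 0) ≤ Real.log ((I.R.card : ℝ) ^ 2) :=
          Real.log_le_log (by exact_mod_cast h3) (by exact_mod_cast hu0)
        rw [Real.log_pow] at h4
        push_cast at h4
        linarith
    have hβR : (β : ℝ) = (Nat.log 2 I.R.card + 2) * O := by rw [hβ]; push_cast; ring
    have hOr : (0 : ℝ) ≤ O := by positivity
    -- From l ≥ 1 / 2: log₂|R| + 2 ≤ 2 l + 4 l, and 1 + 2 l ≤ 4 l. The harmonic term contributes 4 ·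
    -- 6 · 4 = 96, and O ≤ 4 l² O contributes the remaining 4.
    have hβ6 : (β : ℝ) ≤ 6 * l * O := by
      rw [hβR]
      exact mul_le_mul_of_nonneg_right (by linarith) hOr
    have h7 : 4 * (β : ℝ) * (harmonic (u 0) : ℝ) ≤ 4 * (6 * l * O) * (4 * l) := by
      have : (0 : ℝ) ≤ 4 * β := by positivity
      calc 4 * (β : ℝ) * (harmonic (u 0) : ℝ) ≤ 4 * β * (4 * l) :=
            mul_le_mul_of_nonneg_left (by linarith) this
        _ ≤ _ := mul_le_mul_of_nonneg_right (by linarith) (by linarith)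
    have h8 : (1 : ℝ) ≤ 4 * l ^ 2 := by nlinarith
    have h9 : (O : ℝ) ≤ 4 * l ^ 2 * O := by nlinarith
    nlinarith

end NWSTAP

/-! ### Shortest paths with node weights on the machine -/

namespace RAM

namespace Expr

/-- Negation, where nonzero means true. -/
def not (e : Expr) : Expr := .sub (.lit 1) e

/-- Conjunction, where nonzero means true. -/
def and (e f : Expr) : Expr := .not (.add e.not f.not)

/-- Disjunction, where nonzero means true. -/
def or (e f : Expr) : Expr := .add e f

/-- The test `e < f`. -/
def lt (e f : Expr) : Expr := .sub f e

/-- The test `e ≤ f`. -/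
def le (e f : Expr) : Expr := .not (.sub e f)

/-- The test `e = f`. -/
def eq (e f : Expr) : Expr := .not (.add (.sub e f) (.sub f e))

variable {s : State} {e f : Expr}

theorem eval_not : e.not.eval s ≠ 0 ↔ ¬ e.eval s ≠ 0 := by
  simp only [not, eval]; omega

theorem eval_and : (e.and f).eval s ≠ 0 ↔ e.eval s ≠ 0 ∧ f.eval s ≠ 0 := by
  simp only [and, not, eval]; omega

theorem eval_or : (e.or f).eval s ≠ 0 ↔ e.eval s ≠ 0 ∨ f.eval s ≠ 0 := by
  simp only [or, eval]; omega

theorem eval_lt : (e.lt f).eval s ≠ 0 ↔ e.eval s < f.eval s := by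
  simp only [lt, eval]; omega

theorem eval_le : (e.le f).eval s ≠ 0 ↔ e.eval s ≤ f.eval s := by
  simp only [le, not, eval]; omega

theorem eval_eq : (e.eq f).eval s ≠ 0 ↔ e.eval s = f.eval s := by
  simp only [eq, not, eval]; omega

/-- The entry `(i, j)` of the matrix that starts at the cell `o` of the array `a`; array `1` holds
the offsets of the rows. -/
def entry (a : ℕ) (o i j : Expr) : Expr := .get a (.add (.add o (.get 1 i)) j)

end Expr

/-- The set of vertices whose cells in the array `a` are nonzero. -/
def mask (n : ℕ) (s : State) (a : ℕ) : Finset (Fin n) := {x | s.arr a x ≠ 0}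

/-- The set of vertices whose cells in row `y` of the array `a` are nonzero. -/
def rowMask (n : ℕ) (s : State) (a y : ℕ) : Finset (Fin n) := {x | s.arr a (y * n + x) ≠ 0}

theorem mem_mask {n : ℕ} {s : State} {a : ℕ} {x : Fin n} : x ∈ mask n s a ↔ s.arr a x ≠ 0 := by
  simp [mask]

theorem mem_rowMask {n : ℕ} {s : State} {a y : ℕ} {x : Fin n} :
    x ∈ rowMask n s a y ↔ s.arr a (y * n + x) ≠ 0 := by
  simp [rowMask]

theorem row_index_inj {n y y' z z' : ℕ} (hz : z < n) (hz' : z' < n)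
    (h : y * n + z = y' * n + z') : y = y' ∧ z = z' := by
  have h1 : (y * n + z) / n = y := by
    rw [mul_comm, Nat.mul_add_div (by omega), Nat.div_eq_of_lt hz, add_zero]
  have h2 : (y' * n + z') / n = y' := by
    rw [mul_comm, Nat.mul_add_div (by omega), Nat.div_eq_of_lt hz', add_zero]
  have h3 : y = y' := by rw [← h1, ← h2, h]
  subst h3
  exact ⟨rfl, by omega⟩

/-- The data that the main part of the program works with: in the registers `1`, `2`, `3` the number
`n` of vertices, the bound `B` for the number of rounds, and `n ^ 2`; in the arrays `0`, `1`, `2`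
the input, the offsets of the rows and the weights. -/
structure Ctx (I : NWSTAP) (w : Fin I.n → ℕ) (B : ℕ) (s : State) : Prop where
  reg_n : s.reg 1 = I.n
  reg_B : s.reg 2 = B
  reg_sq : s.reg 3 = I.n * I.n
  off : ∀ u < I.n, s.arr 1 u = u * I.n
  weight : ∀ u : Fin I.n, s.arr 2 u = w u
  adj : ∀ u v : Fin I.n, s.arr 0 (1 + u * I.n + v) ≠ 0 ↔ I.G.Adj u v
  tree : ∀ u v : Fin I.n, s.arr 0 (1 + I.n * I.n + u * I.n + v) ≠ 0 ↔ I.T.Adj u v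
  terminal : ∀ v : Fin I.n, s.arr 0 (1 + I.n * I.n + I.n * I.n + v) ≠ 0 ↔ v ∈ I.R

theorem Ctx.agree {I : NWSTAP} {w : Fin I.n → ℕ} {B : ℕ} {s t : State} {rs as : List ℕ}
    (h : Ctx I w B s) (hst : s.Agree rs as t) (h1 : 1 ∉ rs) (h2 : 2 ∉ rs) (h3 : 3 ∉ rs)
    (h0' : 0 ∉ as) (h1' : 1 ∉ as) (h2' : 2 ∉ as) : Ctx I w B t := by
  obtain ⟨a1, a2, a3, a4, a5, a6, a7, a8⟩ := h
  constructor
  · rw [hst.1 1 h1, a1]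
  · rw [hst.1 2 h2, a2]
  · rw [hst.1 3 h3, a3]
  · rw [hst.2 1 h1']; exact a4
  · rw [hst.2 2 h2']; exact a5
  · rw [hst.2 0 h0']; exact a6
  · rw [hst.2 0 h0']; exact a7
  · rw [hst.2 0 h0']; exact a8

namespace Cmd

/-- Relax the edge from the vertex in register `22` to the vertex in register `23`. The array `aD`
holds `0` for the vertices that have not been reached and the distance plus one for the others, the
row of a vertex in `aP` a path to it. -/
def relax (cond : Expr) (aD aP : ℕ) : Cmd :=
  .ite (.and (.get aD (.reg 22)) (.and cond (.or (.not (.get aD (.reg 23)))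
      (.lt (.add (.get aD (.reg 22)) (.get 2 (.reg 23))) (.get aD (.reg 23))))))
    (.seq (.store aD (.reg 23) (.add (.get aD (.reg 22)) (.get 2 (.reg 23))))
      (.seq (.loopTo 24 1 (.store aP (.add (.get 1 (.reg 23)) (.reg 24))
          (.get aP (.add (.get 1 (.reg 22)) (.reg 24)))))
        (.store aP (.add (.get 1 (.reg 23)) (.reg 23)) (.lit 1))))
    .skip

/-- Shortest paths with node weights from the vertex in register `20`. The expression `cond`
decides whether the vertices in the registers `22` and `23` are adjacent. -/
def bellmanFord (cond : Expr) (aD aP : ℕ) : Cmd :=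
  .seq (.loopTo 22 1 (.store aD (.reg 22) (.lit 0)))
    (.seq (.store aD (.reg 20) (.lit 1))
      (.seq (.loopTo 24 1 (.store aP (.add (.get 1 (.reg 20)) (.reg 24)) (.lit 0)))
        (.seq (.store aP (.add (.get 1 (.reg 20)) (.reg 20)) (.lit 1))
          (.loopTo 21 1 (.loopTo 22 1 (.loopTo 23 1 (relax cond aD aP)))))))

end Cmd

section BellmanFord

open State Cmd SimpleGraph

variable {I : NWSTAP} {w : Fin I.n → ℕ} {B : ℕ} {F : SimpleGraph (Fin I.n)} {src : Fin I.n}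
  {cond : Expr} {aD aP : ℕ}

/-- Every reached vertex comes with a connected set of the recorded weight that contains it. -/
def Sound (I : NWSTAP) (w : Fin I.n → ℕ) (F : SimpleGraph (Fin I.n)) (src : Fin I.n) (aD aP : ℕ)
    (t : State) : Prop :=
  ∀ x : Fin I.n, t.arr aD x ≠ 0 → x ∈ rowMask I.n t aP x ∧
    (∀ z ∈ rowMask I.n t aP x, (F.within (rowMask I.n t aP x)).Reachable src z) ∧
    src ∈ rowMask I.n t aP x ∧ ∑ z ∈ rowMask I.n t aP x, w z + 1 ≤ w src + t.arr aD x

/-- The order on distances, where `0` stands for infinity. -/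
def DLe (p q : ℕ) : Prop := q ≠ 0 → p ≠ 0 ∧ p ≤ q

theorem DLe.refl (p : ℕ) : DLe p p := fun h => ⟨h, le_rfl⟩

theorem DLe.trans {p q r : ℕ} (h : DLe p q) (h' : DLe q r) : DLe p r := fun hr =>
  ⟨(h (h' hr).1).1, (h (h' hr).1).2.trans (h' hr).2⟩

theorem copy_row {s : State} (hs : Ctx I w B s) (ha1 : aP ≠ 1) {a x : Fin I.n}
    (hr22 : s.reg 22 = a) (hr23 : s.reg 23 = x) (hax : a ≠ x) :
    let t := (Cmd.loopTo 24 1 (.store aP (.add (.get 1 (.reg 23)) (.reg 24))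
          (.get aP (.add (.get 1 (.reg 22)) (.reg 24))))).run s
    (∀ z < I.n, t.arr aP (x * I.n + z) = s.arr aP (a * I.n + z)) ∧
      ∀ y : Fin I.n, y ≠ x → ∀ z < I.n, t.arr aP (y * I.n + z) = s.arr aP (y * I.n + z) := by
  have := loopTo_induction (s := s) (r := 24) (b := 1) (p := .store aP
      (.add (.get 1 (.reg 23)) (.reg 24)) (.get aP (.add (.get 1 (.reg 22)) (.reg 24))))
    (I := fun k t => (∀ z < k, t.arr aP (x * I.n + z) = s.arr aP (a * I.n + z)) ∧
      ∀ y : Fin I.n, y ≠ x → ∀ z < I.n, t.arr aP (y * I.n + z) = s.arr aP (y * I.n + z))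
    (fun _ _ _ h => h) (by simp) ?_
  · rw [hs.reg_n] at this
    exact this
  · intro k hk t hag hk' ⟨h1, h2⟩
    rw [hs.reg_n] at hk
    have e22 : t.reg 22 = a := by rw [hag.1 22 (by simp [regs]), hr22]
    have e23 : t.reg 23 = x := by rw [hag.1 23 (by simp [regs]), hr23]
    have e1 : t.arr 1 = s.arr 1 := hag.2 1 (by simp [arrs, ha1.symm])
    simp only [run, Expr.eval, e22, e23, hk', e1, hs.off _ x.2, hs.off _ a.2]
    constructor
    · intro z hz
      simp only [setArr_arr, true_and]
      split_ifs with h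
      · rw [h2 a hax k hk, show z = k by omega]
      · exact h1 z (by omega)
    · intro y hy z hz
      simp only [setArr_arr, true_and]
      split_ifs with h
      · exact absurd (row_index_inj hz hk h).1 (fun e => hy (Fin.ext e))
      · exact h2 y hy z hz

/-- A successful relaxation replaces the row of x by the row of a with x inserted, which stays
connected. If x was already in the row of a, its weight is not added again, so `Sound` can only
claim an inequality. -/
theorem relax_spec {s : State} (hs : Ctx I w B s) (hDP : aD ≠ aP) (hP : aP ∉ [0, 1, 2])
    (hD : aD ∉ [0, 1, 2]) {a x : Fin I.n} (hr22 : s.reg 22 = a) (hr23 : s.reg 23 = x)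
    (hcond : cond.eval s ≠ 0 ↔ F.Adj a x) (hsound : Sound I w F src aD aP s) :
    Sound I w F src aD aP ((relax cond aD aP).run s) ∧
      (∀ z : Fin I.n, DLe (((relax cond aD aP).run s).arr aD z) (s.arr aD z)) ∧
      (F.Adj a x → s.arr aD a ≠ 0 → DLe (((relax cond aD aP).run s).arr aD x)
        (s.arr aD a + w x)) := by
  simp only [List.mem_cons, List.not_mem_nil, not_or, or_false] at hP hD
  obtain ⟨hP0, hP1, hP2⟩ := hP
  obtain ⟨hD0, hD1, hD2⟩ := hD
  rw [relax]
  by_cases h : (Expr.and (.get aD (.reg 22)) (.and cond (.or (.not (.get aD (.reg 23)))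
      (.lt (.add (.get aD (.reg 22)) (.get 2 (.reg 23))) (.get aD (.reg 23)))))).eval s ≠ 0
  · rw [run_ite_pos h]
    simp only [Expr.eval_and, Expr.eval_or, Expr.eval_not, Expr.eval_lt, hcond] at h
    simp only [Expr.eval, hr22, hr23, hs.weight] at h
    obtain ⟨ha, hadj, hlt⟩ := h
    have hax : a ≠ x := hadj.ne
    rw [run_seq, run_seq, run_store, run_store]
    set s₁ := s.setArr aD (Expr.eval s (.reg 23))
      (Expr.eval s (.add (.get aD (.reg 22)) (.get 2 (.reg 23)))) with hs₁
    have hag : s.Agree [] [aD] s₁ := agree_setArr (by simp) _ _ _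
    have hctx₁ : Ctx I w B s₁ := hs.agree hag (by simp) (by simp) (by simp) (by simp [Ne.symm hD0])
      (by simp [Ne.symm hD1]) (by simp [Ne.symm hD2])
    obtain ⟨hc1, hc2⟩ := copy_row hctx₁ hP1 (a := a) (x := x) hr22 hr23 hax
    set s₂ := (Cmd.loopTo 24 1 (.store aP (.add (.get 1 (.reg 23)) (.reg 24))
          (.get aP (.add (.get 1 (.reg 22)) (.reg 24))))).run s₁ with hs₂
    have hag₂ := agree_run (Cmd.loopTo 24 1 (.store aP (.add (.get 1 (.reg 23)) (.reg 24))
          (.get aP (.add (.get 1 (.reg 22)) (.reg 24))))) s₁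
    rw [← hs₂] at hag₂
    have e23 : s₂.reg 23 = x := by rw [hag₂.1 23 (by simp [regs])]; exact hr23
    have e1 : s₂.arr 1 x = x * I.n := by
      rw [hag₂.2 1 (by simp [arrs, Ne.symm hP1])]; exact hctx₁.off x x.2
    have eD : s₂.arr aD = s₁.arr aD := hag₂.2 aD (by simp [arrs, hDP])
    have eP : s₁.arr aP = s.arr aP := hag.2 aP (by simp [hDP.symm])
    simp only [Expr.eval, e23, e1]
    set s₃ := s₂.setArr aP (x * I.n + x) 1 with hs₃
    have eD₃ : ∀ z : Fin I.n, s₃.arr aD z = if z = x then s.arr aD a + w x else s.arr aD z := by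
      intro z
      rw [hs₃, setArr_arr_of_ne _ hDP, eD, hs₁]
      simp [Expr.eval, hr22, hr23, hs.weight, Fin.ext_iff]
    have hrow : rowMask I.n s₃ aP x = insert x (rowMask I.n s aP a) := by
      ext z
      rw [mem_insert, mem_rowMask, mem_rowMask, hs₃]
      simp only [setArr_arr, true_and]
      split_ifs with h
      · have : z = x := Fin.ext (by omega)
        simp [this]
      · have : z ≠ x := fun e => h (by rw [e])
        rw [hc1 z z.2, eP]
        simp [this]
    have hrow' : ∀ y : Fin I.n, y ≠ x → rowMask I.n s₃ aP y = rowMask I.n s aP y := by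
      intro y hy
      ext z
      rw [mem_rowMask, mem_rowMask, hs₃]
      simp only [setArr_arr, true_and]
      rw [if_neg (fun h => hy (Fin.ext (row_index_inj z.2 x.2 h).1)), hc2 y hy z z.2, eP]
    refine ⟨fun z hz => ?_, fun z => ?_, fun _ _ => ?_⟩
    · by_cases hzx : z = x
      · subst hzx
        obtain ⟨g1, g2, g3, g4⟩ := hsound a ha
        rw [hrow, eD₃, if_pos rfl]
        have hsub : F.within (rowMask I.n s aP a) ≤ F.within (insert z (rowMask I.n s aP a)) :=
          within_mono le_rfl (subset_insert _ _)
        refine ⟨mem_insert_self _ _, fun y hy => ?_, mem_insert_of_mem g3, ?_⟩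
        · rcases mem_insert.1 hy with rfl | hy
          · exact ((g2 a g1).mono hsub).trans
              (Adj.reachable ⟨hadj, mem_insert_of_mem g1, mem_insert_self _ _⟩)
          · exact (g2 y hy).mono hsub
        · by_cases hz' : z ∈ rowMask I.n s aP a
          · rw [insert_eq_of_mem hz']; omega
          · rw [sum_insert hz']; omega
      · rw [eD₃, if_neg hzx] at hz
        rw [eD₃, if_neg hzx, hrow' z hzx]
        exact hsound z hz
    · rw [eD₃]
      split_ifs with hzx
      · subst hzx
        intro h0
        exact ⟨by omega, by omega⟩
      · exact .refl _
    · rw [eD₃, if_pos rfl]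
      exact .refl _
  · rw [run_ite_neg h]
    simp only [Expr.eval_and, Expr.eval_or, Expr.eval_not, Expr.eval_lt, hcond] at h
    simp only [Expr.eval, hr22, hr23, hs.weight] at h
    refine ⟨hsound, fun z => .refl _, fun hadj ha => ?_⟩
    simp only [run]
    intro _
    by_contra hcon
    apply h
    refine ⟨ha, hadj, ?_⟩
    omega

end BellmanFord

end RAM

namespace RAM

section BellmanFord

open State Cmd SimpleGraph

/-- `Steps F w src k x c` says that there is a walk with `k` edges from `src` to `x` whose vertices
other than the first have total weight `c`. -/
inductive Steps {V : Type*} (F : SimpleGraph V) (w : V → ℕ) (src : V) : ℕ → V → ℕ → Prop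
  | zero : Steps F w src 0 src 0
  | succ {k : ℕ} {a x : V} {c : ℕ} : Steps F w src k a c → F.Adj a x →
      Steps F w src (k + 1) x (c + w x)

variable {I : NWSTAP} {w : Fin I.n → ℕ} {B : ℕ} {F : SimpleGraph (Fin I.n)} {src : Fin I.n}
  {cond : Expr} {aD aP : ℕ}

theorem Ctx.of_agree_bf {s t : State} (hs : Ctx I w B s) (hP : aP ∉ [0, 1, 2])
    (hD : aD ∉ [0, 1, 2]) (h : Agree [21, 22, 23, 24] [aD, aP] s t) : Ctx I w B t := by
  simp only [List.mem_cons, List.not_mem_nil, not_or, or_false] at hP hD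
  refine hs.agree h (by simp) (by simp) (by simp) ?_ ?_ ?_ <;>
    simp only [List.mem_cons, List.not_mem_nil, not_or, or_false] <;> omega

/-- The expression `cond` decides adjacency in `F`. -/
def Decides (I : NWSTAP) (F : SimpleGraph (Fin I.n)) (cond : Expr) (aD aP : ℕ) (s : State) : Prop :=
  ∀ t, Agree [21, 22, 23, 24] [aD, aP] s t → ∀ a x : Fin I.n, t.reg 22 = a → t.reg 23 = x →
    (cond.eval t ≠ 0 ↔ F.Adj a x)

/-- Entries only decrease, so relaxing with the current value of a is at least as good as with its
value before the loop. -/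
theorem relax_row_spec {s : State} (hs : Ctx I w B s) (hDP : aD ≠ aP) (hP : aP ∉ [0, 1, 2])
    (hD : aD ∉ [0, 1, 2]) (hcond : Decides I F cond aD aP s) {a : Fin I.n} (hr22 : s.reg 22 = a)
    (hsound : Sound I w F src aD aP s) :
    let t := (Cmd.loopTo 23 1 (relax cond aD aP)).run s
    Sound I w F src aD aP t ∧ (∀ z : Fin I.n, DLe (t.arr aD z) (s.arr aD z)) ∧
      ∀ x : Fin I.n, F.Adj a x → s.arr aD a ≠ 0 → DLe (t.arr aD x) (s.arr aD a + w x) := by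
  have := loopTo_induction (s := s) (r := 23) (b := 1) (p := relax cond aD aP)
    (I := fun k t => Sound I w F src aD aP t ∧ (∀ z : Fin I.n, DLe (t.arr aD z) (s.arr aD z)) ∧
      ∀ x : Fin I.n, x < k → F.Adj a x → s.arr aD a ≠ 0 → DLe (t.arr aD x) (s.arr aD a + w x))
    (fun _ _ _ h => h) ⟨hsound, fun z => .refl _, fun x hx => absurd hx (by omega)⟩ ?_
  · rw [hs.reg_n] at this
    exact ⟨this.1, this.2.1, fun x => this.2.2 x x.2⟩
  · intro k hk t hag hk' ⟨h1, h2, h3⟩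
    rw [hs.reg_n] at hk
    have hag' : Agree [21, 22, 23, 24] [aD, aP] s t :=
      hag.mono (by simp [regs, relax]) (by simp [arrs, relax])
    have e22 : t.reg 22 = a := by rw [hag.1 22 (by simp [regs, relax]), hr22]
    obtain ⟨g1, g2, g3⟩ := relax_spec (hs.of_agree_bf hP hD hag') hDP hP hD (x := ⟨k, hk⟩) e22 hk'
      (hcond t hag' a ⟨k, hk⟩ e22 hk') h1
    refine ⟨g1, fun z => (g2 z).trans (h2 z), fun x hx hadj ha => ?_⟩
    rcases Nat.lt_or_ge x k with hxk | hxk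
    · exact (g2 x).trans (h3 x hxk hadj ha)
    · obtain rfl : x = ⟨k, hk⟩ := Fin.ext (by simp; omega)
      obtain ⟨h4, h5⟩ := h2 a ha
      exact (g3 hadj h4).trans fun _ => ⟨by omega, by omega⟩

theorem relax_round_spec {s : State} (hs : Ctx I w B s) (hDP : aD ≠ aP) (hP : aP ∉ [0, 1, 2])
    (hD : aD ∉ [0, 1, 2]) (hcond : Decides I F cond aD aP s)
    (hsound : Sound I w F src aD aP s) :
    let t := (Cmd.loopTo 22 1 (.loopTo 23 1 (relax cond aD aP))).run s
    Sound I w F src aD aP t ∧ (∀ z : Fin I.n, DLe (t.arr aD z) (s.arr aD z)) ∧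
      ∀ a x : Fin I.n, F.Adj a x → s.arr aD a ≠ 0 → DLe (t.arr aD x) (s.arr aD a + w x) := by
  have := loopTo_induction (s := s) (r := 22) (b := 1) (p := .loopTo 23 1 (relax cond aD aP))
    (I := fun k t => Sound I w F src aD aP t ∧ (∀ z : Fin I.n, DLe (t.arr aD z) (s.arr aD z)) ∧
      ∀ a : Fin I.n, a < k → ∀ x : Fin I.n, F.Adj a x → s.arr aD a ≠ 0 →
        DLe (t.arr aD x) (s.arr aD a + w x))
    (fun _ _ _ h => h) ⟨hsound, fun z => .refl _, fun x hx => absurd hx (by omega)⟩ ?_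
  · rw [hs.reg_n] at this
    exact ⟨this.1, this.2.1, fun a => this.2.2 a a.2⟩
  · intro k hk t hag hk' ⟨h1, h2, h3⟩
    rw [hs.reg_n] at hk
    have hag' : Agree [21, 22, 23, 24] [aD, aP] s t :=
      hag.mono (by simp [regs, relax]) (by simp [arrs, relax])
    obtain ⟨g1, g2, g3⟩ := relax_row_spec (hs.of_agree_bf hP hD hag') hDP hP hD (a := ⟨k, hk⟩)
      (fun u hu => hcond u (hag'.trans hu)) hk' h1
    refine ⟨g1, fun z => (g2 z).trans (h2 z), fun a ha x hadj ha0 => ?_⟩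
    rcases Nat.lt_or_ge a k with hak | hak
    · exact (g2 x).trans (h3 a hak x hadj ha0)
    · obtain rfl : a = ⟨k, hk⟩ := Fin.ext (by simp; omega)
      obtain ⟨h4, h5⟩ := h2 _ ha0
      exact (g3 x hadj h4).trans fun _ => ⟨by omega, by omega⟩

theorem clear_spec {s : State} (hs : Ctx I w B s) (a : ℕ) :
    ∀ z < I.n, ((Cmd.loopTo 22 1 (.store a (.reg 22) (.lit 0))).run s).arr a z = 0 := by
  have := loopTo_induction (s := s) (r := 22) (b := 1) (p := .store a (.reg 22) (.lit 0))
    (I := fun k t => ∀ z < k, t.arr a z = 0) (fun _ _ _ h => h) (by simp) ?_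
  · rw [hs.reg_n] at this
    exact this
  · intro k hk t hag hk' h z hz
    simp only [run_store, Expr.eval, hk', setArr_arr, true_and]
    split_ifs
    · rfl
    · exact h z (by omega)

theorem clear_row_spec {s : State} (hs : Ctx I w B s) (haP : aP ≠ 1) (h20 : s.reg 20 = src) :
    ∀ z < I.n, ((Cmd.loopTo 24 1 (.store aP (.add (.get 1 (.reg 20)) (.reg 24)) (.lit 0))).run
      s).arr aP (src * I.n + z) = 0 := by
  have := loopTo_induction (s := s) (r := 24) (b := 1)
    (p := .store aP (.add (.get 1 (.reg 20)) (.reg 24)) (.lit 0))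
    (I := fun k t => ∀ z < k, t.arr aP (src * I.n + z) = 0) (fun _ _ _ h => h) (by simp) ?_
  · rw [hs.reg_n] at this
    exact this
  · intro k hk t hag hk' h z hz
    have e20 : t.reg 20 = src := by rw [hag.1 20 (by simp [regs]), h20]
    have e1 : t.arr 1 = s.arr 1 := hag.2 1 (by simp [arrs, haP.symm])
    simp only [run_store, Expr.eval, hk', setArr_arr, true_and, e20, e1, hs.off _ src.2]
    split_ifs
    · rfl
    · exact h z (by omega)

/-- After k rounds all walks with at most k edges are accounted for. Simple paths have fewer than n
edges, so n rounds are enough. -/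
theorem bellmanFord_sound_steps {s : State} (hs : Ctx I w B s) (hDP : aD ≠ aP)
    (hP : aP ∉ [0, 1, 2]) (hD : aD ∉ [0, 1, 2]) (h20 : s.reg 20 = src)
    (hcond : Decides I F cond aD aP s) :
    let t := (bellmanFord cond aD aP).run s
    Sound I w F src aD aP t ∧
      ∀ k ≤ I.n, ∀ x c, Steps F w src k x c → DLe (t.arr aD x) (c + 1) := by
  intro t
  have hP1 : aP ≠ 1 := by simp at hP; omega
  set s₁ := (Cmd.loopTo 22 1 (.store aD (.reg 22) (.lit 0))).run s with hs₁
  have ag₁ : Agree [21, 22, 23, 24] [aD, aP] s s₁ :=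
    (agree_run _ _).mono (by simp [regs]) (by simp [arrs])
  have c₁ := hs.of_agree_bf hP hD ag₁
  have hz₁ := clear_spec hs aD
  rw [← hs₁] at hz₁
  have e20 : s₁.reg 20 = src := by rw [ag₁.1 20 (by simp), h20]
  set s₂ := s₁.setArr aD src 1 with hs₂
  have ag₂ : Agree [21, 22, 23, 24] [aD, aP] s s₂ :=
    ag₁.trans (agree_setArr (by simp) _ _ _)
  have c₂ := hs.of_agree_bf hP hD ag₂
  set s₃ := (Cmd.loopTo 24 1 (.store aP (.add (.get 1 (.reg 20)) (.reg 24)) (.lit 0))).run s₂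
    with hs₃
  have hz₃ := clear_row_spec c₂ hP1 (src := src) e20
  rw [← hs₃] at hz₃
  have ag₂₃ := agree_run (Cmd.loopTo 24 1 (.store aP (.add (.get 1 (.reg 20)) (.reg 24)) (.lit 0)))
    s₂
  rw [← hs₃] at ag₂₃
  have ag₃ : Agree [21, 22, 23, 24] [aD, aP] s s₃ :=
    ag₂.trans (ag₂₃.mono (by simp [regs]) (by simp [arrs]))
  have c₃ := hs.of_agree_bf hP hD ag₃
  have e20₃ : s₃.reg 20 = src := by rw [ag₃.1 20 (by simp), h20]
  set s₄ := s₃.setArr aP (src * I.n + src) 1 with hs₄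
  have ag₄ : Agree [21, 22, 23, 24] [aD, aP] s s₄ :=
    ag₃.trans (agree_setArr (by simp) _ _ _)
  have c₄ := hs.of_agree_bf hP hD ag₄
  have ht : t = (Cmd.loopTo 21 1 (.loopTo 22 1 (.loopTo 23 1 (relax cond aD aP)))).run s₄ := by
    simp only [t, bellmanFord, run_seq, run_store, Expr.eval, ← hs₁, e20, ← hs₂, ← hs₃, e20₃,
      c₃.off _ src.2, ← hs₄]
  have eD : ∀ z : Fin I.n, s₄.arr aD z = if z = src then 1 else 0 := by
    intro z
    rw [hs₄, setArr_arr_of_ne _ hDP, ag₂₃.2 aD (by simp [arrs, hDP]), hs₂]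
    simp only [setArr_arr, true_and, Fin.ext_iff, hz₁ z z.2]
  have hrow : rowMask I.n s₄ aP src = {src} := by
    ext z
    rw [mem_rowMask, mem_singleton, hs₄]
    simp only [setArr_arr, true_and, hz₃ z z.2, Fin.ext_iff]
    split_ifs with h
    · simp; omega
    · simp; omega
  have hsound : Sound I w F src aD aP s₄ := by
    intro x hx
    rw [eD] at hx
    obtain rfl : x = src := by by_contra h; simp [h] at hx
    rw [hrow, eD]
    simp
  have := loopTo_induction (s := s₄) (r := 21) (b := 1)
    (p := .loopTo 22 1 (.loopTo 23 1 (relax cond aD aP)))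
    (I := fun k t => Sound I w F src aD aP t ∧
      ∀ j ≤ k, ∀ x c, Steps F w src j x c → DLe (t.arr aD x) (c + 1))
    (fun _ _ _ h => h) ⟨hsound, ?_⟩ ?_
  · rw [← ht, c₄.reg_n] at this
    exact this
  · intro j hj x c hst
    obtain rfl : j = 0 := by omega
    cases hst
    rw [eD, if_pos rfl]
    exact .refl _
  · intro k hk t hag hk' ⟨h1, h2⟩
    have hag' : Agree [21, 22, 23, 24] [aD, aP] s t :=
      ag₄.trans (hag.mono (by simp [regs, relax]) (by simp [arrs, relax]))
    obtain ⟨g1, g2, g3⟩ := relax_round_spec (hs.of_agree_bf hP hD hag') hDP hP hD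
      (fun u hu => hcond u (hag'.trans hu)) h1
    refine ⟨g1, fun j hj x c hst => ?_⟩
    rcases Nat.lt_or_ge k j with hkj | hkj
    · obtain rfl : j = k + 1 := by omega
      cases hst with
      | @succ _ a _ c hst hadj =>
        obtain ⟨h4, h5⟩ := h2 k le_rfl a c hst (by omega)
        exact (g3 a x hadj h4).trans fun _ => ⟨by omega, by omega⟩
    · exact (g2 x).trans (h2 j hkj x c hst)

theorem steps_of_walk {V : Type*} {F : SimpleGraph V} {w : V → ℕ} {src a x : V} {k c : ℕ}
    (h : Steps F w src k a c) (p : F.Walk a x) :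
    Steps F w src (k + p.length) x (c + (p.support.tail.map w).sum) := by
  induction p generalizing k c with
  | nil => simpa using h
  | @cons a b x hab p ih =>
    have := ih (h.succ hab)
    rw [Walk.length_cons, Walk.support_cons, List.tail_cons]
    rw [show k + (p.length + 1) = k + 1 + p.length by omega]
    have e : (p.support.map w).sum = w b + (p.support.tail.map w).sum := by
      rw [← List.sum_cons, ← List.map_cons, Walk.cons_tail_support]
    rw [e, ← add_assoc]
    exact this

/-- A simple walk from `src` inside `P` gives at most the weight of `P`. -/
theorem exists_steps {P : Finset (Fin I.n)} {x : Fin I.n} (hP : F.ConnectedOn P) (hsrc : src ∈ P)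
    (hx : x ∈ P) : ∃ k ≤ I.n, ∃ c, Steps F w src k x c ∧ w src + c ≤ ∑ z ∈ P, w z := by
  obtain ⟨p, hp⟩ := (hP src hsrc x hx).exists_isPath
  have hsupp : ∀ z ∈ p.support, z ∈ P := by
    have key : ∀ (a b : Fin I.n) (p : (F.within P).Walk a b), a ∈ P → ∀ z ∈ p.support, z ∈ P := by
      intro a b p ha z hz
      induction p with
      | nil => simp at hz; exact hz ▸ ha
      | cons h p ih =>
        rw [Walk.support_cons, List.mem_cons] at hz
        rcases hz with rfl | hz
        · exact ha
        · exact ih h.2.2 hz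
    exact key _ _ p hsrc
  have hlen := hp.length_lt
  rw [Fintype.card_fin] at hlen
  set q := p.mapLe (within_le F P) with hq
  have h1 := steps_of_walk (w := w) Steps.zero q
  have hqs : q.support = p.support := by simp [hq]
  have hql : q.length = p.length := by simp [hq]
  rw [hqs, hql, zero_add, zero_add] at h1
  refine ⟨_, hlen.le, _, h1, ?_⟩
  have h2 : w src + (p.support.tail.map w).sum = (p.support.map w).sum := by
    rw [← List.sum_cons, ← List.map_cons, Walk.cons_tail_support]
  rw [h2, ← List.sum_toFinset w hp.support_nodup]
  exact sum_le_sum_of_subset fun z hz => hsupp z (List.mem_toFinset.1 hz)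

theorem connectedOn_univ_comp (F : SimpleGraph (Fin I.n)) {x : Fin I.n} (h : F.Reachable src x) :
    ∃ P, F.ConnectedOn P ∧ src ∈ P ∧ x ∈ P := by
  have hle : F ≤ F.within univ := fun a b hab => ⟨hab, mem_univ _, mem_univ _⟩
  exact ⟨_, connectedOn_compOn F univ src, mem_compOn.2 ⟨mem_univ _, .rfl⟩,
    mem_compOn.2 ⟨mem_univ _, h.mono hle⟩⟩

/-- Correctness of the shortest path computation. -/
theorem bellmanFord_spec {s : State} (hs : Ctx I w B s) (hDP : aD ≠ aP)
    (hP : aP ∉ [0, 1, 2]) (hD : aD ∉ [0, 1, 2]) (h20 : s.reg 20 = src)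
    (hcond : Decides I F cond aD aP s) (y : Fin I.n) :
    let t := (bellmanFord cond aD aP).run s
    (t.arr aD y ≠ 0 ↔ F.Reachable src y) ∧ (t.arr aD y ≠ 0 →
      F.ConnectedOn (rowMask I.n t aP y) ∧ src ∈ rowMask I.n t aP y ∧ y ∈ rowMask I.n t aP y ∧
      ∑ z ∈ rowMask I.n t aP y, w z ≤ w src + (t.arr aD y - 1) ∧
      t.arr aD y - 1 = F.nodeDist w src y) := by
  intro t
  obtain ⟨hsound, hsteps⟩ := bellmanFord_sound_steps hs hDP hP hD h20 hcond
  refine ⟨⟨fun h => ?_, fun h => ?_⟩, fun h => ?_⟩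
  · obtain ⟨h1, h2, -, -⟩ := hsound y h
    exact (h2 y h1).mono (within_le _ _)
  · obtain ⟨P, hPc, hsP, hyP⟩ := connectedOn_univ_comp F h
    obtain ⟨k, hk, c, hst, -⟩ := exists_steps (w := w) hPc hsP hyP
    exact (hsteps k hk y c hst (by omega)).1
  · obtain ⟨h1, h2, h3, h4⟩ := hsound y h
    have hconn : F.ConnectedOn (rowMask I.n t aP y) := .of_root src h2
    have hle : ∑ z ∈ rowMask I.n t aP y, w z ≤ w src + (t.arr aD y - 1) := by
      have : ∑ z ∈ rowMask I.n t aP y, w z + 1 ≤ w src + t.arr aD y := h4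
      omega
    -- The stored row attains the value, and a simple path inside any competing connected set bounds
    -- it from above.
    refine ⟨hconn, h3, h1, hle, nodeDist_eq hconn h3 h1 hle fun Q hQ hsQ hyQ => ?_⟩
    obtain ⟨k, hk, c, hst, hc⟩ := exists_steps (w := w) hQ hsQ hyQ
    have : t.arr aD y ≤ c + 1 := (hsteps k hk y c hst (by omega)).2
    omega

end BellmanFord

end RAM

/-! ### Multiplication, connectivity after an edge deletion, counting covered edges -/

namespace RAM

namespace Cmd

/-- Multiply the registers `10` and `11` into register `12`, bit by bit. -/
def mul : Cmd :=
  .seq (.assign 12 (.lit 0)) (.loopTo 13 2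
    (.seq (.ite (.sub (.reg 11) (.add (.half (.reg 11)) (.half (.reg 11))))
        (.assign 12 (.add (.reg 12) (.reg 10))) .skip)
      (.seq (.assign 10 (.add (.reg 10) (.reg 10))) (.assign 11 (.half (.reg 11))))))

/-- Adjacency of the vertices in the registers `22` and `23`, inside the set stored in the array `q`
and without the edge between the vertices in the registers `30` and `31`. -/
def reachCond (q : ℕ) : Expr :=
  .and (.entry 0 (.lit 1) (.reg 22) (.reg 23)) (.and (.get q (.reg 22)) (.and (.get q (.reg 23))
    (.not (.or (.and (.eq (.reg 22) (.reg 30)) (.eq (.reg 23) (.reg 31)))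
      (.and (.eq (.reg 22) (.reg 31)) (.eq (.reg 23) (.reg 30)))))))

/-- The vertices reachable from the vertex in register `20` after the deletion of an edge. -/
def reach (q : ℕ) : Cmd := bellmanFord (reachCond q) 6 7

/-- Count the covered tree edges in register `32`. -/
def covCmd (q : ℕ) : Cmd :=
  .seq (.assign 32 (.lit 0)) (.loopTo 30 1 (.loopTo 31 1
    (.ite (.entry 0 (.add (.lit 1) (.reg 3)) (.reg 30) (.reg 31))
      (.seq (.assign 20 (.reg 30)) (.seq (reach q)
        (.ite (.get 6 (.reg 31)) (.assign 32 (.add (.reg 32) (.lit 1))) .skip))) .skip)))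

end Cmd

open State Cmd SimpleGraph

/-- The quantity reg 12 + reg 10 * reg 11 is invariant while reg 11 is halved until it vanishes.
Only the second factor must have at most B bits. -/
theorem mul_spec {s : State} (h : s.reg 11 < 2 ^ s.reg 2) :
    (mul.run s).reg 12 = s.reg 10 * s.reg 11 := by
  set s₁ := s.setReg 12 0 with hs₁
  have h2 : s₁.reg 2 = s.reg 2 := by simp [hs₁]
  have := loopTo_induction (s := s₁) (r := 13) (b := 2)
    (p := .seq (.ite (.sub (.reg 11) (.add (.half (.reg 11)) (.half (.reg 11))))
        (.assign 12 (.add (.reg 12) (.reg 10))) .skip)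
      (.seq (.assign 10 (.add (.reg 10) (.reg 10))) (.assign 11 (.half (.reg 11)))))
    (I := fun k t => t.reg 12 + t.reg 10 * t.reg 11 = s.reg 10 * s.reg 11 ∧
      t.reg 11 = s.reg 11 / 2 ^ k)
    (fun k t v h => by simpa using h) (by simp [hs₁]) ?_
  · rw [h2, Nat.div_eq_of_lt h] at this
    rw [mul, run_seq, run_assign, Expr.eval, ← hs₁]
    obtain ⟨h3, h4⟩ := this
    rw [h4, mul_zero, add_zero] at h3
    exact h3
  · intro k _ t _ _ ⟨h3, h4⟩
    have h5 : t.reg 11 / 2 = s.reg 11 / 2 ^ (k + 1) := by rw [h4, Nat.div_div_eq_div_mul, pow_succ]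
    rw [run_seq, run_seq, run_assign, run_assign]
    by_cases hodd : Expr.eval t (.sub (.reg 11) (.add (.half (.reg 11)) (.half (.reg 11)))) ≠ 0
    · rw [run_ite_pos hodd, run_assign]
      simp only [Expr.eval] at hodd
      simp only [Expr.eval, setReg_reg]
      norm_num
      refine ⟨?_, h5⟩
      rw [← h3]
      have : t.reg 11 = 2 * (t.reg 11 / 2) + 1 := by omega
      conv_rhs => rw [this]
      ring
    · rw [run_ite_neg hodd, run_skip]
      simp only [Expr.eval] at hodd
      simp only [Expr.eval, setReg_reg]
      norm_num
      refine ⟨?_, h5⟩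
      rw [← h3]
      have : t.reg 11 = 2 * (t.reg 11 / 2) := by omega
      conv_rhs => rw [this]
      ring

theorem mul_agree (s : State) : Agree [10, 11, 12, 13] [] s (mul.run s) :=
  (agree_run _ _).mono (by decide) (by decide)

variable {I : NWSTAP} {w : Fin I.n → ℕ} {B : ℕ}

theorem reach_agree (q : ℕ) (s : State) :
    Agree [21, 22, 23, 24] [6, 7] s ((reach q).run s) :=
  (agree_run _ _).mono (by simp [reach, bellmanFord, relax, regs])
    (by simp [reach, bellmanFord, relax, arrs])

/-- The shortest path routine serves as a graph search: only whether the stored distance is nonzero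
matters. -/
theorem reach_spec {s : State} (hs : Ctx I w B s) {q : ℕ} (hq : q ∉ [6, 7]) {src a b : Fin I.n}
    (h20 : s.reg 20 = src) (h30 : s.reg 30 = a) (h31 : s.reg 31 = b) (y : Fin I.n) :
    ((reach q).run s).arr 6 y ≠ 0 ↔
      ((I.G.deleteEdges {s(a, b)}).within (mask I.n s q)).Reachable src y := by
  refine (bellmanFord_spec hs (by decide) (by decide) (by decide) h20 ?_ y).1
  intro t hag u x hu hx
  have hctx := hs.of_agree_bf (aD := 6) (aP := 7) (by decide) (by decide) hag
  have e30 : t.reg 30 = a := by rw [hag.1 30 (by simp), h30]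
  have e31 : t.reg 31 = b := by rw [hag.1 31 (by simp), h31]
  have eq : t.arr q = s.arr q := hag.2 q hq
  rw [reachCond]
  simp only [Expr.eval_and, Expr.eval_not, Expr.eval_or, Expr.eval_eq]
  simp only [Expr.entry, Expr.eval, hu, hx, e30, e31, eq, hctx.off _ u.2, hctx.adj,
    ← mem_mask (n := I.n), ← Fin.ext_iff]
  simp only [within, deleteEdges_adj, Set.mem_singleton_iff, Sym2.eq_iff]
  tauto

theorem Ctx.of_agree_cov {s t : State} (hs : Ctx I w B s)
    (h : Agree [20, 21, 22, 23, 24, 30, 31, 32] [6, 7] s t) : Ctx I w B t :=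
  hs.agree h (by decide) (by decide) (by decide) (by decide) (by decide) (by decide)

theorem cov_agree (q : ℕ) (s : State) :
    Agree [20, 21, 22, 23, 24, 30, 31, 32] [6, 7] s ((covCmd q).run s) :=
  (agree_run _ _).mono (by simp [covCmd, reach, bellmanFord, relax, regs])
    (by simp [covCmd, reach, bellmanFord, relax, arrs])

theorem mask_congr {n : ℕ} {s t : State} {q : ℕ} (h : t.arr q = s.arr q) :
    mask n t q = mask n s q := by
  simp [mask, h]

theorem rowMask_congr {n : ℕ} {s t : State} {q : ℕ} (h : t.arr q = s.arr q) (y : ℕ) :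
    rowMask n t q y = rowMask n s q y := by
  simp [rowMask, h]

open Classical in
/-- The indicator of the covered tree edges. -/
noncomputable def covInd (I : NWSTAP) (M : Finset (Fin I.n)) (a b : ℕ) : ℕ :=
  if h : a < I.n ∧ b < I.n then
    if I.T.Adj ⟨a, h.1⟩ ⟨b, h.2⟩ ∧ I.Covers M ⟨a, h.1⟩ ⟨b, h.2⟩ then 1 else 0
  else 0

theorem cov_eq_sum (M : Finset (Fin I.n)) :
    I.cov M = ∑ a ∈ range I.n, ∑ b ∈ range I.n, covInd I M a b := by
  classical
  rw [NWSTAP.cov, card_filter, Fintype.sum_prod_type, ← Fin.sum_univ_eq_sum_range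
    (fun a => ∑ b ∈ range I.n, covInd I M a b)]
  refine sum_congr rfl fun a _ => ?_
  rw [← Fin.sum_univ_eq_sum_range (fun b => covInd I M a b)]
  refine sum_congr rfl fun b _ => ?_
  simp [covInd]

theorem cov_pair_spec {s : State} (hs : Ctx I w B s) {q : ℕ} (hq : q ∉ [6, 7]) {a b : Fin I.n}
    (h30 : s.reg 30 = a) (h31 : s.reg 31 = b) :
    ((Cmd.ite (.entry 0 (.add (.lit 1) (.reg 3)) (.reg 30) (.reg 31))
      (.seq (.assign 20 (.reg 30)) (.seq (reach q)
        (.ite (.get 6 (.reg 31)) (.assign 32 (.add (.reg 32) (.lit 1))) .skip))) .skip).run s).reg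
          32 = s.reg 32 + covInd I (mask I.n s q) a b := by
  have hT : Expr.eval s (.entry 0 (.add (.lit 1) (.reg 3)) (.reg 30) (.reg 31)) ≠ 0 ↔
      I.T.Adj a b := by
    simp only [Expr.entry, Expr.eval, h30, h31, hs.reg_sq, hs.off _ a.2, hs.tree]
  by_cases hc : Expr.eval s (.entry 0 (.add (.lit 1) (.reg 3)) (.reg 30) (.reg 31)) ≠ 0
  · rw [run_ite_pos hc, run_seq, run_seq, run_assign, Expr.eval, h30]
    set s₁ := s.setReg 20 a with hs₁
    have ag₁ : Agree [20, 21, 22, 23, 24, 30, 31, 32] [6, 7] s s₁ := agree_setReg (by simp) _ _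
    have hr := reach_spec (hs.of_agree_cov ag₁) hq (src := a) (a := a) (b := b) (by simp [hs₁])
      (by simp [hs₁, h30]) (by simp [hs₁, h31]) b
    rw [mask_congr (show s₁.arr q = s.arr q from rfl)] at hr
    set s₂ := (reach q).run s₁ with hs₂
    have ag₂ : Agree [21, 22, 23, 24] [6, 7] s₁ s₂ := reach_agree _ _
    have e31 : s₂.reg 31 = b := by rw [ag₂.1 31 (by simp)]; simp [hs₁, h31]
    have e32 : s₂.reg 32 = s.reg 32 := by rw [ag₂.1 32 (by simp)]; simp [hs₁]
    have hadj := hT.1 hc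
    by_cases h6 : Expr.eval s₂ (.get 6 (.reg 31)) ≠ 0
    · rw [run_ite_pos h6, run_assign]
      simp only [Expr.eval, e31] at h6
      have : I.Covers (mask I.n s q) a b := hr.1 h6
      simp [Expr.eval, e32, covInd, hadj, this]
    · rw [run_ite_neg h6, run_skip]
      simp only [Expr.eval, e31] at h6
      have : ¬ I.Covers (mask I.n s q) a b := fun h => h6 (hr.2 h)
      simp [e32, covInd, this]
  · rw [run_ite_neg hc, run_skip]
    have hadj : ¬ I.T.Adj a b := fun h => hc (hT.2 h)
    simp [covInd, hadj]

theorem cov_row_spec {s : State} (hs : Ctx I w B s) {q : ℕ} (hq : q ∉ [6, 7]) {a : Fin I.n}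
    (h30 : s.reg 30 = a) :
    ((Cmd.loopTo 31 1 (.ite (.entry 0 (.add (.lit 1) (.reg 3)) (.reg 30) (.reg 31))
      (.seq (.assign 20 (.reg 30)) (.seq (reach q)
        (.ite (.get 6 (.reg 31)) (.assign 32 (.add (.reg 32) (.lit 1))) .skip))) .skip)).run s).reg
          32 = s.reg 32 + ∑ b ∈ range I.n, covInd I (mask I.n s q) a b := by
  have := loopTo_induction (s := s) (r := 31) (b := 1)
    (p := .ite (.entry 0 (.add (.lit 1) (.reg 3)) (.reg 30) (.reg 31))
      (.seq (.assign 20 (.reg 30)) (.seq (reach q)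
        (.ite (.get 6 (.reg 31)) (.assign 32 (.add (.reg 32) (.lit 1))) .skip))) .skip)
    (I := fun k t => t.reg 32 = s.reg 32 + ∑ b ∈ range k, covInd I (mask I.n s q) a b)
    (fun k t v h => by simpa using h) (by simp) ?_
  · rw [hs.reg_n] at this
    exact this
  · intro k hk t hag hk' h
    rw [hs.reg_n] at hk
    have hag' : Agree [20, 21, 22, 23, 24, 30, 31, 32] [6, 7] s t := hag.mono
      (by simp [reach, bellmanFord, relax, regs]) (by simp [reach, bellmanFord, relax, arrs])
    have hctx : Ctx I w B t := hs.of_agree_cov hag'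
    have e30 : t.reg 30 = a := by
      rw [hag.1 30 (by simp [reach, bellmanFord, relax, regs]), h30]
    have eq : t.arr q = s.arr q := hag'.2 q hq
    rw [cov_pair_spec hctx hq e30 (b := ⟨k, hk⟩) hk', h, sum_range_succ, mask_congr eq, add_assoc]

theorem cov_spec {s : State} (hs : Ctx I w B s) {q : ℕ} (hq : q ∉ [6, 7]) :
    ((covCmd q).run s).reg 32 = I.cov (mask I.n s q) := by
  rw [covCmd, run_seq, run_assign, Expr.eval]
  set s₁ := s.setReg 32 0 with hs₁
  have hs' : Ctx I w B s₁ := hs.of_agree_cov (agree_setReg (by simp) _ _)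
  have := loopTo_induction (s := s₁) (r := 30) (b := 1)
    (p := .loopTo 31 1 (.ite (.entry 0 (.add (.lit 1) (.reg 3)) (.reg 30) (.reg 31))
      (.seq (.assign 20 (.reg 30)) (.seq (reach q)
        (.ite (.get 6 (.reg 31)) (.assign 32 (.add (.reg 32) (.lit 1))) .skip))) .skip))
    (I := fun k t => t.reg 32 =
      ∑ a ∈ range k, ∑ b ∈ range I.n, covInd I (mask I.n s₁ q) a b)
    (fun k t v h => by simpa using h) (by simp [hs₁]) ?_
  · rw [hs'.reg_n, ← cov_eq_sum] at this
    exact this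
  · intro k hk t hag hk' h
    rw [hs'.reg_n] at hk
    have hag' : Agree [20, 21, 22, 23, 24, 30, 31, 32] [6, 7] s₁ t := hag.mono
      (by simp [reach, bellmanFord, relax, regs]) (by simp [reach, bellmanFord, relax, arrs])
    have hctx : Ctx I w B t := hs'.of_agree_cov hag'
    have eq : t.arr q = s₁.arr q := hag'.2 q hq
    rw [cov_row_spec hctx hq (a := ⟨k, hk⟩) hk', h, sum_range_succ, mask_congr eq]

end RAM

/-! ### The greedy construction of spiders and its invariants -/

namespace NWSTAP

open SimpleGraph

variable {I : NWSTAP} {w : Fin I.n → ℕ} {lam : ℕ} {M M' Q P : Finset (Fin I.n)} {v r : Fin I.n}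
  {k qc : ℕ}

/-- The state of the construction of a spider with center `v` and first foot `r` on top of `M`,
after the feet below `k` have been tried: `Q` is the current set and `qc` its additional cost. -/
structure SpiderInv (I : NWSTAP) (w : Fin I.n → ℕ) (lam : ℕ) (v r : Fin I.n)
    (M : Finset (Fin I.n)) (k : ℕ) (Q : Finset (Fin I.n)) (qc : ℕ) : Prop where
  subset : M ⊆ Q
  mem : v ∈ Q
  conn : (I.links.within Q).Reachable v r
  weight_le : ∑ x ∈ Q, w x ≤ ∑ x ∈ M, w x + qc
  cost_le : qc ≤ w v + I.links.nodeDist w v r + lam * (I.cov Q - I.cov M)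
  unc_le : ∀ y ∈ I.R, y.1 < k → I.links.Reachable v y →
    lam * I.unc Q {r, y} ≤ I.links.nodeDist w v y

/-- The center is already in Q, so a new leg does not pay for it again. -/
theorem weight_union_le (hv : v ∈ Q) (hvP : v ∈ P) {k : ℕ} (hP : ∑ x ∈ P, w x ≤ w v + k) :
    ∑ x ∈ Q ∪ P, w x ≤ ∑ x ∈ Q, w x + k := by
  have h1 : ∑ x ∈ Q ∪ P, w x = ∑ x ∈ Q, w x + ∑ x ∈ P \ Q, w x := by
    rw [← union_sdiff_self_eq_union, sum_union disjoint_sdiff]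
  have h2 : ∑ x ∈ P \ Q, w x ≤ ∑ x ∈ P.erase v, w x :=
    sum_le_sum_of_subset fun x hx =>
      mem_erase.2 ⟨fun e => (mem_sdiff.1 hx).2 (e ▸ hv), (mem_sdiff.1 hx).1⟩
  have h3 := add_sum_erase P w hvP
  omega

theorem SpiderInv.init (hP : I.links.ConnectedOn P) (hv : v ∈ P) (hr : r ∈ P)
    (hPw : ∑ x ∈ P, w x ≤ w v + I.links.nodeDist w v r) :
    I.SpiderInv w lam v r M 0 (M ∪ P) (w v + I.links.nodeDist w v r) where
  subset := subset_union_left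
  mem := mem_union_right _ hv
  conn := (hP v hv r hr).mono (within_mono le_rfl subset_union_right)
  weight_le := by
    have h1 : ∑ x ∈ M ∪ P, w x ≤ ∑ x ∈ M, w x + ∑ x ∈ P, w x := by
      rw [← sum_union_inter]; omega
    omega
  cost_le := by omega
  unc_le := fun _ _ h => absurd h (by omega)

theorem SpiderInv.skip {y : Fin I.n} (h : I.SpiderInv w lam v r M y.1 Q qc)
    (hy : ¬ (I.links.Reachable v y ∧ y ∈ I.R)) : I.SpiderInv w lam v r M (y.1 + 1) Q qc where
  __ := h
  unc_le := fun z hz hzk hzr => by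
    have hne : z ≠ y := fun e => hy ⟨e ▸ hzr, e ▸ hz⟩
    have := Fin.val_ne_of_ne hne
    exact h.unc_le z hz (by omega) hzr

/-- Through v the foot y is now linked to r, so {r, y} crosses no uncovered edge any more; the
bounds for earlier feet survive because `unc` decreases as the set grows. -/
theorem SpiderInv.accept {y : Fin I.n} (h : I.SpiderInv w lam v r M y.1 Q qc) (hM : I.R ⊆ M)
    (hr : r ∈ I.R) (hP : I.links.ConnectedOn P) (hv : v ∈ P) (hy : y ∈ P)
    (hPw : ∑ x ∈ P, w x ≤ w v + I.links.nodeDist w v y)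
    (hacc : I.links.nodeDist w v y ≤ lam * (I.cov (Q ∪ P) - I.cov Q)) :
    I.SpiderInv w lam v r M (y.1 + 1) (Q ∪ P) (qc + I.links.nodeDist w v y) where
  subset := h.subset.trans subset_union_left
  mem := mem_union_left _ h.mem
  conn := h.conn.mono (within_mono le_rfl subset_union_left)
  weight_le := by
    have h1 := weight_union_le h.mem hv hPw
    have h2 := h.weight_le
    omega
  cost_le := by
    have h1 := cov_mono h.subset
    have h2 := cov_mono (I := I) (M := Q) (M' := Q ∪ P) subset_union_left
    have h3 := h.cost_le
    have h4 : I.cov (Q ∪ P) - I.cov M = (I.cov Q - I.cov M) + (I.cov (Q ∪ P) - I.cov Q) := by omega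
    rw [h4, mul_add]
    omega
  unc_le := fun z hz hzk hzr => by
    by_cases hzy : z = y
    · subst hzy
      have hrz : (I.links.within (Q ∪ P)).Reachable r z :=
        (h.conn.mono (within_mono le_rfl subset_union_left)).symm.trans
          ((hP v hv z hy).mono (within_mono le_rfl subset_union_right))
      rw [unc_pair_eq_zero (hM.trans (h.subset.trans subset_union_left)) hr hz hrz]
      omega
    · have := Fin.val_ne_of_ne hzy
      exact (Nat.mul_le_mul_left _ (unc_anti subset_union_left _)).trans
        (h.unc_le z hz (by omega) hzr)

/-- Adding the leg would link y to r and cover every uncovered edge crossed by {r, y}. As the leg is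
too expensive, λ times their number is less than its length. -/
theorem SpiderInv.reject {y : Fin I.n} (h : I.SpiderInv w lam v r M y.1 Q qc) (hM : I.R ⊆ M)
    (hr : r ∈ I.R) (hP : I.links.ConnectedOn P) (hv : v ∈ P) (hy : y ∈ P)
    (hrej : ¬ I.links.nodeDist w v y ≤ lam * (I.cov (Q ∪ P) - I.cov Q)) :
    I.SpiderInv w lam v r M (y.1 + 1) Q qc where
  __ := h
  unc_le := fun z hz hzk hzr => by
    by_cases hzy : z = y
    · subst hzy
      have hrz : (I.links.within (Q ∪ P)).Reachable r z :=
        (h.conn.mono (within_mono le_rfl subset_union_left)).symm.trans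
          ((hP v hv z hy).mono (within_mono le_rfl subset_union_right))
      have h1 := unc_pair_le subset_union_left (hM.trans h.subset) hr hz hrz
      have h2 := Nat.mul_le_mul_left lam h1
      omega
    · have := Fin.val_ne_of_ne hzy
      exact h.unc_le z hz (by omega) hzr

/-- The set grows, and pays at most `2 * lam` for every newly covered edge. -/
def Grows (I : NWSTAP) (w : Fin I.n → ℕ) (lam : ℕ) (M M' : Finset (Fin I.n)) : Prop :=
  M ⊆ M' ∧ ∑ x ∈ M', w x ≤ ∑ x ∈ M, w x + 2 * lam * (I.cov M' - I.cov M)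

theorem Grows.refl (M : Finset (Fin I.n)) : I.Grows w lam M M := ⟨subset_rfl, by omega⟩

theorem Grows.trans {M'' : Finset (Fin I.n)} (h : I.Grows w lam M M') (h' : I.Grows w lam M' M'') :
    I.Grows w lam M M'' := by
  refine ⟨h.1.trans h'.1, ?_⟩
  have h1 := cov_mono h.1
  have h2 := cov_mono h'.1
  have h3 : I.cov M'' - I.cov M = (I.cov M' - I.cov M) + (I.cov M'' - I.cov M') := by omega
  have h4 := h.2
  have h5 := h'.2
  rw [h3, mul_add]
  omega

/-- No spider with center `v` and a foot `r` covers the edges that are still uncovered at a cost of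
less than `lam` per edge. -/
def Saturated (I : NWSTAP) (w : Fin I.n → ℕ) (lam : ℕ) (v r : Fin I.n) (M : Finset (Fin I.n)) :
    Prop :=
  ∀ Y ⊆ I.R, r ∈ Y → (∀ y ∈ Y, I.links.Reachable v y) →
    lam * I.unc M Y ≤ w v + ∑ y ∈ Y, I.links.nodeDist w v y

/-- For this reason one pass over all pairs (v, r) suffices, although the set keeps growing during
the pass. -/
theorem Saturated.mono (h : I.Saturated w lam v r M) (hM : M ⊆ M') : I.Saturated w lam v r M' :=
  fun Y hY hr hreach => (Nat.mul_le_mul_left _ (unc_anti hM Y)).trans (h Y hY hr hreach)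

theorem SpiderInv.sum_le (h : I.SpiderInv w lam v r M I.n Q qc) {Y : Finset (Fin I.n)}
    (hY : Y ⊆ I.R) (hreach : ∀ y ∈ Y, I.links.Reachable v y) :
    lam * I.unc Q Y ≤ ∑ y ∈ Y.erase r, I.links.nodeDist w v y := by
  refine (Nat.mul_le_mul_left _ (unc_le_sum Q Y r)).trans ?_
  rw [mul_sum]
  exact sum_le_sum fun y hy => h.unc_le y (hY (mem_of_mem_erase hy)) y.2
    (hreach y (mem_of_mem_erase hy))

/-- Once Q is kept, the bounds for the individual feet already sum to saturation, without using the
center or the first leg. -/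
theorem SpiderInv.finish_accept (h : I.SpiderInv w lam v r M I.n Q qc)
    (hacc : qc ≤ 2 * lam * (I.cov Q - I.cov M)) :
    I.Grows w lam M Q ∧ I.Saturated w lam v r Q := by
  refine ⟨⟨h.subset, by have := h.weight_le; omega⟩, fun Y hY hr hreach => ?_⟩
  have h1 := h.sum_le hY hreach
  have h2 : ∑ y ∈ Y.erase r, I.links.nodeDist w v y ≤ ∑ y ∈ Y, I.links.nodeDist w v y :=
    sum_le_sum_of_subset (erase_subset _ _)
  omega

/-- Let Δ be the number of edges that Q would newly cover. Rejection means 2λΔ < qc, whereas qc ≤ w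
v + d(v, r) + λΔ; hence λΔ < w v + d(v, r). So the center and the first leg pay for the Δ edges
given up, and the other legs pay for the edges uncovered even by Q. -/
theorem SpiderInv.finish_reject (h : I.SpiderInv w lam v r M I.n Q qc)
    (hrej : ¬ qc ≤ 2 * lam * (I.cov Q - I.cov M)) :
    I.Grows w lam M M ∧ I.Saturated w lam v r M := by
  refine ⟨.refl M, fun Y hY hr hreach => ?_⟩
  have h1 := h.sum_le hY hreach
  have h2 := add_sum_erase Y (fun y => I.links.nodeDist w v y) hr
  have h3 := Nat.mul_le_mul_left lam (unc_le_add h.subset Y)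
  have h4 := h.cost_le
  rw [mul_add] at h3
  have h5 : 2 * lam * (I.cov Q - I.cov M) =
    lam * (I.cov Q - I.cov M) + lam * (I.cov Q - I.cov M) := by ring
  omega

theorem level_of_saturated (h : I.Grows w lam M M') (hs : ∀ v r, I.Saturated w lam v r M') :
    I.Level w lam M M' where
  subset := h.1
  cost_le := h.2
  spider_le := fun v Y hY ⟨r, hr⟩ hreach => hs v r Y hY hr hreach

/-- It guarantees that the second factors passed to `mul` have at most B bits. -/
theorem cov_le_sq (M : Finset (Fin I.n)) : I.cov M ≤ I.n * I.n := by
  have h1 := cov_add_uncovered M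
  have h2 := uncovered_le (I := I) ∅
  have h3 : I.R.card ≤ I.n := by simpa using card_le_univ I.R
  nlinarith

end NWSTAP

/-! ### The greedy rounds as a program -/

namespace RAM

namespace Cmd

/-- Copy the array `src` to the array `dst`. -/
def copyArr (dst src : ℕ) : Cmd := .loopTo 48 1 (.store dst (.reg 48) (.get src (.reg 48)))

/-- Store in the array `dst` the union of the array `src` and the path to the vertex in register
`y`. -/
def unionRow (dst src y : ℕ) : Cmd :=
  .loopTo 48 1 (.store dst (.reg 48)
    (.add (.get src (.reg 48)) (.entry 5 (.lit 0) (.reg y) (.reg 48))))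

/-- Test whether the vertex in register `y` is a terminal. -/
def terminal (y : ℕ) : Expr := .get 0 (.add (.add (.add (.lit 1) (.reg 3)) (.reg 3)) (.reg y))

/-- Adjacency of the vertices in the registers `22` and `23` in the graph without the tree. -/
def linkCond : Expr :=
  .and (.entry 0 (.lit 1) (.reg 22) (.reg 23))
    (.not (.entry 0 (.add (.lit 1) (.reg 3)) (.reg 22) (.reg 23)))

/-- Add the path to the vertex in register `44` to the spider in array `8`, if it pays off at the
threshold in register `40`. -/
def tryFoot : Cmd :=
  .ite (.and (.get 4 (.reg 44)) (terminal 44))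
    (.seq (unionRow 9 8 44) (.seq (covCmd 9) (.seq (.assign 10 (.reg 40))
      (.seq (.assign 11 (.sub (.reg 32) (.reg 46))) (.seq mul
        (.ite (.le (.sub (.get 4 (.reg 44)) (.lit 1)) (.reg 12))
          (.seq (copyArr 8 9) (.seq (.assign 46 (.reg 32))
            (.assign 47 (.add (.reg 47) (.sub (.get 4 (.reg 44)) (.lit 1))))))
          .skip))))))
    .skip

/-- Construct a spider whose center is in register `42` and whose first foot is in register `43`,
and add it to the current set in array `3` if it pays off. -/
def tryRoot : Cmd :=
  .ite (.and (.get 4 (.reg 43)) (terminal 43))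
    (.seq (covCmd 3) (.seq (.assign 45 (.reg 32)) (.seq (unionRow 8 3 43) (.seq (covCmd 8)
      (.seq (.assign 46 (.reg 32))
        (.seq (.assign 47 (.add (.get 2 (.reg 42)) (.sub (.get 4 (.reg 43)) (.lit 1))))
          (.seq (.loopTo 44 1 tryFoot) (.seq (.assign 10 (.add (.reg 40) (.reg 40)))
            (.seq (.assign 11 (.sub (.reg 46) (.reg 45))) (.seq mul
              (.ite (.le (.reg 47) (.reg 12)) (copyArr 3 8) .skip)))))))))))
    .skip

/-- Try all spiders with the center in register `42`. -/
def tryCenter : Cmd :=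
  .seq (.assign 20 (.reg 42)) (.seq (bellmanFord linkCond 4 5) (.loopTo 43 1 tryRoot))

/-- All rounds, with doubling thresholds. -/
def allRounds : Cmd :=
  .loopTo 41 2 (.seq (.loopTo 42 1 tryCenter) (.assign 40 (.add (.reg 40) (.reg 40))))

end Cmd

open State Cmd SimpleGraph

variable {I : NWSTAP} {w : Fin I.n → ℕ} {B lam : ℕ} {v r : Fin I.n} {M : Finset (Fin I.n)}

theorem copyArr_spec {s : State} (hs : Ctx I w B s) {dst src : ℕ} (h : src ≠ dst) :
    mask I.n ((copyArr dst src).run s) dst = mask I.n s src := by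
  have := loopTo_induction (s := s) (r := 48) (b := 1)
    (p := .store dst (.reg 48) (.get src (.reg 48)))
    (I := fun k t => ∀ z < k, t.arr dst z = s.arr src z) (fun _ _ _ h => h) (by simp) ?_
  · rw [hs.reg_n] at this
    ext x
    rw [mem_mask, mem_mask, copyArr, this x x.2]
  · intro k hk t hag hk' ih z hz
    have e : t.arr src = s.arr src := hag.2 src (by simp [arrs, h])
    simp only [run_store, Expr.eval, hk', setArr_arr, true_and, e]
    split_ifs with h'
    · rw [h']
    · exact ih z (by omega)

theorem unionRow_spec {s : State} (hs : Ctx I w B s) {dst src y : ℕ} (h : src ≠ dst)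
    (h1 : dst ≠ 1) (h5 : dst ≠ 5) (hy : y ≠ 48) {x : Fin I.n} (hx : s.reg y = x) :
    mask I.n ((unionRow dst src y).run s) dst = mask I.n s src ∪ rowMask I.n s 5 x := by
  have := loopTo_induction (s := s) (r := 48) (b := 1)
    (p := .store dst (.reg 48) (.add (.get src (.reg 48)) (.entry 5 (.lit 0) (.reg y) (.reg 48))))
    (I := fun k t => ∀ z < k, t.arr dst z = s.arr src z + s.arr 5 (x * I.n + z))
    (fun _ _ _ h => h) (by simp) ?_
  · rw [hs.reg_n] at this
    ext z
    rw [mem_union, mem_mask, mem_mask, mem_rowMask, unionRow, this z z.2]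
    omega
  · intro k hk t hag hk' ih z hz
    have e : t.arr src = s.arr src := hag.2 src (by simp [arrs, h])
    have e5 : t.arr 5 = s.arr 5 := hag.2 5 (by simp [arrs, h5.symm])
    have e1 : t.arr 1 = s.arr 1 := hag.2 1 (by simp [arrs, h1.symm])
    have ey : t.reg y = x := by rw [hag.1 y (by simp [regs, hy]), hx]
    simp only [run_store, Expr.entry, Expr.eval, hk', setArr_arr, true_and, e, e5, e1, ey,
      hs.off _ x.2, zero_add]
    split_ifs with h'
    · rw [h']
    · exact ih z (by omega)

theorem eval_terminal {s : State} (hs : Ctx I w B s) {y : ℕ} {x : Fin I.n} (hx : s.reg y = x) :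
    Expr.eval s (terminal y) ≠ 0 ↔ x ∈ I.R := by
  simp only [terminal, Expr.eval, hs.reg_sq, hx, hs.terminal]

/-- The arrays `4` and `5` hold the distances from `v` in the graph of links and corresponding
paths. -/
def Paths (I : NWSTAP) (w : Fin I.n → ℕ) (v : Fin I.n) (t : State) : Prop :=
  ∀ y : Fin I.n, (t.arr 4 y ≠ 0 ↔ I.links.Reachable v y) ∧ (t.arr 4 y ≠ 0 →
    I.links.ConnectedOn (rowMask I.n t 5 y) ∧ v ∈ rowMask I.n t 5 y ∧ y ∈ rowMask I.n t 5 y ∧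
    ∑ z ∈ rowMask I.n t 5 y, w z ≤ w v + (t.arr 4 y - 1) ∧
    t.arr 4 y - 1 = I.links.nodeDist w v y)

theorem Paths.congr {s t : State} (h : Paths I w v s) (h4 : t.arr 4 = s.arr 4)
    (h5 : t.arr 5 = s.arr 5) : Paths I w v t := by
  intro y
  rw [h4, rowMask_congr h5]
  exact h y

/-- The registers written by the inner loop. -/
def footRegs : List ℕ := [10, 11, 12, 13, 20, 21, 22, 23, 24, 30, 31, 32, 46, 47, 48]

/-- Array 8 holds the spider set Q and array 9 the trial set Q ∪ P; register 46 holds the coverage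
of Q and register 47 its cost qc. -/
theorem tryFoot_spec {s : State} (hs : Ctx I w B s) (hB : I.n * I.n < 2 ^ B) (hp : Paths I w v s)
    (h40 : s.reg 40 = lam) {y : Fin I.n} (h44 : s.reg 44 = y) (hM : I.R ⊆ M) (hr : r ∈ I.R)
    (h46 : s.reg 46 = I.cov (mask I.n s 8))
    (hinv : I.SpiderInv w lam v r M y (mask I.n s 8) (s.reg 47)) :
    (tryFoot.run s).reg 46 = I.cov (mask I.n (tryFoot.run s) 8) ∧
    I.SpiderInv w lam v r M (y + 1) (mask I.n (tryFoot.run s) 8) ((tryFoot.run s).reg 47) := by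
  have hT := eval_terminal hs h44
  have h4 : Expr.eval s (.get 4 (.reg 44)) ≠ 0 ↔ I.links.Reachable v y := by
    simp only [Expr.eval, h44]
    exact (hp y).1
  rw [tryFoot]
  by_cases hc : Expr.eval s (.and (.get 4 (.reg 44)) (terminal 44)) ≠ 0
  · rw [run_ite_pos hc]
    rw [Expr.eval_and, hT, h4] at hc
    obtain ⟨hPc, hvP, hyP, hPw, hPd⟩ := (hp y).2 ((hp y).1.2 hc.1)
    rw [hPd] at hPw
    set P := rowMask I.n s 5 y with hPdef
    set Q := mask I.n s 8 with hQ
    simp only [run_seq, run_assign]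
    set s₁ := (unionRow 9 8 44).run s with hs₁
    have hm₁ : mask I.n s₁ 9 = Q ∪ P :=
      unionRow_spec hs (by decide) (by decide) (by decide) (by decide) h44
    have ag₁ : Agree footRegs [6, 7, 9] s s₁ := (agree_run _ _).mono (by decide) (by decide)
    have c₁ : Ctx I w B s₁ := hs.agree ag₁ (by decide) (by decide) (by decide) (by decide)
      (by decide) (by decide)
    set s₂ := (covCmd 9).run s₁ with hs₂
    have h32 : s₂.reg 32 = I.cov (Q ∪ P) := by
      rw [hs₂, cov_spec c₁ (by decide), hm₁]
    have ag₁₂ : Agree [20, 21, 22, 23, 24, 30, 31, 32] [6, 7] s₁ s₂ := cov_agree _ _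
    have hm₂ : mask I.n s₂ 9 = Q ∪ P := by rw [mask_congr (ag₁₂.2 9 (by decide)), hm₁]
    have ag₂ : Agree [10, 11, 12, 13, 20, 21, 22, 23, 24, 30, 31, 32, 48] [6, 7, 9] s s₂ :=
      Agree.trans ((agree_run _ _).mono (by decide) (by decide))
        (ag₁₂.mono (by decide) (by decide))
    set s₃ := s₂.setReg 10 (Expr.eval s₂ (.reg 40)) with hs₃
    set s₄ := s₃.setReg 11 (Expr.eval s₃ (.sub (.reg 32) (.reg 46))) with hs₄
    set s₅ := mul.run s₄ with hs₅
    have ag₄₅ : Agree [10, 11, 12, 13] [] s₄ s₅ := mul_agree _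
    have ag₂₅ : Agree [10, 11, 12, 13] [] s₂ s₅ :=
      ((agree_setReg (by decide) _ _).trans (agree_setReg (by decide) _ _)).trans ag₄₅
    have ag₅ : Agree [10, 11, 12, 13, 20, 21, 22, 23, 24, 30, 31, 32, 48] [6, 7, 9] s s₅ :=
      ag₂.trans (ag₂₅.mono (by decide) (by decide))
    have c₅ : Ctx I w B s₅ := hs.agree ag₅ (by decide) (by decide) (by decide) (by decide)
      (by decide) (by decide)
    have e11 : s₄.reg 11 = I.cov (Q ∪ P) - I.cov Q := by
      simp [hs₄, hs₃, Expr.eval, h32, ag₂.1 46 (by decide), h46]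
    have e10 : s₄.reg 10 = lam := by
      simp [hs₄, hs₃, Expr.eval, ag₂.1 40 (by decide), h40]
    have e2 : s₄.reg 2 = B := by
      simp [hs₄, hs₃, ag₂.1 2 (by decide), hs.reg_B]
    have e12 : s₅.reg 12 = lam * (I.cov (Q ∪ P) - I.cov Q) := by
      rw [hs₅, mul_spec, e10, e11]
      rw [e11, e2]
      have := NWSTAP.cov_le_sq (Q ∪ P)
      omega
    have e44 : s₅.reg 44 = y := by rw [ag₅.1 44 (by decide), h44]
    have e4 : s₅.arr 4 y - 1 = I.links.nodeDist w v y := by rw [ag₅.2 4 (by decide), hPd]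
    by_cases hle : Expr.eval s₅ (.le (.sub (.get 4 (.reg 44)) (.lit 1)) (.reg 12)) ≠ 0
    · rw [run_ite_pos hle]
      rw [Expr.eval_le] at hle
      simp only [Expr.eval, e44, e4, e12] at hle
      simp only [run_seq, run_assign]
      set s₆ := (copyArr 8 9).run s₅ with hs₆
      have hm₆ : mask I.n s₆ 8 = Q ∪ P := by
        rw [hs₆, copyArr_spec c₅ (by decide), mask_congr (ag₂₅.2 9 (by decide)), hm₂]
      have ag₅₆ : Agree [48] [8] s₅ s₆ := (agree_run _ _).mono (by decide) (by decide)
      have e32 : s₆.reg 32 = I.cov (Q ∪ P) := by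
        rw [ag₅₆.1 32 (by decide), ag₂₅.1 32 (by decide), h32]
      have e47 : s₆.reg 47 = s.reg 47 := by rw [ag₅₆.1 47 (by decide), ag₅.1 47 (by decide)]
      have e44' : s₆.reg 44 = y := by rw [ag₅₆.1 44 (by decide), e44]
      have e4' : s₆.arr 4 y - 1 = I.links.nodeDist w v y := by rw [ag₅₆.2 4 (by decide), e4]
      have hmm : ∀ (r v r' v' : ℕ), mask I.n ((s₆.setReg r v).setReg r' v') 8 = mask I.n s₆ 8 :=
        fun _ _ _ _ => mask_congr rfl
      rw [hmm, hm₆]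
      simp only [Expr.eval, setReg_reg, setReg_arr]
      norm_num
      rw [e32, e47, e44', e4']
      exact ⟨rfl, hinv.accept hM hr hPc hvP hyP hPw hle⟩
    · rw [run_ite_neg hle, run_skip]
      rw [Expr.eval_le] at hle
      simp only [Expr.eval, e44, e4, e12] at hle
      rw [mask_congr (ag₅.2 8 (by decide)), ag₅.1 46 (by decide), ag₅.1 47 (by decide)]
      exact ⟨h46, hinv.reject hM hr hPc hvP hyP hle⟩
  · rw [run_ite_neg hc, run_skip]
    rw [Expr.eval_and, hT, h4] at hc
    exact ⟨h46, hinv.skip hc⟩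

theorem tryFoot_loop_spec {s : State} (hs : Ctx I w B s) (hB : I.n * I.n < 2 ^ B)
    (hp : Paths I w v s) (h40 : s.reg 40 = lam) (hM : I.R ⊆ M) (hr : r ∈ I.R)
    (h46 : s.reg 46 = I.cov (mask I.n s 8))
    (hinv : I.SpiderInv w lam v r M 0 (mask I.n s 8) (s.reg 47)) :
    let t := (Cmd.loopTo 44 1 tryFoot).run s
    t.reg 46 = I.cov (mask I.n t 8) ∧ I.SpiderInv w lam v r M I.n (mask I.n t 8) (t.reg 47) := by
  have := loopTo_induction (s := s) (r := 44) (b := 1) (p := tryFoot)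
    (I := fun k t => t.reg 46 = I.cov (mask I.n t 8) ∧
      I.SpiderInv w lam v r M k (mask I.n t 8) (t.reg 47))
    (fun k t v h => by
      rw [mask_congr (show (t.setReg 44 v).arr 8 = t.arr 8 from rfl)]; simpa using h)
    ⟨h46, hinv⟩ ?_
  · rw [hs.reg_n] at this
    exact this
  · intro k hk t hag hk' ⟨h1, h2⟩
    rw [hs.reg_n] at hk
    have c : Ctx I w B t := hs.agree hag (by decide) (by decide) (by decide) (by decide)
      (by decide) (by decide)
    exact tryFoot_spec c hB (hp.congr (hag.2 4 (by decide)) (hag.2 5 (by decide)))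
      (by rw [hag.1 40 (by decide), h40]) (y := ⟨k, hk⟩) hk' hM hr h1 h2

/-- The registers written when a spider is tried. -/
def rootRegs : List ℕ := [10, 11, 12, 13, 20, 21, 22, 23, 24, 30, 31, 32, 44, 45, 46, 47, 48]

/-- Array 3 holds the current set M and register 45 its coverage. M is overwritten only if the
finished spider passes the test with the doubled threshold. -/
theorem tryRoot_spec {s : State} (hs : Ctx I w B s) (hB : I.n * I.n < 2 ^ B) (hp : Paths I w v s)
    (h40 : s.reg 40 = lam) (h42 : s.reg 42 = v) (h43 : s.reg 43 = r)
    (hM : I.R ⊆ mask I.n s 3) :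
    I.Grows w lam (mask I.n s 3) (mask I.n (tryRoot.run s) 3) ∧
      I.Saturated w lam v r (mask I.n (tryRoot.run s) 3) := by
  have hT := eval_terminal hs h43
  have h4 : Expr.eval s (.get 4 (.reg 43)) ≠ 0 ↔ I.links.Reachable v r := by
    simp only [Expr.eval, h43]
    exact (hp r).1
  rw [tryRoot]
  by_cases hc : Expr.eval s (.and (.get 4 (.reg 43)) (terminal 43)) ≠ 0
  · rw [run_ite_pos hc]
    rw [Expr.eval_and, hT, h4] at hc
    obtain ⟨hPc, hvP, hrP, hPw, hPd⟩ := (hp r).2 ((hp r).1.2 hc.1)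
    rw [hPd] at hPw
    set P := rowMask I.n s 5 r with hPdef
    set M := mask I.n s 3 with hMdef
    simp only [run_seq, run_assign]
    set s₁ := (covCmd 3).run s with hs₁
    have h32 : s₁.reg 32 = I.cov M := by rw [hs₁, cov_spec hs (by decide)]
    have ag₁ : Agree rootRegs [6, 7, 8, 9] s s₁ := (cov_agree _ _).mono (by decide) (by decide)
    set s₂ := s₁.setReg 45 (Expr.eval s₁ (.reg 32)) with hs₂
    have h45 : s₂.reg 45 = I.cov M := by simp [hs₂, Expr.eval, h32]
    have ag₂ : Agree rootRegs [6, 7, 8, 9] s s₂ := ag₁.trans (agree_setReg (by decide) _ _)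
    have c₂ : Ctx I w B s₂ := hs.agree ag₂ (by decide) (by decide) (by decide) (by decide)
      (by decide) (by decide)
    set s₃ := (unionRow 8 3 43).run s₂ with hs₃
    have hm₃ : mask I.n s₃ 8 = M ∪ P := by
      rw [hs₃, unionRow_spec c₂ (by decide) (by decide) (by decide) (by decide)
        (x := r) (by rw [ag₂.1 43 (by decide), h43]), mask_congr (ag₂.2 3 (by decide)),
        rowMask_congr (ag₂.2 5 (by decide))]
    have ag₂₃ : Agree [48] [8] s₂ s₃ := (agree_run _ _).mono (by decide) (by decide)
    have ag₃ : Agree rootRegs [6, 7, 8, 9] s s₃ :=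
      ag₂.trans (ag₂₃.mono (by decide) (by decide))
    have c₃ : Ctx I w B s₃ := hs.agree ag₃ (by decide) (by decide) (by decide) (by decide)
      (by decide) (by decide)
    set s₄ := (covCmd 8).run s₃ with hs₄
    have h32₄ : s₄.reg 32 = I.cov (M ∪ P) := by rw [hs₄, cov_spec c₃ (by decide), hm₃]
    have ag₃₄ : Agree [20, 21, 22, 23, 24, 30, 31, 32] [6, 7] s₃ s₄ := cov_agree _ _
    have hm₄ : mask I.n s₄ 8 = M ∪ P := by rw [mask_congr (ag₃₄.2 8 (by decide)), hm₃]
    have ag₄ : Agree rootRegs [6, 7, 8, 9] s s₄ :=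
      ag₃.trans (ag₃₄.mono (by decide) (by decide))
    set s₅ := s₄.setReg 46 (Expr.eval s₄ (.reg 32)) with hs₅
    have ag₄₅ : Agree [46] [] s₄ s₅ := agree_setReg (by decide) _ _
    have ag₅ : Agree rootRegs [6, 7, 8, 9] s s₅ :=
      ag₄.trans (ag₄₅.mono (by decide) (by decide))
    set s₆ := s₅.setReg 47
      (Expr.eval s₅ (.add (.get 2 (.reg 42)) (.sub (.get 4 (.reg 43)) (.lit 1)))) with hs₆
    have ag₅₆ : Agree [47] [] s₅ s₆ := agree_setReg (by decide) _ _
    have ag₆ : Agree rootRegs [6, 7, 8, 9] s s₆ :=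
      ag₅.trans (ag₅₆.mono (by decide) (by decide))
    have c₆ : Ctx I w B s₆ := hs.agree ag₆ (by decide) (by decide) (by decide) (by decide)
      (by decide) (by decide)
    have hm₆ : mask I.n s₆ 8 = M ∪ P := hm₄
    have e46 : s₆.reg 46 = I.cov (mask I.n s₆ 8) := by
      rw [hm₆]
      simp [hs₆, hs₅, Expr.eval, h32₄]
    have e47 : s₆.reg 47 = w v + I.links.nodeDist w v r := by
      simp only [hs₆, Expr.eval, setReg_reg, if_true]
      rw [ag₅.1 42 (by decide), ag₅.1 43 (by decide), ag₅.2 2 (by decide), ag₅.2 4 (by decide),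
        h42, h43, hs.weight, hPd]
    have e45 : s₆.reg 45 = I.cov M := by
      rw [ag₅₆.1 45 (by decide), ag₄₅.1 45 (by decide), ag₃₄.1 45 (by decide),
        ag₂₃.1 45 (by decide), h45]
    have e40 : s₆.reg 40 = lam := by rw [ag₆.1 40 (by decide), h40]
    have hp₆ := hp.congr (ag₆.2 4 (by decide)) (ag₆.2 5 (by decide))
    obtain ⟨g46, ginv⟩ := tryFoot_loop_spec c₆ hB hp₆ e40 hM hc.2 e46 (by
      rw [hm₆, e47]
      exact .init hPc hvP hrP hPw)
    set s₇ := (Cmd.loopTo 44 1 tryFoot).run s₆ with hs₇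
    set Q := mask I.n s₇ 8 with hQ
    have ag₆₇ : Agree (44 :: footRegs) [6, 7, 8, 9] s₆ s₇ :=
      (agree_run _ _).mono (by decide) (by decide)
    have ag₇ : Agree rootRegs [6, 7, 8, 9] s s₇ :=
      ag₆.trans (ag₆₇.mono (by decide) (by decide))
    set s₈ := s₇.setReg 10 (Expr.eval s₇ (.add (.reg 40) (.reg 40))) with hs₈
    set s₉ := s₈.setReg 11 (Expr.eval s₈ (.sub (.reg 46) (.reg 45))) with hs₉
    set s₁₀ := mul.run s₉ with hs₁₀
    have ag₇₁₀ : Agree [10, 11, 12, 13] [] s₇ s₁₀ :=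
      ((agree_setReg (by decide) _ _).trans (agree_setReg (by decide) _ _)).trans (mul_agree _)
    have ag₁₀ : Agree rootRegs [6, 7, 8, 9] s s₁₀ :=
      ag₇.trans (ag₇₁₀.mono (by decide) (by decide))
    have c₁₀ : Ctx I w B s₁₀ := hs.agree ag₁₀ (by decide) (by decide) (by decide) (by decide)
      (by decide) (by decide)
    have e11 : s₉.reg 11 = I.cov Q - I.cov M := by
      simp [hs₉, hs₈, Expr.eval, g46, ag₆₇.1 45 (by decide), e45]
    have e10 : s₉.reg 10 = 2 * lam := by
      simp [hs₉, hs₈, Expr.eval, ag₇.1 40 (by decide), h40, two_mul]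
    have e2 : s₉.reg 2 = B := by
      simp [hs₉, hs₈, ag₇.1 2 (by decide), hs.reg_B]
    have e12 : s₁₀.reg 12 = 2 * lam * (I.cov Q - I.cov M) := by
      rw [hs₁₀, mul_spec, e10, e11]
      rw [e11, e2]
      have := NWSTAP.cov_le_sq Q
      omega
    have hm₁₀ : mask I.n s₁₀ 8 = Q := mask_congr (ag₇₁₀.2 8 (by decide))
    by_cases hle : Expr.eval s₁₀ (.le (.reg 47) (.reg 12)) ≠ 0
    · rw [run_ite_pos hle]
      rw [Expr.eval_le] at hle
      simp only [Expr.eval, e12] at hle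
      rw [ag₇₁₀.1 47 (by decide)] at hle
      rw [copyArr_spec c₁₀ (by decide), hm₁₀]
      exact ginv.finish_accept hle
    · rw [run_ite_neg hle, run_skip]
      rw [Expr.eval_le] at hle
      simp only [Expr.eval, e12] at hle
      rw [ag₇₁₀.1 47 (by decide)] at hle
      rw [mask_congr (ag₁₀.2 3 (by decide))]
      exact ginv.finish_reject hle
  · rw [run_ite_neg hc, run_skip]
    rw [Expr.eval_and, hT, h4] at hc
    -- If r is not a terminal reachable from v, saturation is vacuous.
    exact ⟨.refl _, fun Y hY hr hreach => absurd ⟨hreach r hr, hY hr⟩ hc⟩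

theorem tryCenter_spec {s : State} (hs : Ctx I w B s) (hB : I.n * I.n < 2 ^ B)
    (h40 : s.reg 40 = lam) (h42 : s.reg 42 = v) (hM : I.R ⊆ mask I.n s 3) :
    I.Grows w lam (mask I.n s 3) (mask I.n (tryCenter.run s) 3) ∧
      ∀ r, I.Saturated w lam v r (mask I.n (tryCenter.run s) 3) := by
  rw [tryCenter, run_seq, run_seq, run_assign, Expr.eval, h42]
  set s₁ := s.setReg 20 v with hs₁
  have ag₁ : Agree (43 :: rootRegs) [4, 5, 6, 7, 8, 9] s s₁ := agree_setReg (by decide) _ _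
  have c₁ : Ctx I w B s₁ := hs.agree ag₁ (by decide) (by decide) (by decide) (by decide)
    (by decide) (by decide)
  set s₂ := (bellmanFord linkCond 4 5).run s₁ with hs₂
  have ag₂ : Agree (43 :: rootRegs) [4, 5, 6, 7, 8, 9] s s₂ :=
    ag₁.trans ((agree_run _ _).mono (by decide) (by decide))
  have c₂ : Ctx I w B s₂ := hs.agree ag₂ (by decide) (by decide) (by decide) (by decide)
    (by decide) (by decide)
  have hp : Paths I w v s₂ := by
    refine bellmanFord_spec c₁ (by decide) (by decide) (by decide) (by simp [hs₁]) ?_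
    intro t hag u x hu hx
    have hctx := c₁.of_agree_bf (aD := 4) (aP := 5) (by decide) (by decide) hag
    rw [linkCond, Expr.eval_and, Expr.eval_not]
    simp only [Expr.entry, Expr.eval, hu, hx, hctx.off _ u.2, hctx.reg_sq, hctx.adj, hctx.tree]
    exact I.links_adj.symm
  have hm₂ : mask I.n s₂ 3 = mask I.n s 3 := mask_congr (ag₂.2 3 (by decide))
  have := loopTo_induction (s := s₂) (r := 43) (b := 1) (p := tryRoot)
    (I := fun k t => I.Grows w lam (mask I.n s 3) (mask I.n t 3) ∧
      ∀ r : Fin I.n, r < k → I.Saturated w lam v r (mask I.n t 3))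
    (fun _ _ _ h => h) ⟨by rw [hm₂]; exact .refl _, fun r hr => absurd hr (by omega)⟩ ?_
  · rw [c₂.reg_n] at this
    exact ⟨this.1, fun r => this.2 r r.2⟩
  · intro k hk t hag hk' ⟨h1, h2⟩
    rw [c₂.reg_n] at hk
    have c : Ctx I w B t := c₂.agree hag (by decide) (by decide) (by decide) (by decide)
      (by decide) (by decide)
    obtain ⟨g1, g2⟩ := tryRoot_spec c hB (hp.congr (hag.2 4 (by decide)) (hag.2 5 (by decide)))
      (by rw [hag.1 40 (by decide), ag₂.1 40 (by decide), h40])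
      (by rw [hag.1 42 (by decide), ag₂.1 42 (by decide), h42]) (r := ⟨k, hk⟩) hk'
      (hM.trans h1.1)
    refine ⟨h1.trans g1, fun r hr => ?_⟩
    rcases Nat.lt_or_ge r k with hrk | hrk
    · exact (h2 r hrk).mono g1.1
    · obtain rfl : r = ⟨k, hk⟩ := Fin.ext (by simp; omega)
      exact g2

theorem round_spec {s : State} (hs : Ctx I w B s) (hB : I.n * I.n < 2 ^ B)
    (h40 : s.reg 40 = lam) (hM : I.R ⊆ mask I.n s 3) :
    I.Level w lam (mask I.n s 3) (mask I.n ((Cmd.loopTo 42 1 tryCenter).run s) 3) := by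
  have := loopTo_induction (s := s) (r := 42) (b := 1) (p := tryCenter)
    (I := fun k t => I.Grows w lam (mask I.n s 3) (mask I.n t 3) ∧
      ∀ v : Fin I.n, v < k → ∀ r, I.Saturated w lam v r (mask I.n t 3))
    (fun _ _ _ h => h) ⟨.refl _, fun r hr => absurd hr (by omega)⟩ ?_
  · rw [hs.reg_n] at this
    exact NWSTAP.level_of_saturated this.1 fun v => this.2 v v.2
  · intro k hk t hag hk' ⟨h1, h2⟩
    rw [hs.reg_n] at hk
    have c : Ctx I w B t := hs.agree hag (by decide) (by decide) (by decide) (by decide)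
      (by decide) (by decide)
    obtain ⟨g1, g2⟩ := tryCenter_spec c hB (by rw [hag.1 40 (by decide), h40]) (v := ⟨k, hk⟩) hk'
      (hM.trans h1.1)
    refine ⟨h1.trans g1, fun v hv r => ?_⟩
    rcases Nat.lt_or_ge v k with hvk | hvk
    · exact (h2 v hvk r).mono g1.1
    · obtain rfl : v = ⟨k, hk⟩ := Fin.ext (by simp; omega)
      exact g2 r

theorem allRounds_spec {s : State} (hs : Ctx I w B s) (hB : I.n * I.n < 2 ^ B)
    (h40 : s.reg 40 = 1) (hM : mask I.n s 3 = I.R) :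
    ∃ Ms : ℕ → Finset (Fin I.n), Ms 0 = I.R ∧
      (∀ k < B, I.Level w (2 ^ k) (Ms k) (Ms (k + 1))) ∧
      mask I.n (allRounds.run s) 3 = Ms B := by
  have := loopTo_induction (s := s) (r := 41) (b := 2)
    (p := .seq (.loopTo 42 1 tryCenter) (.assign 40 (.add (.reg 40) (.reg 40))))
    (I := fun k t => t.reg 40 = 2 ^ k ∧ ∃ Ms : ℕ → Finset (Fin I.n), Ms 0 = I.R ∧
      (∀ j < k, I.Level w (2 ^ j) (Ms j) (Ms (j + 1))) ∧ mask I.n t 3 = Ms k)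
    (fun _ _ _ h => by
      refine ⟨by simpa using h.1, ?_⟩
      exact h.2)
    ⟨by simpa using h40, fun _ => I.R, rfl, fun j hj => absurd hj (by omega), hM⟩ ?_
  · rw [hs.reg_B] at this
    exact this.2
  · intro k hk t hag hk' ⟨h1, Ms, h2, h3, h4⟩
    have c : Ctx I w B t := hs.agree hag (by decide) (by decide) (by decide) (by decide)
      (by decide) (by decide)
    have hsub : ∀ j ≤ k, I.R ⊆ Ms j := by
      intro j hj
      induction j with
      | zero => rw [h2]
      | succ j ih => exact (ih (by omega)).trans (h3 j (by omega)).subset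
    have hl := round_spec c hB h1 (by rw [h4]; exact hsub k le_rfl)
    rw [run_seq, run_assign]
    set t' := (Cmd.loopTo 42 1 tryCenter).run t with ht'
    have e40 : t'.reg 40 = 2 ^ k := by rw [ht', run_reg (by decide), h1]
    -- The chain is extended by the set after this round, without changing the earlier entries.
    refine ⟨by simp [Expr.eval, e40, pow_succ]; omega, Function.update Ms (k + 1) (mask I.n t' 3),
      ?_, ?_, ?_⟩
    · rw [Function.update_of_ne (by omega), h2]
    · intro j hj
      rcases Nat.lt_or_ge j k with hjk | hjk
      · rw [Function.update_of_ne (by omega), Function.update_of_ne (by omega)]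
        exact h3 j hjk
      · obtain rfl : j = k := by omega
        rw [Function.update_self, Function.update_of_ne (by omega), ← h4]
        exact hl
    · rw [Function.update_self]
      exact mask_congr rfl

end RAM

/-! ### Integral weights, pruning and output -/

namespace RAM

namespace Cmd

/-- Compute the offsets of the rows and the square of the number of vertices. -/
def setOffsets : Cmd :=
  .seq (.assign 3 (.lit 0)) (.loopTo 50 1
    (.seq (.store 1 (.reg 50) (.reg 3)) (.assign 3 (.add (.reg 3) (.reg 1)))))

/-- The first cell of the costs in the input. -/
def costBase : Expr := .add (.add (.add (.lit 1) (.reg 3)) (.reg 3)) (.reg 1)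

/-- Multiply register `12` with the numerator of the cost of the vertex in register `51` if this is
the vertex in register `50`, and with the denominator otherwise. -/
def scaleWeight : Cmd :=
  .seq (.assign 10 (.reg 12))
    (.seq (.ite (.eq (.reg 51) (.reg 50))
        (.assign 11 (.get 0 (.add costBase (.add (.reg 51) (.reg 51)))))
        (.assign 11 (.get 0 (.add (.add costBase (.add (.reg 51) (.reg 51))) (.lit 1)))))
      mul)

/-- Compute the integral weights. -/
def setWeights : Cmd :=
  .loopTo 50 1 (.seq (.assign 12 (.add (.add (.reg 3) (.reg 3)) (.add (.reg 3) (.reg 3))))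
    (.seq (.loopTo 51 1 scaleWeight) (.store 2 (.reg 50) (.reg 12))))

/-- Start with the set of terminals and the threshold `1`. -/
def setStart : Cmd :=
  .seq (.loopTo 50 1 (.store 3 (.reg 50) (terminal 50))) (.assign 40 (.lit 1))

/-- Remove from the array `10` the vertices that are not reachable from the terminal in register
`52` after the deletion of the edge between the vertices in the registers `30` and `31`. -/
def pruneStep : Cmd :=
  .ite (terminal 52)
    (.seq (.assign 20 (.reg 52)) (.seq (reach 3)
      (.loopTo 53 1 (.ite (.get 6 (.reg 53)) .skip (.store 10 (.reg 53) (.lit 0)))))) .skip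

/-- Compute in the array `10` the vertices outside `R` that are 2-edge-connected with `R`. -/
def prune : Cmd :=
  .seq (.loopTo 53 1 (.store 10 (.reg 53) (.not (terminal 53))))
    (.loopTo 30 1 (.loopTo 31 1 (.loopTo 52 1 pruneStep)))

/-- Write the output. -/
def writeOut : Cmd :=
  .seq (.loopTo 54 1 (.store 0 (.reg 54) (.get 10 (.reg 54)))) (.assign 0 (.reg 1))

/-- The program after the computation of the loop bounds. -/
def main : Cmd :=
  .seq setOffsets (.seq setWeights (.seq setStart (.seq allRounds (.seq prune writeOut))))

theorem main_wf : main.WF [1, 2] := by decide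

end Cmd

open State Cmd SimpleGraph

/-- The integral weights: the costs times `4 * n ^ 2` times the product of all denominators. -/
def weight (I : NWSTAP) (v : Fin I.n) : ℕ :=
  4 * (I.n * I.n) * ∏ u : Fin I.n, if u = v then (I.c u).num else (I.c u).den

/-- The state after the computation of the loop bounds. -/
structure Input (I : NWSTAP) (B : ℕ) (s : State) : Prop where
  reg_n : s.reg 1 = I.n
  reg_B : s.reg 2 = B
  adj : ∀ u v : Fin I.n, s.arr 0 (1 + u * I.n + v) ≠ 0 ↔ I.G.Adj u v
  tree : ∀ u v : Fin I.n, s.arr 0 (1 + I.n * I.n + u * I.n + v) ≠ 0 ↔ I.T.Adj u v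
  terminal : ∀ v : Fin I.n, s.arr 0 (1 + I.n * I.n + I.n * I.n + v) ≠ 0 ↔ v ∈ I.R
  num : ∀ v : Fin I.n, s.arr 0 (1 + I.n * I.n + I.n * I.n + I.n + (v + v)) = (I.c v).num
  den : ∀ v : Fin I.n, s.arr 0 (1 + I.n * I.n + I.n * I.n + I.n + (v + v) + 1) = (I.c v).den

variable {I : NWSTAP} {B : ℕ}

theorem Input.agree {s t : State} {rs as : List ℕ} (h : Input I B s) (hst : s.Agree rs as t)
    (h1 : 1 ∉ rs) (h2 : 2 ∉ rs) (h0 : 0 ∉ as) : Input I B t := by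
  obtain ⟨a1, a2, a3, a4, a5, a6, a7⟩ := h
  constructor
  · rw [hst.1 1 h1, a1]
  · rw [hst.1 2 h2, a2]
  all_goals rw [hst.2 0 h0]; assumption

theorem setOffsets_spec {s : State} (hs : Input I B s) :
    (setOffsets.run s).reg 3 = I.n * I.n ∧
      ∀ u < I.n, (setOffsets.run s).arr 1 u = u * I.n := by
  rw [setOffsets, run_seq, run_assign, Expr.eval]
  set s₁ := s.setReg 3 0 with hs₁
  have e1 : s₁.reg 1 = I.n := by simp [hs₁, hs.reg_n]
  have := loopTo_induction (s := s₁) (r := 50) (b := 1)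
    (p := .seq (.store 1 (.reg 50) (.reg 3)) (.assign 3 (.add (.reg 3) (.reg 1))))
    (I := fun k t => t.reg 3 = k * I.n ∧ ∀ u < k, t.arr 1 u = u * I.n)
    (fun _ _ _ h => by simpa using h) (by simp [hs₁]) ?_
  · rw [e1] at this
    exact this
  · intro k hk t hag hk' ⟨h1, h2⟩
    have e1' : t.reg 1 = I.n := by rw [hag.1 1 (by decide), e1]
    simp only [run_seq, run_assign, run_store, Expr.eval, hk', h1]
    constructor
    · simp [e1', h1, Nat.succ_mul]
    · intro u hu
      simp only [setReg_arr, setArr_arr, true_and]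
      split_ifs with h
      · rw [h]
      · exact h2 u (by omega)

/-- The factor of the vertex `u` in the weight of the vertex `v`. -/
def factor (I : NWSTAP) (v u : ℕ) : ℕ :=
  if h : u < I.n then if u = v then (I.c ⟨u, h⟩).num else (I.c ⟨u, h⟩).den else 1

theorem weight_eq (v : Fin I.n) :
    weight I v = 4 * (I.n * I.n) * ∏ u ∈ range I.n, factor I v u := by
  rw [weight, ← Fin.prod_univ_eq_prod_range (fun u => factor I v u)]
  congr 1
  refine prod_congr rfl fun u _ => ?_
  simp [factor, Fin.ext_iff]

/-- The running product may be long, but it is the first factor; the second one is a numerator or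
denominator from the input and is below 2 ^ B. -/
theorem scaleWeight_spec {s : State} (hs : Input I B s) (h3 : s.reg 3 = I.n * I.n)
    (hB : ∀ v : Fin I.n, (I.c v).num < 2 ^ B ∧ (I.c v).den < 2 ^ B) {v u : Fin I.n}
    (h50 : s.reg 50 = v) (h51 : s.reg 51 = u) :
    (scaleWeight.run s).reg 12 = s.reg 12 * factor I v u := by
  have hf : factor I v u < 2 ^ B := by
    simp only [factor, u.2, dif_pos]
    split_ifs
    exacts [(hB _).1, (hB _).2]
  rw [scaleWeight, run_seq, run_seq, run_assign, Expr.eval]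
  set s₁ := s.setReg 10 (s.reg 12) with hs₁
  by_cases h : Expr.eval s₁ (.eq (.reg 51) (.reg 50)) ≠ 0
  · rw [run_ite_pos h, run_assign]
    rw [Expr.eval_eq] at h
    simp [Expr.eval, hs₁, h51, h50] at h
    have e : Expr.eval s₁ (.get 0 (.add costBase (.add (.reg 51) (.reg 51)))) = factor I v u := by
      simp only [costBase, Expr.eval, hs₁, setReg_reg, setReg_arr]
      norm_num
      rw [h51, h3, hs.reg_n, hs.num]
      obtain rfl : u = v := Fin.ext h
      simp [factor]
    rw [e, mul_spec]
    · simp [hs₁]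
    · simp only [hs₁, setReg_reg]
      norm_num
      rw [hs.reg_B]
      exact hf
  · rw [run_ite_neg h, run_assign]
    rw [Expr.eval_eq] at h
    simp [Expr.eval, hs₁, h51, h50] at h
    have e : Expr.eval s₁ (.get 0 (.add (.add costBase (.add (.reg 51) (.reg 51))) (.lit 1))) =
        factor I v u := by
      simp only [costBase, Expr.eval, hs₁, setReg_reg, setReg_arr]
      norm_num
      rw [h51, h3, hs.reg_n, hs.den]
      simp [factor, h]
    rw [e, mul_spec]
    · simp [hs₁]
    · simp only [hs₁, setReg_reg]
      norm_num
      rw [hs.reg_B]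
      exact hf

theorem setWeights_spec {s : State} (hs : Input I B s) (h3 : s.reg 3 = I.n * I.n)
    (hB : ∀ v : Fin I.n, (I.c v).num < 2 ^ B ∧ (I.c v).den < 2 ^ B) :
    ∀ v : Fin I.n, (setWeights.run s).arr 2 v = weight I v := by
  have := loopTo_induction (s := s) (r := 50) (b := 1)
    (p := .seq (.assign 12 (.add (.add (.reg 3) (.reg 3)) (.add (.reg 3) (.reg 3))))
      (.seq (.loopTo 51 1 scaleWeight) (.store 2 (.reg 50) (.reg 12))))
    (I := fun k t => ∀ v : Fin I.n, v < k → t.arr 2 v = weight I v)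
    (fun _ _ _ h => h) (fun v hv => absurd hv (by omega)) ?_
  · rw [hs.reg_n] at this
    exact fun v => this v v.2
  · intro k hk t hag hk' ih
    rw [hs.reg_n] at hk
    have ht : Input I B t := hs.agree hag (by decide) (by decide) (by decide)
    have e3 : t.reg 3 = I.n * I.n := by rw [hag.1 3 (by decide), h3]
    rw [run_seq, run_seq, run_assign]
    set t₁ := t.setReg 12 (Expr.eval t (.add (.add (.reg 3) (.reg 3)) (.add (.reg 3) (.reg 3))))
      with ht₁
    have ag₁ : Agree [12] [] t t₁ := agree_setReg (by decide) _ _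
    have c₁ : Input I B t₁ := ht.agree ag₁ (by decide) (by decide) (by decide)
    have e12 : t₁.reg 12 = 4 * (I.n * I.n) := by
      simp [ht₁, Expr.eval, e3]; omega
    have e50 : t₁.reg 50 = k := by rw [ag₁.1 50 (by decide), hk']
    have e3' : t₁.reg 3 = I.n * I.n := by rw [ag₁.1 3 (by decide), e3]
    have hloop := loopTo_induction (s := t₁) (r := 51) (b := 1) (p := scaleWeight)
      (I := fun j u => u.reg 12 = 4 * (I.n * I.n) * ∏ u ∈ range j, factor I k u)
      (fun _ _ _ h => by simpa using h) (by simpa using e12) (by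
        intro j hj u hagu hj' ihj
        rw [c₁.reg_n] at hj
        rw [scaleWeight_spec (c₁.agree hagu (by decide) (by decide) (by decide))
          (by rw [hagu.1 3 (by decide), e3']) hB (v := ⟨k, hk⟩) (u := ⟨j, hj⟩)
          (by rw [hagu.1 50 (by decide), e50]) hj', ihj, prod_range_succ, mul_assoc])
    rw [c₁.reg_n, ← weight_eq ⟨k, hk⟩] at hloop
    set t₂ := (Cmd.loopTo 51 1 scaleWeight).run t₁ with ht₂
    have ag₂ : Agree [10, 11, 12, 13, 51] [] t₁ t₂ := (agree_run _ _).mono (by decide) (by decide)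
    have e50' : t₂.reg 50 = k := by rw [ag₂.1 50 (by decide), e50]
    intro v hv
    simp only [run_store, Expr.eval, e50', hloop, setArr_arr, true_and]
    split_ifs with h
    · obtain rfl : v = ⟨k, hk⟩ := Fin.ext h
      rfl
    · rw [ag₂.2 2 (by decide), ag₁.2 2 (by decide)]
      exact ih v (by omega)

theorem setStart_spec {w : Fin I.n → ℕ} {s : State} (hs : Ctx I w B s) :
    mask I.n (setStart.run s) 3 = I.R ∧ (setStart.run s).reg 40 = 1 := by
  have := loopTo_induction (s := s) (r := 50) (b := 1) (p := .store 3 (.reg 50) (terminal 50))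
    (I := fun k t => ∀ v : Fin I.n, v < k → (t.arr 3 v ≠ 0 ↔ v ∈ I.R))
    (fun _ _ _ h => h) (fun v hv => absurd hv (by omega)) ?_
  · rw [hs.reg_n] at this
    refine ⟨?_, by simp [setStart, run_seq, run_assign, Expr.eval]⟩
    ext v
    rw [mem_mask]
    exact this v v.2
  · intro k hk t hag hk' ih v hv
    rw [hs.reg_n] at hk
    have ht : Ctx I w B t := hs.agree hag (by decide) (by decide) (by decide) (by decide)
      (by decide) (by decide)
    simp only [run_store]
    rw [Expr.eval, hk', setArr_arr]
    simp only [true_and]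
    split_ifs with h
    · obtain rfl : v = ⟨k, hk⟩ := Fin.ext h
      exact eval_terminal ht hk'
    · exact ih v (by omega)

/-- The array `10` in the state `t` is the one in the state `s`, restricted to the vertices with the
property `C`. -/
def Filters (I : NWSTAP) (s t : State) (C : Fin I.n → Prop) : Prop :=
  ∀ x : Fin I.n, (C x → t.arr 10 x = s.arr 10 x) ∧ (¬ C x → t.arr 10 x = 0)

/-- Each round keeps a cell or sets it to 0, so a loop intersects the conditions of its rounds.
Nested loops then produce the quantifiers over a, b and r. -/
theorem loopTo_filters {r : ℕ} {p : Cmd} {s : State} (hn : s.reg 1 = I.n)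
    (C : Fin I.n → Fin I.n → Prop)
    (h : ∀ (k : Fin I.n) (t : State), Agree (r :: p.regs) p.arrs s t → t.reg r = k →
      Filters I t (p.run t) (C k)) :
    Filters I s ((Cmd.loopTo r 1 p).run s) (fun x => ∀ k, C k x) := by
  classical
  have := loopTo_induction (s := s) (r := r) (b := 1) (p := p)
    (I := fun k t => Filters I s t (fun x => ∀ j : Fin I.n, j < k → C j x))
    (fun _ _ _ h => h) (fun x => ⟨fun _ => rfl, fun h => absurd (by simp) h⟩) ?_
  · rw [hn] at this
    exact fun x => ⟨fun h => (this x).1 fun j _ => h j,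
      fun h => (this x).2 fun h' => h fun j => h' j j.2⟩
  · intro k hk t hag hk' ih x
    rw [hn] at hk
    obtain ⟨h1, h2⟩ := h ⟨k, hk⟩ t hag hk' x
    refine ⟨fun hC => ?_, fun hC => ?_⟩
    · rw [h1 (hC _ (by simp)), (ih x).1 fun j hj => hC j (by omega)]
    · by_cases hCk : C ⟨k, hk⟩ x
      · rw [h1 hCk]
        refine (ih x).2 fun h' => hC fun j hj => ?_
        rcases Nat.lt_or_ge j k with hjk | hjk
        · exact h' j hjk
        · obtain rfl : j = ⟨k, hk⟩ := Fin.ext (by simp; omega)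
          exact hCk
      · exact h2 hCk

variable {w : Fin I.n → ℕ}

theorem pruneStep_spec {s : State} (hs : Ctx I w B s) {a b r : Fin I.n} (h30 : s.reg 30 = a)
    (h31 : s.reg 31 = b) (h52 : s.reg 52 = r) :
    Filters I s (pruneStep.run s) (fun x => r ∈ I.R →
      ((I.G.deleteEdges {s(a, b)}).within (mask I.n s 3)).Reachable r x) := by
  classical
  have hT := eval_terminal hs h52
  rw [pruneStep]
  by_cases hc : Expr.eval s (terminal 52) ≠ 0
  · rw [run_ite_pos hc, run_seq, run_seq, run_assign, Expr.eval, h52]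
    have hr := hT.1 hc
    set s₁ := s.setReg 20 r with hs₁
    have c₁ : Ctx I w B s₁ := hs.of_agree_cov (agree_setReg (by simp) _ _)
    have hreach := reach_spec c₁ (q := 3) (by decide) (src := r) (a := a) (b := b) (by simp [hs₁])
      (by simp [hs₁, h30]) (by simp [hs₁, h31])
    rw [mask_congr (show s₁.arr 3 = s.arr 3 from rfl)] at hreach
    set s₂ := (reach 3).run s₁ with hs₂
    have ag₂ : Agree [21, 22, 23, 24] [6, 7] s₁ s₂ := reach_agree _ _
    have hf := loopTo_filters (I := I) (s := s₂) (r := 53)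
      (p := .ite (.get 6 (.reg 53)) .skip (.store 10 (.reg 53) (.lit 0)))
      -- Round k touches only cell k, so its condition is trivial for all other cells.
      (by rw [ag₂.1 1 (by decide), c₁.reg_n]) (fun k x => x = k →
        ((I.G.deleteEdges {s(a, b)}).within (mask I.n s 3)).Reachable r x) (by
      intro k t hag hk x
      have e6 : t.arr 6 = s₂.arr 6 := hag.2 6 (by decide)
      by_cases h6 : Expr.eval t (.get 6 (.reg 53)) ≠ 0
      · rw [run_ite_pos h6, run_skip]
        simp only [Expr.eval, hk, e6] at h6
        refine ⟨fun _ => rfl, fun h => absurd ?_ h⟩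
        rintro rfl
        exact (hreach x).1 h6
      · rw [run_ite_neg h6, run_store]
        simp only [Expr.eval, hk, e6] at h6
        simp only [Expr.eval, hk, setArr_arr, true_and, ← Fin.ext_iff]
        by_cases hxk : x = k
        · subst hxk
          exact ⟨fun h => absurd ((hreach x).2 (h rfl)) h6, fun _ => if_pos rfl⟩
        · exact ⟨fun _ => if_neg hxk, fun h => absurd (fun h => absurd h hxk) h⟩)
    intro x
    rw [← show s₂.arr 10 = s.arr 10 from ag₂.2 10 (by decide)]
    exact ⟨fun h => (hf x).1 fun k hk => h hr, fun h => (hf x).2 fun h' => h fun _ => h' x rfl⟩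
  · rw [run_ite_neg hc, run_skip]
    exact fun x => ⟨fun _ => rfl, fun h => absurd (fun h => absurd (hT.2 h) hc) h⟩

open Classical in
theorem prune_spec {s : State} (hs : Ctx I w B s) {A : Finset (Fin I.n)}
    (hA : ∀ x, x ∈ A ↔ x ∉ I.R ∧ ∀ a b, ∀ r ∈ I.R,
      ((I.G.deleteEdges {s(a, b)}).within (mask I.n s 3)).Reachable r x) (x : Fin I.n) :
    (prune.run s).arr 10 x = if x ∈ A then 1 else 0 := by
  rw [prune, run_seq]
  set s₁ := (Cmd.loopTo 53 1 (.store 10 (.reg 53) (.not (terminal 53)))).run s with hs₁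
  have h10 : ∀ x : Fin I.n, s₁.arr 10 x = if x ∈ I.R then 0 else 1 := by
    have := loopTo_induction (s := s) (r := 53) (b := 1)
      (p := .store 10 (.reg 53) (.not (terminal 53)))
      (I := fun k t => ∀ x : Fin I.n, x < k → t.arr 10 x = if x ∈ I.R then 0 else 1)
      (fun _ _ _ h => h) (fun v hv => absurd hv (by omega)) ?_
    · rw [hs.reg_n] at this
      exact fun x => this x x.2
    · intro k hk t hag hk' ih v hv
      rw [hs.reg_n] at hk
      have ht : Ctx I w B t := hs.agree hag (by decide) (by decide) (by decide) (by decide)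
        (by decide) (by decide)
      simp only [run_store]
      rw [Expr.eval, hk', setArr_arr]
      simp only [true_and]
      split_ifs with h h' h'
      · obtain rfl : v = ⟨k, hk⟩ := Fin.ext h
        have := (eval_terminal ht (y := 53) (x := ⟨k, hk⟩) hk').2 h'
        simp only [Expr.not, Expr.eval]
        omega
      · obtain rfl : v = ⟨k, hk⟩ := Fin.ext h
        have := (not_iff_not.2 (eval_terminal ht (y := 53) (x := ⟨k, hk⟩) hk')).2 h'
        simp only [Expr.not, Expr.eval]
        omega
      · rw [ih v (by omega), if_pos h']
      · rw [ih v (by omega), if_neg h']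
  have ag₁ : Agree [53] [10] s s₁ := (agree_run _ _).mono (by decide) (by decide)
  have c₁ : Ctx I w B s₁ := hs.agree ag₁ (by decide) (by decide) (by decide) (by decide)
    (by decide) (by decide)
  have hm : mask I.n s₁ 3 = mask I.n s 3 := mask_congr (ag₁.2 3 (by decide))
  have hf := loopTo_filters (I := I) (s := s₁) (r := 30)
    (p := .loopTo 31 1 (.loopTo 52 1 pruneStep))
    c₁.reg_n (fun a x => ∀ b r, r ∈ I.R →
      ((I.G.deleteEdges {s(a, b)}).within (mask I.n s 3)).Reachable r x) (by
    intro a t hag ha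
    have ct : Ctx I w B t := c₁.agree hag (by decide) (by decide) (by decide) (by decide)
      (by decide) (by decide)
    refine loopTo_filters ct.reg_n _ fun b u hagu hb => ?_
    have cu : Ctx I w B u := ct.agree hagu (by decide) (by decide) (by decide) (by decide)
      (by decide) (by decide)
    refine loopTo_filters cu.reg_n _ fun r u' hagu' hr => ?_
    have cu' : Ctx I w B u' := cu.agree hagu' (by decide) (by decide) (by decide) (by decide)
      (by decide) (by decide)
    have := pruneStep_spec cu' (a := a) (b := b) (r := r)
      (by rw [hagu'.1 30 (by decide), hagu.1 30 (by decide), ha])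
      (by rw [hagu'.1 31 (by decide), hb]) hr
    rwa [mask_congr (hagu'.2 3 (by decide)), mask_congr (hagu.2 3 (by decide)),
      mask_congr (hag.2 3 (by decide)), hm] at this)
  obtain ⟨hf1, hf2⟩ := hf x
  split_ifs with hx
  · rw [hA] at hx
    rw [hf1 hx.2, h10, if_neg hx.1]
  · by_cases hxR : x ∈ I.R
    · by_cases hc : ∀ a b, ∀ r ∈ I.R,
          ((I.G.deleteEdges {s(a, b)}).within (mask I.n s 3)).Reachable r x
      · rw [hf1 hc, h10, if_pos hxR]
      · exact hf2 hc
    · exact hf2 fun hc => hx ((hA x).2 ⟨hxR, hc⟩)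

theorem writeOut_spec {s : State} (hs : Ctx I w B s) :
    (writeOut.run s).output = (List.range I.n).map (s.arr 10) := by
  have := loopTo_induction (s := s) (r := 54) (b := 1) (p := .store 0 (.reg 54) (.get 10 (.reg 54)))
    (I := fun k t => ∀ x < k, t.arr 0 x = s.arr 10 x)
    (fun _ _ _ h => h) (fun v hv => absurd hv (by omega)) ?_
  · rw [hs.reg_n] at this
    rw [writeOut, run_seq, run_assign]
    set t := (Cmd.loopTo 54 1 (.store 0 (.reg 54) (.get 10 (.reg 54)))).run s with ht
    have e1 : t.reg 1 = I.n := by rw [ht, run_reg (by decide), hs.reg_n]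
    simp only [State.output, Expr.eval, e1, setReg_reg, if_true, setReg_arr]
    exact List.map_congr_left fun x hx => this x (List.mem_range.1 hx)
  · intro k hk t hag hk' ih x hx
    have e10 : t.arr 10 = s.arr 10 := hag.2 10 (by decide)
    simp only [run_store, Expr.eval, hk', setArr_arr, true_and, e10]
    split_ifs with h
    · rw [h]
    · exact ih x (by omega)

/-- What the program computes: the pruned result of a chain of rounds with doubling thresholds. -/
theorem main_spec {s : State} (hs : Input I B s) (hB : I.n * I.n < 2 ^ B)
    (hc : ∀ v : Fin I.n, (I.c v).num < 2 ^ B ∧ (I.c v).den < 2 ^ B) :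
    ∃ (A : Finset (Fin I.n)) (Ms : ℕ → Finset (Fin I.n)), (main.run s).output = I.encodeSet A ∧
      Ms 0 = I.R ∧ (∀ k < B, I.Level (weight I) (2 ^ k) (Ms k) (Ms (k + 1))) ∧
      ∀ x, x ∈ A ↔ x ∉ I.R ∧
        ∀ a b, ∀ r ∈ I.R, ((I.G.deleteEdges {s(a, b)}).within (Ms B)).Reachable r x := by
  classical
  simp only [main, run_seq]
  obtain ⟨g1, g2⟩ := setOffsets_spec hs
  set s₁ := setOffsets.run s with hs₁
  have ag₁ : Agree [3, 50] [1] s s₁ := (agree_run _ _).mono (by decide) (by decide)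
  have c₁ : Input I B s₁ := hs.agree ag₁ (by decide) (by decide) (by decide)
  have hw := setWeights_spec c₁ g1 hc
  set s₂ := setWeights.run s₁ with hs₂
  have ag₂ : Agree [10, 11, 12, 13, 50, 51] [2] s₁ s₂ :=
    (agree_run _ _).mono (by decide) (by decide)
  have c₂' : Input I B s₂ := c₁.agree ag₂ (by decide) (by decide) (by decide)
  have c₂ : Ctx I (weight I) B s₂ :=
    { reg_n := c₂'.reg_n
      reg_B := c₂'.reg_B
      reg_sq := by rw [ag₂.1 3 (by decide), g1]
      off := by rw [ag₂.2 1 (by decide)]; exact g2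
      weight := hw
      adj := c₂'.adj
      tree := c₂'.tree
      terminal := c₂'.terminal }
  obtain ⟨hm₃, h40⟩ := setStart_spec c₂
  set s₃ := setStart.run s₂ with hs₃
  have c₃ : Ctx I (weight I) B s₃ := c₂.agree (agree_run _ _) (by decide) (by decide) (by decide)
    (by decide) (by decide) (by decide)
  obtain ⟨Ms, hMs0, hMs, hMsB⟩ := allRounds_spec c₃ hB h40 hm₃
  set s₄ := allRounds.run s₃ with hs₄
  have c₄ : Ctx I (weight I) B s₄ := c₃.agree (agree_run _ _) (by decide) (by decide) (by decide)
    (by decide) (by decide) (by decide)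
  let A : Finset (Fin I.n) := univ.filter fun x => x ∉ I.R ∧ ∀ a b, ∀ r ∈ I.R,
    ((I.G.deleteEdges {s(a, b)}).within (Ms B)).Reachable r x
  have hA : ∀ x, x ∈ A ↔ x ∉ I.R ∧ ∀ a b, ∀ r ∈ I.R,
      ((I.G.deleteEdges {s(a, b)}).within (Ms B)).Reachable r x := fun x => by
    rw [mem_filter_univ]
  have hpr := prune_spec c₄ (A := A) (by rw [hMsB]; exact hA)
  set s₅ := prune.run s₄ with hs₅
  have c₅ : Ctx I (weight I) B s₅ := c₄.agree (agree_run _ _) (by decide) (by decide) (by decide)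
    (by decide) (by decide) (by decide)
  refine ⟨A, Ms, ?_, hMs0, hMs, hA⟩
  rw [writeOut_spec c₅, NWSTAP.encodeSet]
  refine List.ext_getElem (by simp) fun i h1 h2 => ?_
  have hi : i < I.n := by simpa using h1
  simp only [List.getElem_map, List.getElem_range, List.getElem_ofFn]
  exact hpr ⟨i, hi⟩

end RAM

/-! ### Reading the input and computing its bit length -/

namespace RAM

/-- Add the binary length of register `5` to register `2` and clear register `5`. -/
def addSize : Prog :=
  .loop (.reg 5) (.seq (.assign 5 (.half (.reg 5))) (.assign 2 (.add (.reg 2) (.lit 1))))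

/-- Add the size of the entry of the input at the position in register `4` to register `2`, and
move to the next position. -/
def addEntry : Prog :=
  .seq (.assign 5 (.get 0 (.reg 4)))
    (.seq addSize (.seq (.assign 2 (.add (.reg 2) (.lit 1))) (.assign 4 (.add (.reg 4) (.lit 1)))))

/-- Store the first entry of the input in register `1` and its bit length in register `2`. -/
def readInput : Prog :=
  .seq (.loop (.sub (.reg 0) (.reg 4)) addEntry) (.assign 1 (.get 0 (.lit 0)))

/-- Every bit takes 2 steps for the test, 3 for the halving and 4 for the counter; the final test
takes 2. -/
theorem exec_addSize (m : ℕ) : ∀ s : State, s.reg 5 = m →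
    Exec addSize s (9 * m.size + 2) ((s.setReg 2 (s.reg 2 + m.size)).setReg 5 0) := by
  induction m using Nat.strong_induction_on with
  | _ m ih =>
    intro s hs
    rcases Nat.eq_zero_or_pos m with rfl | hm
    · have : (s.setReg 2 (s.reg 2 + Nat.size 0)).setReg 5 0 = s := by
        ext r
        · by_cases h5 : r = 5 <;> by_cases h2 : r = 2 <;> simp [State.setReg_reg, *]
        · rfl
      rw [this]
      exact Exec.loop_false hs
    · have hsize : m.size = (m / 2).size + 1 := by
        conv_lhs => rw [← Nat.bit_bodd_div2 m]
        rw [Nat.size_bit, Nat.div2_val]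
        rw [Nat.bit_bodd_div2]; omega
      have h1 := Exec.assign 5 (.half (.reg 5)) s
      have h2 := Exec.assign 2 (.add (.reg 2) (.lit 1)) (s.setReg 5 (Expr.eval s (.half (.reg 5))))
      have h3 := ih (m / 2) (by omega)
        ((s.setReg 5 (Expr.eval s (.half (.reg 5)))).setReg 2
          (Expr.eval (s.setReg 5 (Expr.eval s (.half (.reg 5)))) (.add (.reg 2) (.lit 1))))
        (by simp [State.setReg_reg, Expr.eval, hs])
      have h4 : Exec addSize _ _ _ :=
        Exec.loop_true (e := .reg 5) (by simp [Expr.eval, hs]; omega) (h1.seq h2) h3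
      convert h4 using 1
      · simp [Expr.cost, hsize]; ring
      · ext r
        · by_cases h5 : r = 5 <;> by_cases h2 : r = 2 <;>
            simp [State.setReg_reg, Expr.eval, *]
          all_goals omega
        · rfl

theorem exec_addEntry (s : State) :
    Exec addEntry s (9 * (s.arr 0 (s.reg 4)).size + 13)
      (((s.setReg 5 0).setReg 2 (s.reg 2 + ((s.arr 0 (s.reg 4)).size + 1))).setReg 4
        (s.reg 4 + 1)) := by
  have h1 := Exec.assign 5 (.get 0 (.reg 4)) s
  have h2 := exec_addSize _ _ (show (s.setReg 5 (Expr.eval s (.get 0 (.reg 4)))).reg 5 = _ by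
    rw [State.setReg_reg, if_pos rfl])
  have h := h1.seq (h2.seq ((Exec.assign 2 (.add (.reg 2) (.lit 1)) _).seq
    (Exec.assign 4 (.add (.reg 4) (.lit 1)) _)))
  rw [addEntry]
  convert h using 1
  · simp [Expr.cost, Expr.eval]; ring
  · ext r
    · by_cases h5 : r = 5 <;> by_cases h2 : r = 2 <;> by_cases h4 : r = 4 <;>
        simp [State.setReg_reg, Expr.eval, *]
      all_goals omega
    · rfl

/-- An entry takes 9 * size + 13 steps plus 4 for the test, at most 17 times its share size + 1 of
the bit length. -/
theorem exec_addEntries (x : List ℕ) : ∀ s : State, s.reg 4 + x.length = s.reg 0 →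
    (∀ i < x.length, s.arr 0 (s.reg 4 + i) = x.getD i 0) →
    ∃ t s', Exec (.loop (.sub (.reg 0) (.reg 4)) addEntry) s t s' ∧ t ≤ 17 * bitLength x + 4 ∧
      s'.reg 2 = s.reg 2 + bitLength x ∧ s'.arr = s.arr := by
  induction x with
  | nil =>
    intro s h0 _
    exact ⟨4, s, Exec.loop_false (by simp [Expr.eval]; simp at h0; omega), by simp,
      by simp [bitLength], rfl⟩
  | cons a x ih =>
    intro s h0 hx
    have ha : s.arr 0 (s.reg 4) = a := by simpa using hx 0 (by simp)
    have h1 := exec_addEntry s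
    rw [ha] at h1
    obtain ⟨t, s', h2, ht, h3, h4⟩ := ih (((s.setReg 5 0).setReg 2
      (s.reg 2 + (a.size + 1))).setReg 4 (s.reg 4 + 1)) (by
      simp [State.setReg_reg] at h0 ⊢
      omega) (by
      intro i hi
      have := hx (i + 1) (by simpa using hi)
      simp only [List.getD_cons_succ] at this
      rw [← this]
      simp [State.setReg_reg, State.setReg_arr, add_assoc, add_comm 1])
    refine ⟨_, s', Exec.loop_true (by simp [Expr.eval]; simp at h0; omega) h1 h2, ?_, ?_, ?_⟩
    · simp only [Expr.cost, bitLength, List.map_cons, List.sum_cons] at ht ⊢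
      omega
    · rw [h3]
      simp [State.setReg_reg, bitLength]
      omega
    · rw [h4]; rfl

theorem exec_readInput (x : List ℕ) : ∃ t s, Exec readInput (.init x) t s ∧
    t ≤ 17 * bitLength x + 7 ∧ s.reg 1 = x.getD 0 0 ∧ s.reg 2 = bitLength x ∧
      s.arr 0 = fun i => x.getD i 0 := by
  obtain ⟨t, s, h, ht, h2, ha⟩ := exec_addEntries x (.init x) (by simp [State.init])
    (fun i _ => by simp [State.init])
  refine ⟨_, _, h.seq (Exec.assign 1 (.get 0 (.lit 0)) s), ?_, ?_, ?_, ?_⟩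
  · simp only [Expr.cost]
    omega
  · simp [State.setReg_reg, Expr.eval, ha, State.init]
  · simp [State.setReg_reg, h2, State.init]
  · rw [State.setReg_arr, ha]
    simp [State.init]

end RAM

/-! ### Decoding an instance -/

namespace List

theorem length_flatMap_of_forall {α β : Type*} {f : α → List β} {m : ℕ} (hf : ∀ a, (f a).length = m)
    (l : List α) : (l.flatMap f).length = l.length * m := by
  induction l with
  | nil => simp
  | cons a l ih => rw [flatMap_cons, length_append, ih, hf, length_cons]; ring

theorem getD_flatMap_of_forall {α β : Type*} {f : α → List β} {m : ℕ} (hf : ∀ a, (f a).length = m)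
    (d : β) {j : ℕ} (hj : j < m) (l : List α) :
    ∀ (i : ℕ) (hi : i < l.length), (l.flatMap f).getD (i * m + j) d = (f l[i]).getD j d := by
  induction l with
  | nil => intro i hi; simp at hi
  | cons a l ih =>
    intro i hi
    rw [flatMap_cons]
    cases i with
    | zero => rw [zero_mul, zero_add, getD_append _ _ _ _ (by rw [hf]; exact hj)]; rfl
    | succ i =>
      rw [getD_append_right _ _ _ _ (by rw [hf, Nat.succ_mul]; omega), hf,
        show (i + 1) * m + j - m = i * m + j by rw [Nat.succ_mul]; omega,
        ih i (by simpa using hi)]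
      rfl

end List

namespace RAM

theorem bitLength_append (x y : List ℕ) : bitLength (x ++ y) = bitLength x + bitLength y := by
  simp [bitLength]

theorem length_le_bitLength (x : List ℕ) : x.length ≤ bitLength x := by
  induction x with
  | nil => simp
  | cons a x ih =>
    simp only [bitLength, List.length_cons, List.map_cons, List.sum_cons] at ih ⊢
    omega

theorem bitLength_flatMap {α : Type*} (f : α → List ℕ) (l : List α) :
    bitLength (l.flatMap f) = (l.map fun a => bitLength (f a)).sum := by
  induction l with
  | nil => simp [bitLength]
  | cons a l ih => rw [List.flatMap_cons, bitLength_append, ih, List.map_cons, List.sum_cons]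

variable (I : NWSTAP)

theorem length_encodeRel (r : Fin I.n → Fin I.n → Prop) :
    (I.encodeRel r).length = I.n * I.n := by
  rw [NWSTAP.encodeRel, List.length_flatMap_of_forall (m := I.n) (by simp)]
  simp

theorem length_encodeSet (S : Finset (Fin I.n)) : (I.encodeSet S).length = I.n := by
  simp [NWSTAP.encodeSet]

theorem index_lt (u v : Fin I.n) : u * I.n + v < I.n * I.n := by
  have := Nat.mul_le_mul_right I.n (Nat.succ_le_of_lt u.2)
  rw [Nat.succ_mul] at this
  have := v.2
  omega

theorem getD_encodeRel (r : Fin I.n → Fin I.n → Prop) (u v : Fin I.n) :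
    (I.encodeRel r).getD (u * I.n + v) 0 ≠ 0 ↔ r u v := by
  rw [NWSTAP.encodeRel, List.getD_flatMap_of_forall (m := I.n) (by simp) _ v.2 _ u (by simp)]
  simp [List.getD_eq_getElem?_getD]

theorem getD_encodeSet (S : Finset (Fin I.n)) (v : Fin I.n) :
    (I.encodeSet S).getD v 0 ≠ 0 ↔ v ∈ S := by
  simp [NWSTAP.encodeSet, List.getD_eq_getElem?_getD]

/-- The segments of the encoding have lengths 1, n², n², n and 2n, and the last consists of blocks
of length two; each position is located by peeling off segments. -/
theorem input_of_arr {B : ℕ} {s : State} (h1 : s.reg 1 = I.encode.getD 0 0) (h2 : s.reg 2 = B)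
    (h0 : s.arr 0 = fun i => I.encode.getD i 0) : Input I B s := by
  have hG := length_encodeRel I I.G.Adj
  have hT := length_encodeRel I I.T.Adj
  have hR := length_encodeSet I I.R
  have hc : ∀ (v : Fin I.n) (j : ℕ) (hj : j < 2),
      s.arr 0 (1 + I.n * I.n + I.n * I.n + I.n + (v * 2 + j)) =
        [(I.c v).num, (I.c v).den].getD j 0 := by
    intro v j hj
    rw [h0]
    simp only [NWSTAP.encode]
    rw [List.getD_append_right _ _ _ _ (by simp [hG, hT, hR]; omega)]
    simp only [List.length_append, hG, hT, hR, List.length_singleton]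
    rw [Nat.add_sub_cancel_left]
    rw [List.getD_flatMap_of_forall (m := 2) (by simp) _ hj _ v (by simp)]
    simp
  refine ⟨by rw [h1]; simp [NWSTAP.encode], h2, fun u v => ?_, fun u v => ?_, fun v => ?_,
    fun v => ?_, fun v => ?_⟩
  · have := index_lt I u v
    rw [← getD_encodeRel I I.G.Adj, h0]
    simp only [NWSTAP.encode]
    rw [List.getD_append _ _ _ _ (by simp [hG, hT, hR]; omega),
      List.getD_append _ _ _ _ (by simp [hG, hT]; omega),
      List.getD_append _ _ _ _ (by simp [hG]; omega),
      List.getD_append_right _ _ _ _ (by simp; omega), List.length_singleton, add_assoc,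
      Nat.add_sub_cancel_left]
  · have := index_lt I u v
    rw [← getD_encodeRel I I.T.Adj, h0]
    simp only [NWSTAP.encode]
    rw [List.getD_append _ _ _ _ (by simp [hG, hT, hR]; omega),
      List.getD_append _ _ _ _ (by simp [hG, hT]; omega),
      List.getD_append_right _ _ _ _ (by simp [hG]; omega), List.length_append,
      List.length_singleton, hG, add_assoc _ (_ * _) (v : ℕ), Nat.add_sub_cancel_left]
  · have := v.2
    rw [← getD_encodeSet I I.R, h0]
    simp only [NWSTAP.encode]
    rw [List.getD_append _ _ _ _ (by simp [hG, hT, hR]; omega),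
      List.getD_append_right _ _ _ _ (by simp [hG, hT]; omega), List.length_append,
      List.length_append, List.length_singleton, hG, hT, Nat.add_sub_cancel_left]
  · rw [← mul_two]
    exact hc v 0 (by simp)
  · rw [← mul_two, add_assoc]
    exact hc v 1 (by simp)

/-! ### Size estimates and the scaling of costs -/

theorem n_pos : 0 < I.n := by
  obtain ⟨r, -⟩ := I.R_nonempty
  exact r.pos

/-- The total binary length of the costs. -/
def costSize : ℕ := ∑ v, ((I.c v).num.size + (I.c v).den.size)

/-- The separators of all entries account for the polynomial terms, the binary digits of the costs
for `costSize`. All comparisons with 2 ^ B below rest on this bound. -/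
theorem le_bitLength_encode :
    2 * (I.n * I.n) + 3 * I.n + 2 + costSize I ≤ bitLength I.encode := by
  simp only [NWSTAP.encode, bitLength_append, bitLength_flatMap]
  have hn : 2 ≤ bitLength [I.n] := by
    have := Nat.size_pos.2 (n_pos I)
    simp only [bitLength, List.map_singleton, List.sum_singleton]
    omega
  have hG := length_le_bitLength (I.encodeRel I.G.Adj)
  have hT := length_le_bitLength (I.encodeRel I.T.Adj)
  have hR := length_le_bitLength (I.encodeSet I.R)
  rw [length_encodeRel] at hG hT
  rw [length_encodeSet] at hR
  have hc : ((List.finRange I.n).map fun v => bitLength [(I.c v).num, (I.c v).den]).sum =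
      costSize I + 2 * I.n := by
    rw [← List.ofFn_eq_map, List.sum_ofFn, costSize]
    simp only [bitLength, List.map_cons, List.map_nil, List.sum_cons, List.sum_nil, add_zero]
    rw [Finset.sum_congr rfl fun v _ => show (I.c v).num.size + 1 + ((I.c v).den.size + 1) =
      (I.c v).num.size + (I.c v).den.size + 2 by ring, Finset.sum_add_distrib]
    simp [mul_comm]
  omega

theorem weight_le (v : Fin I.n) : weight I v ≤ 4 * (I.n * I.n) * 2 ^ costSize I := by
  rw [weight, costSize, ← Finset.prod_pow_eq_pow_sum]
  refine Nat.mul_le_mul_left _ (Finset.prod_le_prod' fun u _ => ?_)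
  split_ifs
  · exact (Nat.lt_size_self _).le.trans (Nat.pow_le_pow_right two_pos (by omega))
  · exact (Nat.lt_size_self _).le.trans (Nat.pow_le_pow_right two_pos (by omega))

theorem num_den_lt (v : Fin I.n) :
    (I.c v).num < 2 ^ bitLength I.encode ∧ (I.c v).den < 2 ^ bitLength I.encode := by
  have h1 : (I.c v).num.size + (I.c v).den.size ≤ costSize I :=
    Finset.single_le_sum (f := fun v => (I.c v).num.size + (I.c v).den.size)
      (fun _ _ => Nat.zero_le _) (Finset.mem_univ v)
  have h2 := le_bitLength_encode I
  exact ⟨(Nat.lt_size_self _).trans_le (Nat.pow_le_pow_right two_pos (by omega)),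
    (Nat.lt_size_self _).trans_le (Nat.pow_le_pow_right two_pos (by omega))⟩

theorem sq_lt_two_pow_bitLength : I.n * I.n < 2 ^ bitLength I.encode := by
  have h1 : I.n < 2 ^ I.n := Nat.lt_two_pow_self
  calc I.n * I.n < 2 ^ I.n * 2 ^ I.n := Nat.mul_lt_mul'' h1 h1
    _ = 2 ^ (I.n + I.n) := (pow_add _ _ _).symm
    _ ≤ _ := Nat.pow_le_pow_right two_pos (by have := le_bitLength_encode I; omega)

/-- This makes the last of the B thresholds large enough. The polynomial factors are at most 2 (2n)⁴
≤ 2 ^ (4n + 1), which the quadratic part of the bit length dominates. -/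
theorem total_weight_lt :
    (Nat.log 2 I.R.card + 2) * (∑ x, weight I x) * 2 < 2 ^ bitLength I.encode := by
  have hn := n_pos I
  have hlog : Nat.log 2 I.R.card + 2 ≤ 3 * I.n := by
    have h1 : Nat.log 2 I.R.card ≤ I.R.card := Nat.log_le_self _ _
    have h2 : I.R.card ≤ I.n := by simpa using I.R.card_le_univ
    omega
  have hsum : ∑ x, weight I x ≤ I.n * (4 * (I.n * I.n) * 2 ^ costSize I) := by
    simpa using Finset.sum_le_card_nsmul univ (weight I) _ fun v _ => weight_le I v
  have h2n : 2 * I.n ≤ 2 ^ I.n := by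
    obtain ⟨m, hm⟩ : ∃ m, I.n = m + 1 := ⟨I.n - 1, by omega⟩
    have : m < 2 ^ m := Nat.lt_two_pow_self
    rw [hm, pow_succ]
    omega
  calc (Nat.log 2 I.R.card + 2) * (∑ x, weight I x) * 2
      ≤ 3 * I.n * (I.n * (4 * (I.n * I.n) * 2 ^ costSize I)) * 2 :=
        Nat.mul_le_mul_right _ (Nat.mul_le_mul hlog hsum)
    _ = 24 * I.n ^ 4 * 2 ^ costSize I := by ring
    _ < 32 * I.n ^ 4 * 2 ^ costSize I := by
        have : 0 < I.n ^ 4 * 2 ^ costSize I := by positivity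
        nlinarith
    _ = 2 * (2 * I.n) ^ 4 * 2 ^ costSize I := by ring
    _ ≤ 2 * (2 ^ I.n) ^ 4 * 2 ^ costSize I := by gcongr
    _ = 2 ^ (4 * I.n + 1 + costSize I) := by ring
    _ ≤ _ := Nat.pow_le_pow_right two_pos (by
        have := le_bitLength_encode I
        have : I.n ≤ I.n * I.n := Nat.le_mul_self _
        omega)

theorem weight_terminal {v : Fin I.n} (hv : v ∈ I.R) : weight I v = 0 := by
  have : ∏ u : Fin I.n, (if u = v then (I.c u).num else (I.c u).den) = 0 :=
    Finset.prod_eq_zero (Finset.mem_univ v) (by simp [I.c_terminal v hv])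
  rw [weight, this, mul_zero]

theorem two_mul_card_sq_lt : 2 * I.R.card ^ 2 < 4 * (I.n * I.n) := by
  have h1 : I.R.card ≤ I.n := by simpa using I.R.card_le_univ
  have := Nat.pow_le_pow_left h1 2
  have := n_pos I
  nlinarith

/-- The factor is the same for all vertices, so passing to integral weights preserves the ratio of
costs. -/
theorem weight_eq_mul_cost (v : Fin I.n) :
    (weight I v : ℝ) = ((4 * (I.n * I.n) * ∏ u, (I.c u).den : ℕ) : ℝ) * ((I.c v : ℚ≥0) : ℝ) := by
  have hden : ((I.c v).den : ℝ) ≠ 0 := by exact_mod_cast (I.c v).den_ne_zero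
  have hc : ((I.c v : ℚ≥0) : ℝ) = (I.c v).num / (I.c v).den :=
    NNRat.cast_def _
  have h1 : ∏ u : Fin I.n, (if u = v then (I.c u).num else (I.c u).den) =
      (I.c v).num * ∏ u ∈ univ.erase v, (I.c u).den := by
    rw [← Finset.mul_prod_erase _ _ (Finset.mem_univ v), if_pos rfl]
    congr 1
    exact Finset.prod_congr rfl fun u hu => if_neg (Finset.ne_of_mem_erase hu)
  rw [weight, h1, ← Finset.mul_prod_erase univ (fun u => (I.c u).den) (Finset.mem_univ v), hc]
  push_cast
  field_simp

theorem sum_weight (S : Finset (Fin I.n)) : ((∑ v ∈ S, weight I v : ℕ) : ℝ) =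
    ((4 * (I.n * I.n) * ∏ u, (I.c u).den : ℕ) : ℝ) * (I.cost S : ℝ) := by
  rw [NWSTAP.cost, NNRat.cast_sum, Finset.mul_sum, Nat.cast_sum]
  exact Finset.sum_congr rfl fun v _ => weight_eq_mul_cost I v

end RAM

/-! ### The approximation theorem -/

open RAM in
theorem theorem2 :
    ∃ A : (I : NWSTAP) → Finset (Fin I.n),
      RAM.PolyTimeComputable NWSTAP.encode (fun I => I.encodeSet (A I)) ∧
      ∃ C : ℝ, ∀ I : NWSTAP, (∃ S, I.Feasible S) →
        I.Feasible (A I) ∧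
        ∀ S, I.Feasible S →
          (I.cost (A I) : ℝ) ≤ C * Real.log (I.R.card : ℝ) ^ 2 * (I.cost S : ℝ) := by
  choose tp sp hexec htp h1 h2 h0 using fun I : NWSTAP => exec_readInput I.encode
  have hin := fun I => input_of_arr I (h1 I) (h2 I) (h0 I)
  choose A Ms hout hM0 hlev hA using fun I =>
    main_spec (hin I) (sq_lt_two_pow_bitLength I) (num_den_lt I)
  refine ⟨A, ⟨.seq readInput Cmd.main.compile,
    17 * Polynomial.X + 7 + Cmd.main.timeBound, fun I => ?_⟩, 100, fun I hfeas => ?_⟩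
  · obtain ⟨t, ht, htb⟩ := Cmd.exec_compile (X := bitLength I.encode) Cmd.main_wf (sp I) (by
      have := le_bitLength_encode I
      have e1 := (hin I).reg_n
      have e2 := (hin I).reg_B
      simp only [List.mem_cons, List.not_mem_nil, or_false, forall_eq_or_imp, forall_eq]
      omega)
    refine ⟨_, _, (hexec I).seq ht, ?_, hout I⟩
    have := htp I
    simp only [Polynomial.eval_add, Polynomial.eval_mul, Polynomial.eval_X, Polynomial.eval_ofNat]
    omega
  · have key := fun {S} (hS : I.Feasible S) => I.covers_and_cost_le_of_levels
      (B := bitLength I.encode) (by have := le_bitLength_encode I; omega)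
      (fun v hv => weight_terminal I hv) (fun v => Dvd.intro _ rfl) (two_mul_card_sq_lt I) (hM0 I)
      (hlev I) hS (total_weight_lt I)
    obtain ⟨S₀, hS₀⟩ := hfeas
    have hR : ∀ k ≤ bitLength I.encode, I.R ⊆ Ms I k := by
      intro k hk
      induction k with
      | zero => rw [hM0]
      | succ k ih => exact (ih (by omega)).trans (hlev I k (by omega)).subset
    refine ⟨I.feasible_of_covers (hR _ le_rfl) (key hS₀).1 (hA I), fun S hS => ?_⟩
    have hAM : A I ⊆ Ms I (bitLength I.encode) := by
      intro x hx
      obtain ⟨r, hr⟩ := I.R_nonempty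
      -- The pair (r, r) is not an edge, so its deletion changes nothing and plain connection inside
      -- the final set remains.
      exact (((hA I x).1 hx).2 r r r hr).mem_of_within (hR _ le_rfl hr)
    have hle : ((∑ x ∈ A I, weight I x : ℕ) : ℝ) ≤
        ((∑ x ∈ Ms I (bitLength I.encode), weight I x : ℕ) : ℝ) :=
      Nat.cast_le.2 (Finset.sum_le_sum_of_subset hAM)
    have h := hle.trans (key hS).2
    rw [sum_weight, sum_weight] at h
    -- The common scaling factor is positive and cancels.
    refine le_of_mul_le_mul_left (h.trans_eq (by ring)) (Nat.cast_pos.2 ?_)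
    have := n_pos I
    have : 0 < ∏ u, (I.c u).den := Finset.prod_pos fun u _ => (I.c u).den_pos
    positivity
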